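/- Let $n$ be a natural number and let $W$ be one of the Weyl groups $W_{A_{n-1}}=S_n$ ($n\ge 1$), $W_{D_n}$ ($n\ge 4$), $W_{B_n}$ ($n\ge 2$), with Coxeter matrix $(m_{ij})$. The simple reflections $s_i$ are indexed by $1\le i\le n-1$ in type $A_{n-1}$ and by $1\le i\le n$ in types $D_n$ and $B_n$; $s_1,\dots,s_{n-1}$ form a chain with unmarked bonds (for $k\le n-1$, $s_k$ is the transposition $(k,k+1)$), and $s_n$ is joined only to $s_{n-1}$, by a bond marked $4$, in type $B_n$, and only to $s_{n-2}$, by an unmarked bond, in type $D_n$. Let $\widetilde W$ be the group generated by $z$ and $\tilde t_i$ (one for each simple reflection) with relations: $z$ is central, $z^2=1$, $\tilde t_i^2=1$, $\tilde t_i\tilde t_j\tilde t_i=\tilde t_j\tilde t_i\tilde t_j$ if $m_{ij}=3$, $\tilde t_i\tilde t_j=z\tilde t_j\tilde t_i$ if $m_{ij}=2$, and $(\tilde t_i\tilde t_j)^2=z(\tilde t_j\tilde t_i)^2$ if $m_{ij}=4$. Let $\mathbb C W^-=\mathbb C\widetilde W/\langle z+1\rangle$ be the spin Weyl group algebra, and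 let $t_i$ be the image of $\tilde t_i$ in it. Put $t_{a\uparrow b}=t_at_{a+1}\cdots t_b$ if $a\le b$ and $t_{a\downarrow b}=t_at_{a-1}\cdots t_b$ if $a\ge b$, and let these be $1$ otherwise. For $1\le i<j\le n$ put $$[i,j]=(-1)^{j-i-1}t_{j-1}\cdots t_{i+1}\,t_i\,t_{i+1}\cdots t_{j-1},\qquad [j,i]=-[i,j],$$ $$\overline{[i,j]}=\overline{[j,i]}=\begin{cases}(-1)^{j-i-1}\,t_{j\uparrow n-1}\,t_{i\uparrow n-2}\,t_n\,t_{n-2\downarrow i}\,t_{n-1\downarrow j}&\text{(type }D_n),\\(-1)^{j-i}\,t_{j\uparrow n-1}\,t_{i\uparrow n-2}\,t_nt_{n-1}t_n\,t_{n-2\downarrow i}\,t_{n-1\downarrow j}&\text{(type }B_n),\end{cases}$$ where $t_{n-1\downarrow j}=t_{n-1}t_{n-2}\cdots t_j$; and for $1\le i\le n$, in type $B_n$, put $\overline{[i]}=(-1)^{n-i}t_i\cdots t_{n-1}t_nt_{n-1}\cdots t_i$. Let $u,v\in\mathbb C$ ($v$ is used in type $B_n$ only). The rational spin double affine Hecke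 algebra $\mathcal H^-_W$ is the unital associative $\mathbb C$-algebra generated by $\xi_i,y_i$ ($1\le i\le n$) and $\mathbb C W^-$, subject to the relations $$y_iy_j=y_jy_i,\qquad \xi_i\xi_j=-\xi_j\xi_i\quad(i\ne j),$$ $$t_ky_k=y_{k+1}t_k,\quad t_k\xi_k=-\xi_{k+1}t_k,\quad t_ky_j=y_jt_k,\quad t_k\xi_j=-\xi_jt_k\qquad(1\le k\le n-1,\ j\ne k,k+1),$$ together with - in type $A_{n-1}$: $[y_j,\xi_i]=-u[i,j]$ for $i\ne j$, and $[y_i,\xi_i]=u\sum_{k\ne i}[i,k]$; - in type $D_n$: $t_ny_n=-y_{n-1}t_n$, $t_n\xi_n=-\xi_{n-1}t_n$, $t_ny_j=y_jt_n$ and $t_n\xi_j=-\xi_jt_n$ for $j\ne n-1,n$; $[y_j,\xi_i]=-u[i,j]+u\overline{[i,j]}$ for $i\ne j$, and $[y_i,\xi_i]=u\sum_{k\ne i}\bigl([i,k]+\overline{[i,k]}\bigr)$; - in type $B_n$: $t_ny_n=-y_nt_n$, $t_n\xi_n=-\xi_nt_n$, $t_ny_j=y_jt_n$ and $t_n\xi_j=-\xi_jt_n$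 for $j\ne n$; $[y_j,\xi_i]=-u[i,j]+u\overline{[i,j]}$ for $i\ne j$, and $[y_i,\xi_i]=u\sum_{k\ne i}\bigl([i,k]+\overline{[i,k]}\bigr)+v\,\overline{[i]}$. Here $[y_j,\xi_i]$ denotes the commutator $y_j\xi_i-\xi_iy_j$. Let $\mathcal C[\xi_1,\dots,\xi_n]$ be the skew-polynomial algebra, that is, the $\mathbb C$-algebra generated by $\xi_1,\dots,\xi_n$ subject only to $\xi_i\xi_j=-\xi_j\xi_i$ for $i\ne j$. **Theorem.** The linear map $$\mathcal C[\xi_1,\dots,\xi_n]\otimes\mathbb C W^-\otimes\mathbb C[y_1,\dots,y_n]\longrightarrow\mathcal H^-_W,\qquad a\otimes\sigma\otimes f\longmapsto a\,\sigma\,f,$$ given by the canonical algebra homomorphisms of the three factors into $\mathcal H^-_W$ followed by multiplication, is an isomorphism of vector spaces. Equivalently, for every basis $(b_\sigma)_\sigma$ of $\mathbb C W^-$, the elements $\xi^\alpha\, b_\sigma\, y^\gamma$, with $\alpha,\gamma\in\mathbb Z_{\ge0}^n$ and $\sigma$ running over the index set of the basis, form a basis of $\mathcal H^-_W$, where $\xi^\alpha=\xi_1^{\alpha_1}\cdots\xi_n^{\alpha_n}$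 and $y^\gamma=y_1^{\gamma_1}\cdots y_n^{\gamma_n}$. -/

import Mathlib

/-!
The spin Weyl group algebras and the rational spin double affine Hecke algebras of types
`A_{n-1}`, `D_n` and `B_n`.

All indices are shifted by one so that they start at `0`: the generators `ξ i`, `y i` are indexed
by `i : Fin n`, and for `k + 1 < n` the generator `t k` covers the transposition of the
coordinates `k` and `k + 1`.  In types `D` and `B` there is one more generator, `t (n - 1)`.
-/

open scoped TensorProduct

noncomputable section

namespace SpinDaha

/-- The three classical types; for a natural number `n` they stand for the Weyl groups
`W_{A_{n-1}} = S_n`, `W_{D_n}` and `W_{B_n}`. -/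
inductive ClassicalType
  | A
  | D
  | B

/-- The range of `n` for the group of type `A_{n-1}`, `D_n` or `B_n`. -/
def ClassicalType.Admissible : ClassicalType → ℕ → Prop
  | .A, n => 1 ≤ n
  | .D, n => 4 ≤ n
  | .B, n => 2 ≤ n

/-- The number of simple reflections: `n - 1` for `A_{n-1}`, and `n` for `D_n` and `B_n`. -/
def ClassicalType.rank : ClassicalType → ℕ → ℕ
  | .A, n => n - 1
  | .D, n => n
  | .B, n => n

/-- The entry `m_{ij}` of the Coxeter matrix (with nodes `0, 1, …, rank - 1`).  In type `B_n` the
bond between the last two nodes is marked `4`; in type `D_n` the last node `n - 1` is joined to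
the node `n - 3` only. -/
def ClassicalType.m : ClassicalType → ℕ → ℕ → ℕ → ℕ
  | .A, _, i, j =>
      if i = j then 1
      else if i + 1 = j ∨ j + 1 = i then 3
      else 2
  | .D, n, i, j =>
      if i = j then 1
      else if i + 1 = n then (if j + 3 = n then 3 else 2)
      else if j + 1 = n then (if i + 3 = n then 3 else 2)
      else if i + 1 = j ∨ j + 1 = i then 3
      else 2
  | .B, n, i, j =>
      if i = j then 1
      else if i + 1 = j ∨ j + 1 = i then (if i + 1 = n ∨ j + 1 = n then 4 else 3)
      else 2

/-- Generators of the double cover of `W`: the element `z` and the lifts of the simple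
reflections. -/
inductive CoverGen (T : ClassicalType) (n : ℕ)
  | z : CoverGen T n
  | t : Fin (T.rank n) → CoverGen T n

/-- The element `z` of the free group. -/
def fz (T : ClassicalType) (n : ℕ) : FreeGroup (CoverGen T n) := FreeGroup.of .z

/-- The letter `t_i` of the free group. -/
def ft (T : ClassicalType) (n : ℕ) (i : Fin (T.rank n)) : FreeGroup (CoverGen T n) :=
  FreeGroup.of (.t i)

/-- `IsCoverRelation T n a b`: the equation `a = b` is a defining relation of the double cover
of `W`: the element `z` is central with `z² = 1`, and
`t_i² = 1`, `t_i t_j t_i = t_j t_i t_j` if `m_{ij} = 3`, `t_i t_j = z t_j t_i` if `m_{ij} = 2`,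
`(t_i t_j)² = z (t_j t_i)²` if `m_{ij} = 4`. -/
inductive IsCoverRelation (T : ClassicalType) (n : ℕ) :
    FreeGroup (CoverGen T n) → FreeGroup (CoverGen T n) → Prop
  | z_sq : IsCoverRelation T n (fz T n ^ 2) 1
  | z_central (i : Fin (T.rank n)) :
      IsCoverRelation T n (fz T n * ft T n i) (ft T n i * fz T n)
  | t_sq (i : Fin (T.rank n)) : IsCoverRelation T n (ft T n i ^ 2) 1
  | two (i j : Fin (T.rank n)) (h : T.m n i j = 2) :
      IsCoverRelation T n (ft T n i * ft T n j) (fz T n * (ft T n j * ft T n i))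
  | three (i j : Fin (T.rank n)) (h : T.m n i j = 3) :
      IsCoverRelation T n (ft T n i * ft T n j * ft T n i) (ft T n j * ft T n i * ft T n j)
  | four (i j : Fin (T.rank n)) (h : T.m n i j = 4) :
      IsCoverRelation T n ((ft T n i * ft T n j) ^ 2) (fz T n * (ft T n j * ft T n i) ^ 2)

/-- The distinguished double cover of the Weyl group, by generators and relations. -/
abbrev DoubleCover (T : ClassicalType) (n : ℕ) : Type :=
  PresentedGroup {r : FreeGroup (CoverGen T n) | ∃ a b, IsCoverRelation T n a b ∧ r = a * b⁻¹}

/-- A generator, in the double cover. -/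
def coverOf {T : ClassicalType} {n : ℕ} (g : CoverGen T n) : DoubleCover T n :=
  PresentedGroup.of g

/-- The single relation `z = -1` on the group algebra of the double cover. -/
inductive SpinRel (T : ClassicalType) (n : ℕ) :
    MonoidAlgebra ℂ (DoubleCover T n) → MonoidAlgebra ℂ (DoubleCover T n) → Prop
  | z_eq : SpinRel T n (MonoidAlgebra.of ℂ (DoubleCover T n) (coverOf .z)) (-1)

/-- The spin Weyl group algebra: the quotient of the group algebra of the double cover by the
two-sided ideal generated by `z + 1`. -/
def SpinWeyl (T : ClassicalType) (n : ℕ) : Type := RingQuot (SpinRel T n)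

instance (T : ClassicalType) (n : ℕ) : Ring (SpinWeyl T n) :=
  inferInstanceAs (Ring (RingQuot (SpinRel T n)))

instance (T : ClassicalType) (n : ℕ) : Algebra ℂ (SpinWeyl T n) :=
  inferInstanceAs (Algebra ℂ (RingQuot (SpinRel T n)))

/-- The quotient map from the group algebra of the double cover. -/
def spinMk (T : ClassicalType) (n : ℕ) :
    MonoidAlgebra ℂ (DoubleCover T n) →ₐ[ℂ] SpinWeyl T n :=
  RingQuot.mkAlgHom ℂ (SpinRel T n)

/-- The generator `t_k` of the spin Weyl group algebra, for `k < rank`; it is only used for such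
`k`, and set to `1` for other natural numbers. -/
def t (T : ClassicalType) (n : ℕ) (k : ℕ) : SpinWeyl T n :=
  if h : k < T.rank n then
    spinMk T n (MonoidAlgebra.of ℂ (DoubleCover T n) (coverOf (.t ⟨k, h⟩)))
  else 1

/-- The increasing product `t_a t_{a+1} ⋯ t_{b-1}`; it is `1` if `b ≤ a`. -/
def tUp (T : ClassicalType) (n a b : ℕ) : SpinWeyl T n :=
  ((List.Ico a b).map (t T n)).prod

/-- The decreasing product `t_{b-1} ⋯ t_{a+1} t_a`; it is `1` if `b ≤ a`. -/
def tDown (T : ClassicalType) (n b a : ℕ) : SpinWeyl T n :=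
  ((List.Ico a b).reverse.map (t T n)).prod

/-- `[i, j]` for `i < j`: the element
`(-1)^{j-i-1} t_{j-1} ⋯ t_{i+1} t_i t_{i+1} ⋯ t_{j-1}`. -/
def bracketLt (T : ClassicalType) (n i j : ℕ) : SpinWeyl T n :=
  (-1) ^ (j - i - 1) * (tDown T n j (i + 1) * t T n i * tUp T n (i + 1) j)

/-- `[i, j]` for `i ≠ j`, with `[j, i] = -[i, j]`. -/
def bracket (T : ClassicalType) (n : ℕ) (i j : Fin n) : SpinWeyl T n :=
  if i < j then bracketLt T n i j else -bracketLt T n j i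

/-- The barred `[i, j]` for `i < j`.  With 0-based indices it is
`(-1)^{j-i-1} (t_j ⋯ t_{n-2}) (t_i ⋯ t_{n-3}) t_{n-1} (t_{n-3} ⋯ t_i) (t_{n-2} ⋯ t_j)` in
type `D_n`, and in type `B_n` the middle factor `t_{n-1}` is replaced by
`-t_{n-1} t_{n-2} t_{n-1}`.  It does not occur in type `A`. -/
def barBracketLt (T : ClassicalType) (n i j : ℕ) : SpinWeyl T n :=
  match T with
  | .A => 0
  | .D => (-1) ^ (j - i - 1) *
      (tUp .D n j (n - 1) * tUp .D n i (n - 2) * t .D n (n - 1) *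
        tDown .D n (n - 2) i * tDown .D n (n - 1) j)
  | .B => (-1) ^ (j - i) *
      (tUp .B n j (n - 1) * tUp .B n i (n - 2) *
        (t .B n (n - 1) * t .B n (n - 2) * t .B n (n - 1)) *
        tDown .B n (n - 2) i * tDown .B n (n - 1) j)

/-- The barred `[i, j]` for `i ≠ j`, symmetric in `i` and `j`. -/
def barBracket (T : ClassicalType) (n : ℕ) (i j : Fin n) : SpinWeyl T n :=
  if i < j then barBracketLt T n i j else barBracketLt T n j i

/-- The barred `[i]` in type `B_n`: with 0-based indices it is
`(-1)^{n-1-i} t_i ⋯ t_{n-2} t_{n-1} t_{n-2} ⋯ t_i`. -/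
def barSingle (n : ℕ) (i : Fin n) : SpinWeyl .B n :=
  (-1) ^ (n - 1 - (i : ℕ)) *
    (tUp .B n i (n - 1) * t .B n (n - 1) * tDown .B n (n - 1) i)

/-- The value of `[y_j, ξ_i]` for `i ≠ j`. -/
def offDiag (T : ClassicalType) (n : ℕ) (u : ℂ) (i j : Fin n) : SpinWeyl T n :=
  match T with
  | .A => -(u • bracket .A n i j)
  | .D => -(u • bracket .D n i j) + u • barBracket .D n i j
  | .B => -(u • bracket .B n i j) + u • barBracket .B n i j

/-- The value of `[y_i, ξ_i]`.  The parameter `v` occurs in type `B` only. -/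
def diag (T : ClassicalType) (n : ℕ) (u v : ℂ) (i : Fin n) : SpinWeyl T n :=
  match T with
  | .A => u • ∑ k ∈ Finset.univ.erase i, bracket .A n i k
  | .D => u • ∑ k ∈ Finset.univ.erase i, (bracket .D n i k + barBracket .D n i k)
  | .B => u • ∑ k ∈ Finset.univ.erase i, (bracket .B n i k + barBracket .B n i k)
      + v • barSingle n i

/-- Generators of the rational spin double affine Hecke algebra: `ξ_i`, `y_i` and the elements of
the spin Weyl group algebra. -/
inductive Gen (T : ClassicalType) (n : ℕ)
  | xi : Fin n → Gen T n
  | y : Fin n → Gen T n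
  | spin : SpinWeyl T n → Gen T n

/-- The letter `ξ_i` of the free algebra. -/
def fxi (T : ClassicalType) {n : ℕ} (i : Fin n) : FreeAlgebra ℂ (Gen T n) :=
  FreeAlgebra.ι ℂ (.xi i)

/-- The letter `y_i` of the free algebra. -/
def fy (T : ClassicalType) {n : ℕ} (i : Fin n) : FreeAlgebra ℂ (Gen T n) :=
  FreeAlgebra.ι ℂ (.y i)

/-- The letter of the free algebra given by an element of the spin Weyl group algebra. -/
def fspin {T : ClassicalType} {n : ℕ} (a : SpinWeyl T n) : FreeAlgebra ℂ (Gen T n) :=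
  FreeAlgebra.ι ℂ (.spin a)

/-- The defining relations of the rational spin double affine Hecke algebra. -/
inductive Rel (T : ClassicalType) (n : ℕ) (u v : ℂ) :
    FreeAlgebra ℂ (Gen T n) → FreeAlgebra ℂ (Gen T n) → Prop
  -- the spin Weyl group algebra maps to the algebra by an algebra homomorphism
  | spin_add (a b : SpinWeyl T n) : Rel T n u v (fspin (a + b)) (fspin a + fspin b)
  | spin_mul (a b : SpinWeyl T n) : Rel T n u v (fspin (a * b)) (fspin a * fspin b)
  | spin_scalar (r : ℂ) :
      Rel T n u v (fspin (algebraMap ℂ (SpinWeyl T n) r))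
        (algebraMap ℂ (FreeAlgebra ℂ (Gen T n)) r)
  -- relations among the `y` and among the `ξ`
  | y_comm (i j : Fin n) : Rel T n u v (fy T i * fy T j) (fy T j * fy T i)
  | xi_anti (i j : Fin n) (h : i ≠ j) :
      Rel T n u v (fxi T i * fxi T j) (-(fxi T j * fxi T i))
  -- relations with the generators `t_k` that cover the transpositions `(k, k + 1)`
  | t_y (i i' : Fin n) (h : (i : ℕ) + 1 = i') :
      Rel T n u v (fspin (t T n i) * fy T i) (fy T i' * fspin (t T n i))
  | t_xi (i i' : Fin n) (h : (i : ℕ) + 1 = i') :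
      Rel T n u v (fspin (t T n i) * fxi T i) (-(fxi T i' * fspin (t T n i)))
  | t_y_of_ne (k : ℕ) (hk : k + 1 < n) (j : Fin n) (h : (j : ℕ) ≠ k) (h' : (j : ℕ) ≠ k + 1) :
      Rel T n u v (fspin (t T n k) * fy T j) (fy T j * fspin (t T n k))
  | t_xi_of_ne (k : ℕ) (hk : k + 1 < n) (j : Fin n) (h : (j : ℕ) ≠ k) (h' : (j : ℕ) ≠ k + 1) :
      Rel T n u v (fspin (t T n k) * fxi T j) (-(fxi T j * fspin (t T n k)))
  -- relations with the last generator in type `D`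
  | D_last_y (hT : T = .D) (i i' : Fin n) (h : (i : ℕ) + 2 = n) (h' : (i' : ℕ) + 1 = n) :
      Rel T n u v (fspin (t T n (n - 1)) * fy T i') (-(fy T i * fspin (t T n (n - 1))))
  | D_last_xi (hT : T = .D) (i i' : Fin n) (h : (i : ℕ) + 2 = n) (h' : (i' : ℕ) + 1 = n) :
      Rel T n u v (fspin (t T n (n - 1)) * fxi T i') (-(fxi T i * fspin (t T n (n - 1))))
  | D_last_y_of_ne (hT : T = .D) (j : Fin n) (h : (j : ℕ) + 2 ≠ n) (h' : (j : ℕ) + 1 ≠ n) :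
      Rel T n u v (fspin (t T n (n - 1)) * fy T j) (fy T j * fspin (t T n (n - 1)))
  | D_last_xi_of_ne (hT : T = .D) (j : Fin n) (h : (j : ℕ) + 2 ≠ n) (h' : (j : ℕ) + 1 ≠ n) :
      Rel T n u v (fspin (t T n (n - 1)) * fxi T j) (-(fxi T j * fspin (t T n (n - 1))))
  -- relations with the last generator in type `B`
  | B_last_y (hT : T = .B) (i : Fin n) (h : (i : ℕ) + 1 = n) :
      Rel T n u v (fspin (t T n (n - 1)) * fy T i) (-(fy T i * fspin (t T n (n - 1))))
  | B_last_xi (hT : T = .B) (i : Fin n) (h : (i : ℕ) + 1 = n) :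
      Rel T n u v (fspin (t T n (n - 1)) * fxi T i) (-(fxi T i * fspin (t T n (n - 1))))
  | B_last_y_of_ne (hT : T = .B) (j : Fin n) (h : (j : ℕ) + 1 ≠ n) :
      Rel T n u v (fspin (t T n (n - 1)) * fy T j) (fy T j * fspin (t T n (n - 1)))
  | B_last_xi_of_ne (hT : T = .B) (j : Fin n) (h : (j : ℕ) + 1 ≠ n) :
      Rel T n u v (fspin (t T n (n - 1)) * fxi T j) (-(fxi T j * fspin (t T n (n - 1))))
  -- commutators of `y` and `ξ`
  | y_xi_of_ne (i j : Fin n) (h : i ≠ j) :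
      Rel T n u v (fy T j * fxi T i - fxi T i * fy T j) (fspin (offDiag T n u i j))
  | y_xi_self (i : Fin n) :
      Rel T n u v (fy T i * fxi T i - fxi T i * fy T i) (fspin (diag T n u v i))

/-- The rational spin double affine Hecke algebra of type `A_{n-1}`, `D_n` or `B_n`. -/
def SDaHa (T : ClassicalType) (n : ℕ) (u v : ℂ) : Type := RingQuot (Rel T n u v)

instance (T : ClassicalType) (n : ℕ) (u v : ℂ) : Ring (SDaHa T n u v) :=
  inferInstanceAs (Ring (RingQuot (Rel T n u v)))

instance (T : ClassicalType) (n : ℕ) (u v : ℂ) : Algebra ℂ (SDaHa T n u v) :=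
  inferInstanceAs (Algebra ℂ (RingQuot (Rel T n u v)))

/-- The quotient map from the free algebra. -/
def mk (T : ClassicalType) (n : ℕ) (u v : ℂ) :
    FreeAlgebra ℂ (Gen T n) →ₐ[ℂ] SDaHa T n u v :=
  RingQuot.mkAlgHom ℂ (Rel T n u v)

/-- The relations `ξ_i ξ_j = -ξ_j ξ_i` for `i ≠ j`. -/
inductive SkewRel (n : ℕ) : FreeAlgebra ℂ (Fin n) → FreeAlgebra ℂ (Fin n) → Prop
  | anti (i j : Fin n) (h : i ≠ j) :
      SkewRel n (FreeAlgebra.ι ℂ i * FreeAlgebra.ι ℂ j) (-(FreeAlgebra.ι ℂ j * FreeAlgebra.ι ℂ i))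

/-- The skew-polynomial algebra in `n` variables. -/
def SkewPoly (n : ℕ) : Type := RingQuot (SkewRel n)

instance (n : ℕ) : Ring (SkewPoly n) := inferInstanceAs (Ring (RingQuot (SkewRel n)))

instance (n : ℕ) : Algebra ℂ (SkewPoly n) :=
  inferInstanceAs (Algebra ℂ (RingQuot (SkewRel n)))

section Maps

variable (T : ClassicalType) (n : ℕ) (u v : ℂ)

theorem mk_rel {a b : FreeAlgebra ℂ (Gen T n)} (h : Rel T n u v a b) :
    mk T n u v a = mk T n u v b :=
  RingQuot.mkAlgHom_rel ℂ h

/-- The generator `ξ_i` of the rational spin double affine Hecke algebra. -/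
def xi (i : Fin n) : SDaHa T n u v := mk T n u v (fxi T i)

/-- The generator `y_i` of the rational spin double affine Hecke algebra. -/
def y (i : Fin n) : SDaHa T n u v := mk T n u v (fy T i)

/-- The canonical homomorphism from the skew-polynomial algebra, sending `ξ_i` to `ξ_i`. -/
def skewHom : SkewPoly n →ₐ[ℂ] SDaHa T n u v :=
  RingQuot.liftAlgHom ℂ (s := SkewRel n) ⟨FreeAlgebra.lift ℂ (xi T n u v), by
    rintro _ _ ⟨i, j, h⟩
    simpa [xi] using mk_rel T n u v (.xi_anti i j h)⟩

/-- The canonical homomorphism from the spin Weyl group algebra. -/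
def spinHom : SpinWeyl T n →ₐ[ℂ] SDaHa T n u v where
  toFun a := mk T n u v (fspin a)
  map_one' := by simpa using mk_rel T n u v (.spin_scalar 1)
  map_zero' := by simpa using mk_rel T n u v (.spin_scalar 0)
  map_mul' a b := by simpa using mk_rel T n u v (.spin_mul a b)
  map_add' a b := by simpa using mk_rel T n u v (.spin_add a b)
  commutes' r := by simpa using mk_rel T n u v (.spin_scalar r)

theorem y_mul_comm (i j : Fin n) :
    y T n u v i * y T n u v j = y T n u v j * y T n u v i := by
  simpa [y] using mk_rel T n u v (.y_comm i j)

open scoped IsMulCommutative in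
/-- The canonical homomorphism from the polynomial algebra, sending the variable `y_i` to `y_i`.
It is built through the (commutative) subalgebra that the `y_i` generate. -/
def polyHom : MvPolynomial (Fin n) ℂ →ₐ[ℂ] SDaHa T n u v :=
  have : IsMulCommutative (Algebra.adjoin ℂ (Set.range (y T n u v))) :=
    Algebra.isMulCommutative_adjoin ℂ (by
      rintro _ ⟨i, rfl⟩ _ ⟨j, rfl⟩
      exact y_mul_comm T n u v i j)
  (Algebra.adjoin ℂ (Set.range (y T n u v))).val.comp
    (MvPolynomial.aeval fun i =>
      (⟨y T n u v i, Algebra.subset_adjoin ⟨i, rfl⟩⟩ :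
        Algebra.adjoin ℂ (Set.range (y T n u v))))

theorem polyHom_X (i : Fin n) : polyHom T n u v (MvPolynomial.X i) = y T n u v i := by
  simp [polyHom]

/-- The linear map `a ⊗ σ ⊗ f ↦ a σ f` given by multiplication. -/
def multMap : SkewPoly n ⊗[ℂ] SpinWeyl T n ⊗[ℂ] MvPolynomial (Fin n) ℂ →ₗ[ℂ] SDaHa T n u v :=
  LinearMap.mul' ℂ (SDaHa T n u v) ∘ₗ
    TensorProduct.map
      (LinearMap.mul' ℂ (SDaHa T n u v) ∘ₗ
        TensorProduct.map (skewHom T n u v).toLinearMap (spinHom T n u v).toLinearMap)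
      (polyHom T n u v).toLinearMap

theorem multMap_tmul (a : SkewPoly n) (s : SpinWeyl T n) (f : MvPolynomial (Fin n) ℂ) :
    multMap T n u v (a ⊗ₜ[ℂ] s ⊗ₜ[ℂ] f) =
      skewHom T n u v a * spinHom T n u v s * polyHom T n u v f := by
  simp [multMap]

/-- The ordered monomial `ξ^α`, that is `ξ_0^{α_0} ξ_1^{α_1} ⋯ ξ_{n-1}^{α_{n-1}}`. -/
def xiMonomial (α : Fin n → ℕ) : SDaHa T n u v :=
  (List.ofFn fun i => xi T n u v i ^ α i).prod

/-- The monomial `y^γ`, that is `y_0^{γ_0} y_1^{γ_1} ⋯ y_{n-1}^{γ_{n-1}}`. -/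
def yMonomial (γ : Fin n → ℕ) : SDaHa T n u v :=
  (List.ofFn fun i => y T n u v i ^ γ i).prod

end Maps

end SpinDaha

end

noncomputable section

namespace SpinDaha

/-- Elements of a ring that satisfy the relations of the generators `t_k` of the spin Weyl group
algebra. -/
structure IsSpinSystem (T : ClassicalType) (n : ℕ) {R : Type*} [Ring R] (τ : ℕ → R) : Prop where
  sq : ∀ i, i < T.rank n → τ i * τ i = 1
  two : ∀ i j, i < T.rank n → j < T.rank n → T.m n i j = 2 → τ i * τ j = -(τ j * τ i)
  three : ∀ i j, i < T.rank n → j < T.rank n → T.m n i j = 3 →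
    τ i * τ j * τ i = τ j * τ i * τ j
  four : ∀ i j, i < T.rank n → j < T.rank n → T.m n i j = 4 →
    τ i * τ j * (τ i * τ j) = -(τ j * τ i * (τ j * τ i))

/-- Elements of a monoid that satisfy the Coxeter relations of the Weyl group. -/
structure IsCoxeterSystem (T : ClassicalType) (n : ℕ) {R : Type*} [Monoid R] (σ : ℕ → R) :
    Prop where
  sq : ∀ i, i < T.rank n → σ i * σ i = 1
  two : ∀ i j, i < T.rank n → j < T.rank n → T.m n i j = 2 → σ i * σ j = σ j * σ i
  three : ∀ i j, i < T.rank n → j < T.rank n → T.m n i j = 3 →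
    σ i * σ j * σ i = σ j * σ i * σ j
  four : ∀ i j, i < T.rank n → j < T.rank n → T.m n i j = 4 →
    σ i * σ j * (σ i * σ j) = σ j * σ i * (σ j * σ i)

section Lift

variable {T : ClassicalType} {n : ℕ} {R : Type*} [Ring R]

theorem IsCoxeterSystem.mul_spin {σ τ : ℕ → R} (hσ : IsCoxeterSystem T n σ)
    (hτ : IsSpinSystem T n τ) (hc : ∀ i j, Commute (σ i) (τ j)) :
    IsSpinSystem T n fun i => σ i * τ i := by
  have key : ∀ i j, σ i * τ i * (σ j * τ j) = σ i * σ j * (τ i * τ j) := fun i j =>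
    ((hc j i).symm.mul_mul_mul_comm (σ i) (τ j))
  have hc2 : ∀ i j k, Commute (σ i) (τ j * τ k) := fun i j k => (hc i j).mul_right (hc i k)
  refine ⟨fun i hi => ?_, fun i j hi hj h => ?_, fun i j hi hj h => ?_, fun i j hi hj h => ?_⟩
  · rw [key, hσ.sq i hi, hτ.sq i hi, one_mul]
  · rw [key, key, hσ.two i j hi hj h, hτ.two i j hi hj h, mul_neg]
  · rw [key, key, (hc2 i i j).symm.mul_mul_mul_comm, (hc2 j j i).symm.mul_mul_mul_comm,
      hσ.three i j hi hj h, hτ.three i j hi hj h]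
  · rw [key, key, ((hc2 i i j).mul_left (hc2 j i j)).symm.mul_mul_mul_comm,
      ((hc2 j j i).mul_left (hc2 i j i)).symm.mul_mul_mul_comm,
      hσ.four i j hi hj h, hτ.four i j hi hj h, mul_neg]

theorem IsSpinSystem.map {S : Type*} [Ring S] {τ : ℕ → R} (hτ : IsSpinSystem T n τ)
    (f : R →+* S) : IsSpinSystem T n fun i => f (τ i) := by
  refine ⟨fun i hi => ?_, fun i j hi hj h => ?_, fun i j hi hj h => ?_, fun i j hi hj h => ?_⟩ <;>
    simp only [← map_mul, ← map_neg, ← map_one f]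
  · rw [hτ.sq i hi]
  · rw [hτ.two i j hi hj h]
  · rw [hτ.three i j hi hj h]
  · rw [hτ.four i j hi hj h]

variable [Algebra ℂ R]

/-- The units of `R` assigned to the generators of the double cover by a spin system. -/
def spinUnit {τ : ℕ → R} (h : IsSpinSystem T n τ) : CoverGen T n → Rˣ
  | .z => -1
  | .t i => ⟨τ i, τ i, h.sq i i.2, h.sq i i.2⟩

/-- The homomorphism from the double cover determined by a spin system. -/
def coverLift {τ : ℕ → R} (h : IsSpinSystem T n τ) : DoubleCover T n →* Rˣ :=
  PresentedGroup.toGroup (f := spinUnit h) (by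
    rintro _ ⟨a, b, hab, rfl⟩
    rw [map_mul, map_inv, mul_inv_eq_one]
    cases hab <;> ext <;> simp [fz, ft, spinUnit, pow_two]
    case t_sq i => exact h.sq i i.2
    case two i j hm => exact h.two i j i.2 j.2 hm
    case three i j hm => exact h.three i j i.2 j.2 hm
    case four i j hm => exact h.four i j i.2 j.2 hm)

/-- The homomorphism from the spin Weyl group algebra determined by a spin system. -/
def spinLift {τ : ℕ → R} (h : IsSpinSystem T n τ) : SpinWeyl T n →ₐ[ℂ] R :=
  RingQuot.liftAlgHom ℂ (s := SpinRel T n)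
    ⟨MonoidAlgebra.lift ℂ R (DoubleCover T n) ((Units.coeHom R).comp (coverLift h)), by
      rintro _ _ ⟨⟩
      simp [coverLift, coverOf, spinUnit]⟩

theorem spinLift_t {τ : ℕ → R} (h : IsSpinSystem T n τ) {k : ℕ} (hk : k < T.rank n) :
    spinLift h (t T n k) = τ k := by
  have h1 : ∀ x, spinLift h (spinMk T n x) =
      MonoidAlgebra.lift ℂ R (DoubleCover T n) ((Units.coeHom R).comp (coverLift h)) x :=
    fun x => RingQuot.liftAlgHom_mkAlgHom_apply ℂ _ _ x
  simp only [t, hk, dif_pos]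
  rw [h1]
  simp [coverLift, coverOf, spinUnit]

theorem spinMk_z : spinMk T n (MonoidAlgebra.of ℂ (DoubleCover T n) (coverOf .z)) = -1 := by
  have : spinMk T n (MonoidAlgebra.of ℂ (DoubleCover T n) (coverOf .z)) = spinMk T n (-1) :=
    RingQuot.mkAlgHom_rel ℂ (SpinRel.z_eq (T := T) (n := n))
  rw [this, map_neg, map_one]

theorem spinHom_ext {f g : SpinWeyl T n →ₐ[ℂ] R}
    (h : ∀ k, k < T.rank n → f (t T n k) = g (t T n k)) : f = g := by
  apply RingQuot.ringQuot_ext'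
  have h1 : ∀ x : DoubleCover T n, f (spinMk T n (MonoidAlgebra.of ℂ _ x)) =
      g (spinMk T n (MonoidAlgebra.of ℂ _ x)) := by
    let F : DoubleCover T n →* R :=
      ((f.comp (spinMk T n)) : _ →* R).comp (MonoidAlgebra.of ℂ _)
    let G : DoubleCover T n →* R :=
      ((g.comp (spinMk T n)) : _ →* R).comp (MonoidAlgebra.of ℂ _)
    have : F.toHomUnits = G.toHomUnits := by
      apply PresentedGroup.ext
      rintro (_ | i) <;> ext
      · change f (spinMk T n (MonoidAlgebra.of ℂ _ (coverOf .z))) =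
          g (spinMk T n (MonoidAlgebra.of ℂ _ (coverOf .z)))
        rw [spinMk_z]
        simp
      · have := h i i.2
        simp only [t, i.2, dif_pos] at this
        exact this
    intro x
    exact congrArg Units.val (DFunLike.congr_fun this x)
  exact MonoidAlgebra.algHom_ext h1 (by ext)

/-- The spin Weyl group algebra is generated by the `t_k`. -/
theorem mem_of_t_mem (U : Subalgebra ℂ (SpinWeyl T n)) (hU : ∀ k, k < T.rank n → t T n k ∈ U)
    (hs : IsSpinSystem T n (t T n)) (a : SpinWeyl T n) : a ∈ U := by
  have hs' : IsSpinSystem T n fun k =>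
      if h : k < T.rank n then (⟨t T n k, hU k h⟩ : U) else 1 := by
    refine ⟨fun i hi => ?_, fun i j hi hj h => ?_, fun i j hi hj h => ?_,
      fun i j hi hj h => ?_⟩ <;> ext
    · simpa [hi] using hs.sq i hi
    · simpa [hi, hj] using hs.two i j hi hj h
    · simpa [hi, hj] using hs.three i j hi hj h
    · simpa [hi, hj] using hs.four i j hi hj h
  have : U.val.comp (spinLift hs') = AlgHom.id ℂ _ := by
    apply spinHom_ext
    intro k hk
    simp [spinLift_t hs' hk, hk]
  have h2 := DFunLike.congr_fun this a
  simp only [AlgHom.comp_apply, AlgHom.id_apply] at h2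
  rw [← h2]
  exact (spinLift hs' a).2

theorem isSpinSystem_t : IsSpinSystem T n (t T n) := by
  have rel : ∀ {a b : FreeGroup (CoverGen T n)}, IsCoverRelation T n a b →
      PresentedGroup.mk {r | ∃ a b, IsCoverRelation T n a b ∧ r = a * b⁻¹} a =
        PresentedGroup.mk {r | ∃ a b, IsCoverRelation T n a b ∧ r = a * b⁻¹} b := by
    intro a b h
    have : PresentedGroup.mk {r | ∃ a b, IsCoverRelation T n a b ∧ r = a * b⁻¹} (a * b⁻¹) = 1 :=
      PresentedGroup.one_of_mem ⟨a, b, h, rfl⟩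
    rwa [map_mul, map_inv, mul_inv_eq_one] at this
  have ht : ∀ {i} (hi : i < T.rank n), t T n i =
      spinMk T n (MonoidAlgebra.of ℂ _ (PresentedGroup.mk _ (ft T n ⟨i, hi⟩))) := by
    intro i hi
    simp only [t, hi, dif_pos]
    rfl
  have hz : spinMk T n (MonoidAlgebra.of ℂ _ (PresentedGroup.mk _ (fz T n))) = -1 := spinMk_z
  refine ⟨fun i hi => ?_, fun i j hi hj h => ?_, fun i j hi hj h => ?_,
      fun i j hi hj h => ?_⟩
  · rw [ht hi, ← map_mul, ← map_mul, ← map_mul, ← pow_two, rel (.t_sq _), map_one, map_one,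
      map_one]
  · rw [ht hi, ht hj, ← neg_one_mul, ← hz]
    simp only [← map_mul]
    rw [rel (.two _ _ h)]
  · rw [ht hi, ht hj]
    simp only [← map_mul]
    rw [rel (.three _ _ h)]
  · rw [ht hi, ht hj, ← neg_one_mul, ← hz]
    simp only [← map_mul]
    rw [← pow_two, ← pow_two, rel (.four _ _ h)]

theorem spin_induction (U : Submodule ℂ (SpinWeyl T n)) (h1 : 1 ∈ U)
    (hU : ∀ k, k < T.rank n → ∀ a ∈ U, t T n k * a ∈ U) (a : SpinWeyl T n) : a ∈ U := by
  let V : Subalgebra ℂ (SpinWeyl T n) :=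
    { carrier := {x | ∀ a ∈ U, x * a ∈ U}
      mul_mem' := fun {x y'} hx hy a ha => by rw [mul_assoc]; exact hx _ (hy _ ha)
      add_mem' := fun {x y'} hx hy a ha => by rw [add_mul]; exact U.add_mem (hx _ ha) (hy _ ha)
      algebraMap_mem' := fun r a ha => by
        rw [← Algebra.smul_def]; exact U.smul_mem _ ha }
  have := mem_of_t_mem V (fun k hk => hU k hk) isSpinSystem_t a 1 h1
  rwa [mul_one] at this

/-- The quotient map from the free algebra to the skew-polynomial algebra. -/
def skewMk (n : ℕ) : FreeAlgebra ℂ (Fin n) →ₐ[ℂ] SkewPoly n := RingQuot.mkAlgHom ℂ (SkewRel n)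

/-- The generator `ξ_i` of the skew-polynomial algebra. -/
def skewX {n : ℕ} (i : Fin n) : SkewPoly n := skewMk n (FreeAlgebra.ι ℂ i)

theorem skewX_anti {i j : Fin n} (h : i ≠ j) : skewX i * skewX j = -(skewX j * skewX i) := by
  have : skewMk n (FreeAlgebra.ι ℂ i * FreeAlgebra.ι ℂ j) =
      skewMk n (-(FreeAlgebra.ι ℂ j * FreeAlgebra.ι ℂ i)) :=
    RingQuot.mkAlgHom_rel ℂ (SkewRel.anti i j h)
  simpa only [skewX, map_mul, map_neg] using this

/-- The homomorphism from the skew-polynomial algebra determined by anticommuting elements. -/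
def skewLift (X : Fin n → R) (h : ∀ i j, i ≠ j → X i * X j = -(X j * X i)) :
    SkewPoly n →ₐ[ℂ] R :=
  RingQuot.liftAlgHom ℂ (s := SkewRel n) ⟨FreeAlgebra.lift ℂ X, by
    rintro _ _ ⟨i, j, hij⟩
    simpa using h i j hij⟩

@[simp]
theorem skewLift_X (X : Fin n → R) (h : ∀ i j, i ≠ j → X i * X j = -(X j * X i)) (i : Fin n) :
    skewLift X h (skewX i) = X i := by
  have h1 : ∀ x, skewLift X h (skewMk n x) = FreeAlgebra.lift ℂ X x :=
    fun x => RingQuot.liftAlgHom_mkAlgHom_apply ℂ _ _ x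
  rw [skewX, h1, FreeAlgebra.lift_ι_apply]

theorem skew_ext {f g : SkewPoly n →ₐ[ℂ] R} (h : ∀ i, f (skewX i) = g (skewX i)) : f = g := by
  apply RingQuot.ringQuot_ext'
  ext i
  exact h i

theorem skew_induction (U : Submodule ℂ (SkewPoly n)) (h1 : 1 ∈ U)
    (hU : ∀ i, ∀ p ∈ U, skewX i * p ∈ U) (p : SkewPoly n) : p ∈ U := by
  obtain ⟨w, rfl⟩ : ∃ w, skewMk n w = p := RingQuot.mkAlgHom_surjective ℂ (SkewRel n) p
  have : ∀ p ∈ U, skewMk n w * p ∈ U := by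
    induction w using FreeAlgebra.induction with
    | grade0 r =>
      intro p hp
      rw [AlgHom.commutes, ← Algebra.smul_def]; exact U.smul_mem _ hp
    | grade1 i => exact hU i
    | mul a b ha hb => intro p hp; rw [map_mul, mul_assoc]; exact ha _ (hb _ hp)
    | add a b ha hb => intro p hp; rw [map_add, add_mul]; exact U.add_mem (ha _ hp) (hb _ hp)
  have h2 := this 1 h1
  rwa [mul_one] at h2

end Lift

/-- The transposition of `a` and `b`, combined with the sign change at both if `s` is true. For
`a = b` it is the sign change at `a`. -/
def signedSwap (a b : ℕ) (s : Bool) (p : ℕ × Bool) : ℕ × Bool :=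
  if p.1 = a then (b, xor s p.2) else if p.1 = b then (a, xor s p.2) else p

theorem signedSwap_sq (a b : ℕ) (s : Bool) (p : ℕ × Bool) :
    signedSwap a b s (signedSwap a b s p) = p := by
  obtain ⟨j, c⟩ := p
  by_cases h1 : j = a <;> by_cases h2 : j = b <;> by_cases h3 : b = a <;> simp_all [signedSwap]

theorem signedSwap_comm {a b a' b' : ℕ} (h1 : a ≠ a') (h2 : a ≠ b') (h3 : b ≠ a') (h4 : b ≠ b')
    (s s' : Bool) (p : ℕ × Bool) :
    signedSwap a b s (signedSwap a' b' s' p) = signedSwap a' b' s' (signedSwap a b s p) := by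
  obtain ⟨j, c⟩ := p
  by_cases j1 : j = a
  · subst j1; simp [signedSwap, *]
  by_cases j2 : j = b
  · subst j2; simp [signedSwap, *]
  by_cases j3 : j = a'
  · subst j3; simp [signedSwap, h1.symm, h2.symm, h3.symm, h4.symm, *]
  by_cases j4 : j = b'
  · subst j4; simp [signedSwap, h1.symm, h2.symm, h3.symm, h4.symm, *]
  simp [signedSwap, *]

theorem signedSwap_comm_self {a b : ℕ} (h : a ≠ b) (s s' : Bool) (p : ℕ × Bool) :
    signedSwap a b s (signedSwap a b s' p) = signedSwap a b s' (signedSwap a b s p) := by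
  obtain ⟨j, c⟩ := p
  by_cases j1 : j = a
  · subst j1; cases s <;> cases s' <;> simp [signedSwap, h.symm]
  by_cases j2 : j = b
  · subst j2; cases s <;> cases s' <;> simp [signedSwap, h.symm]
  simp [signedSwap, *]

theorem signedSwap_braid {a b c : ℕ} (hab : a ≠ b) (hac : a ≠ c) (hbc : b ≠ c) (s s' : Bool)
    (p : ℕ × Bool) :
    signedSwap a b s (signedSwap b c s' (signedSwap a b s p)) =
      signedSwap b c s' (signedSwap a b s (signedSwap b c s' p)) := by
  obtain ⟨j, d⟩ := p
  by_cases j1 : j = a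
  · subst j1; simp [signedSwap, hab, hac, hac.symm, hbc.symm]
  by_cases j2 : j = b
  · subst j2; simp [signedSwap, hab, hac, hab.symm, hac.symm, hbc.symm]
  by_cases j3 : j = c
  · subst j3; simp [signedSwap, hab, hac, hab.symm, hac.symm, hbc.symm]
  simp [signedSwap, *]

theorem signedSwap_four {a b : ℕ} (hab : a ≠ b) (s : Bool) (p : ℕ × Bool) :
    signedSwap a b s (signedSwap b b true (signedSwap a b s (signedSwap b b true p))) =
      signedSwap b b true (signedSwap a b s (signedSwap b b true (signedSwap a b s p))) := by
  obtain ⟨j, d⟩ := p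
  by_cases j1 : j = a
  · subst j1; simp [signedSwap, hab, hab.symm]
  by_cases j2 : j = b
  · subst j2; simp [signedSwap, hab, hab.symm]
  simp [signedSwap, *]

/-- The action of the simple reflection `s_k` on the signed coordinates. -/
def actNat (T : ClassicalType) (n k : ℕ) : ℕ × Bool → ℕ × Bool :=
  if k + 1 < n then signedSwap k (k + 1) false
  else match T with
    | .A => id
    | .D => signedSwap (n - 2) (n - 1) true
    | .B => signedSwap (n - 1) (n - 1) true

theorem actNat_sq (T : ClassicalType) (n k : ℕ) (p : ℕ × Bool) :
    actNat T n k (actNat T n k p) = p := by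
  cases T <;> by_cases h : k + 1 < n <;> simp [actNat, h, signedSwap_sq]

/-- The ways in which two nodes of the diagram can be related. -/
inductive NodePair (T : ClassicalType) (n : ℕ) : ℕ → ℕ → ℕ → Prop
  | self (k : ℕ) : NodePair T n k k 1
  | far (k l : ℕ) (hk : k + 1 < l) (hl : l + 1 < n) : NodePair T n k l 2
  | next (k : ℕ) (hk : k + 2 < n) : NodePair T n k (k + 1) 3
  | D_far (hT : T = .D) (k : ℕ) (hk : k + 3 < n) : NodePair T n k (n - 1) 2
  | D_twin (hT : T = .D) (hn : 2 ≤ n) : NodePair T n (n - 2) (n - 1) 2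
  | D_next (hT : T = .D) (hn : 3 ≤ n) : NodePair T n (n - 3) (n - 1) 3
  | B_far (hT : T = .B) (k : ℕ) (hk : k + 2 < n) : NodePair T n k (n - 1) 2
  | B_next (hT : T = .B) (hn : 2 ≤ n) : NodePair T n (n - 2) (n - 1) 4
  | symm {k l m : ℕ} (h : NodePair T n k l m) : NodePair T n l k m

theorem nodePair_of_le {T : ClassicalType} {n : ℕ} (hn : T.Admissible n) {k l : ℕ} (hkl : k ≤ l)
    (hl : l < T.rank n) : NodePair T n k l (T.m n k l) := by
  rcases eq_or_lt_of_le hkl with rfl | hlt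
  · have : T.m n k k = 1 := by cases T <;> simp [ClassicalType.m]
    rw [this]; exact .self k
  by_cases hl' : l + 1 < n
  · by_cases hlt' : l = k + 1
    · subst hlt'
      have : T.m n k (k + 1) = 3 := by
        have h1 : k + 1 ≠ n := by omega
        have h2 : k + 1 + 1 ≠ n := by omega
        cases T <;> simp [ClassicalType.m, h1, h2]
      rw [this]; exact .next k (by omega)
    · have : T.m n k l = 2 := by
        cases T <;> simp only [ClassicalType.m] <;> split_ifs <;> omega
      rw [this]; exact .far k l (by omega) hl'
  · cases T with
    | A => simp [ClassicalType.rank] at hl; omega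
    | D =>
      simp [ClassicalType.rank, ClassicalType.Admissible] at hl hn
      obtain rfl : l = n - 1 := by omega
      by_cases h3 : k + 3 < n
      · have : ClassicalType.m .D n k (n - 1) = 2 := by
          simp only [ClassicalType.m]; split_ifs <;> omega
        rw [this]; exact .D_far rfl k h3
      by_cases h2 : k + 3 = n
      · obtain rfl : k = n - 3 := by omega
        have : ClassicalType.m .D n (n - 3) (n - 1) = 3 := by
          simp only [ClassicalType.m]; split_ifs <;> omega
        rw [this]; exact .D_next rfl (by omega)
      · obtain rfl : k = n - 2 := by omega
        have : ClassicalType.m .D n (n - 2) (n - 1) = 2 := by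
          simp only [ClassicalType.m]; split_ifs <;> omega
        rw [this]; exact .D_twin rfl (by omega)
    | B =>
      simp [ClassicalType.rank, ClassicalType.Admissible] at hl hn
      obtain rfl : l = n - 1 := by omega
      by_cases h2 : k + 2 = n
      · obtain rfl : k = n - 2 := by omega
        have : ClassicalType.m .B n (n - 2) (n - 1) = 4 := by
          simp only [ClassicalType.m]; split_ifs <;> omega
        rw [this]; exact .B_next rfl (by omega)
      · have : ClassicalType.m .B n k (n - 1) = 2 := by
          simp only [ClassicalType.m]; split_ifs <;> omega
        rw [this]; exact .B_far rfl k (by omega)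

theorem m_symm (T : ClassicalType) (n k l : ℕ) : T.m n k l = T.m n l k := by
  cases T <;> simp only [ClassicalType.m] <;> split_ifs <;> omega

theorem nodePair {T : ClassicalType} {n : ℕ} (hn : T.Admissible n) {k l : ℕ}
    (hk : k < T.rank n) (hl : l < T.rank n) : NodePair T n k l (T.m n k l) := by
  rcases le_total k l with h | h
  · exact nodePair_of_le hn h hl
  · rw [m_symm]; exact (nodePair_of_le hn h hk).symm

theorem isCoxeterSystem_actNat {T : ClassicalType} {n : ℕ} (hn : T.Admissible n) :
    IsCoxeterSystem T n (R := Function.End (ℕ × Bool)) (actNat T n) := by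
  have key : ∀ k l m, NodePair T n k l m →
      (m = 2 → ∀ p, actNat T n k (actNat T n l p) = actNat T n l (actNat T n k p)) ∧
      (m = 3 → ∀ p, actNat T n k (actNat T n l (actNat T n k p)) =
        actNat T n l (actNat T n k (actNat T n l p))) ∧
      (m = 4 → ∀ p, actNat T n k (actNat T n l (actNat T n k (actNat T n l p))) =
        actNat T n l (actNat T n k (actNat T n l (actNat T n k p)))) := by
    intro k l m h
    induction h with
    | self k => simp
    | far k l hk hl =>
      simp only [actNat, if_pos (show k + 1 < n by omega), if_pos hl]
      refine ⟨fun _ => signedSwap_comm ?_ ?_ ?_ ?_ _ _, by simp, by simp⟩ <;> omega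
    | next k hk =>
      simp only [actNat, if_pos (show k + 1 < n by omega), if_pos (show k + 1 + 1 < n by omega)]
      refine ⟨by simp, fun _ => signedSwap_braid ?_ ?_ ?_ _ _, by simp⟩ <;> omega
    | D_far hT k hk =>
      subst hT
      simp only [actNat, if_pos (show k + 1 < n by omega), if_neg (show ¬ n - 1 + 1 < n by omega)]
      refine ⟨fun _ => signedSwap_comm ?_ ?_ ?_ ?_ _ _, by simp, by simp⟩ <;> omega
    | D_twin hT h2 =>
      subst hT
      obtain ⟨n, rfl⟩ := Nat.exists_eq_add_of_le' h2
      simp only [actNat, Nat.add_sub_cancel, if_pos (show n + 1 < n + 2 by omega),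
        if_neg (show ¬ n + 1 + 1 < n + 2 by omega), show n + 2 - 1 = n + 1 by omega]
      exact ⟨fun _ p => signedSwap_comm_self (by omega) _ _ p, by simp, by simp⟩
    | D_next hT h2 =>
      subst hT
      obtain ⟨n, rfl⟩ := Nat.exists_eq_add_of_le' h2
      simp only [actNat, Nat.add_sub_cancel, if_pos (show n + 1 < n + 3 by omega),
        if_neg (show ¬ n + 3 - 1 + 1 < n + 3 by omega), show n + 3 - 2 = n + 1 by omega]
      exact ⟨by simp, fun _ => signedSwap_braid (by omega) (by omega) (by omega) _ _, by simp⟩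
    | B_far hT k hk =>
      subst hT
      simp only [actNat, if_pos (show k + 1 < n by omega), if_neg (show ¬ n - 1 + 1 < n by omega)]
      refine ⟨fun _ => signedSwap_comm ?_ ?_ ?_ ?_ _ _, by simp, by simp⟩ <;> omega
    | B_next hT h2 =>
      subst hT
      obtain ⟨n, rfl⟩ := Nat.exists_eq_add_of_le' h2
      simp only [actNat, Nat.add_sub_cancel, if_pos (show n + 1 < n + 2 by omega),
        if_neg (show ¬ n + 1 + 1 < n + 2 by omega), show n + 2 - 1 = n + 1 by omega]
      exact ⟨by simp, by simp, fun _ p => signedSwap_four (by omega) _ p⟩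
    | symm _ ih =>
      exact ⟨fun h p => (ih.1 h p).symm, fun h p => (ih.2.1 h p).symm,
        fun h p => (ih.2.2 h p).symm⟩
  refine ⟨fun k _ => funext fun p => actNat_sq T n k p, fun k l hk hl h => funext fun p => ?_,
    fun k l hk hl h => funext fun p => ?_, fun k l hk hl h => funext fun p => ?_⟩
  · exact (key k l _ (nodePair hn hk hl)).1 h p
  · exact (key k l _ (nodePair hn hk hl)).2.1 h p
  · exact (key k l _ (nodePair hn hk hl)).2.2 h p

/-- Involutions `c_0, …, c_{N-1}` that satisfy the braid relations of the symmetric group. -/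
structure IsChainAction {α : Type*} (N : ℕ) (c : ℕ → α → α) : Prop where
  sq : ∀ k, k < N → ∀ x, c k (c k x) = x
  far : ∀ k l, k + 1 < l → l < N → ∀ x, c k (c l x) = c l (c k x)
  braid : ∀ k, k + 1 < N → ∀ x, c k (c (k + 1) (c k x)) = c (k + 1) (c k (c (k + 1) x))

/-- The transposition of `k` and `k + 1`. -/
def adjSwap (k j : ℕ) : ℕ := if j = k then k + 1 else if j = k + 1 then k else j

namespace IsChainAction

variable {α : Type*} {N : ℕ} {c : ℕ → α → α}

section Up

variable (hc : IsChainAction N c) {f : ℕ → ℕ → α}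
  (hf : ∀ i j, i < j → j < N → f i (j + 1) = c j (f i j))
  (hfix : ∀ i k, i < N → k < N → (k + 1 < i ∨ i + 1 < k) → c k (f i (i + 1)) = f i (i + 1))
  (hnext : ∀ i, i + 1 < N → c i (c (i + 1) (f i (i + 1))) = f (i + 1) (i + 2))
include hc hf

include hnext in
theorem up_shift {i j : ℕ} (hij : i + 1 < j) (hj : j ≤ N) : c i (f i j) = f (i + 1) j := by
  induction j, hij using Nat.le_induction with
  | base => rw [hf i (i + 1) (by omega) (by omega), hnext i (by omega)]
  | succ j hij ih =>
    rw [hf i j (by omega) (by omega), hc.far i j (by omega) (by omega), ih (by omega),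
      ← hf (i + 1) j (by omega) (by omega)]

include hfix in
theorem up_fix_outer {i j k : ℕ} (hij : i < j) (hj : j ≤ N) (hk : k < N)
    (h : k + 1 < i ∨ j < k) : c k (f i j) = f i j := by
  induction j, hij using Nat.le_induction with
  | base => exact hfix i k (by omega) hk (by omega)
  | succ j hij ih =>
    rw [hf i j (by omega) (by omega)]
    rcases h with h | h
    · rw [hc.far k j (by omega) (by omega), ih (by omega) (by omega)]
    · rw [← hc.far j k (by omega) (by omega), ih (by omega) (by omega)]

include hfix in
theorem up_fix {i j k : ℕ} (hij : i < j) (hj : j ≤ N) (hk : k < N)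
    (h1 : k ≠ i) (h2 : k + 1 ≠ i) (h3 : k ≠ j) (h4 : k + 1 ≠ j) : c k (f i j) = f i j := by
  by_cases hout : k + 1 < i ∨ j < k
  · exact hc.up_fix_outer hf hfix hij hj hk hout
  obtain ⟨hik, hkj⟩ : i < k ∧ k + 2 ≤ j := by omega
  clear hout h1 h2 h3 h4
  induction j, hkj using Nat.le_induction with
  | base =>
    rw [hf i (k + 1) (by omega) (by omega), hf i k (by omega) (by omega),
      hc.braid k (by omega), hc.up_fix_outer hf hfix hik (by omega) (by omega) (by omega)]
  | succ j hkj ih =>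
    rw [hf i j (by omega) (by omega), hc.far k j (by omega) (by omega),
      ih (by omega) (by omega)]

end Up

section Down

variable (hc : IsChainAction N c) {s : ℕ → α} (hs : ∀ i, i < N → s i = c i (s (i + 1)))
  (hfix : ∀ k, k + 1 < N → c k (s N) = s N)
include hc hs hfix

theorem single_fix {i k : ℕ} (hi : i ≤ N) (hk : k < N) (h1 : k ≠ i) (h2 : k + 1 ≠ i) :
    c k (s i) = s i := by
  induction hi using Nat.decreasingInduction with
  | self => exact hfix k (by omega)
  | of_succ i hi ih =>
    by_cases h3 : k = i + 1
    · subst h3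
      have h4 : c i (s (i + 2)) = s (i + 2) := by
        clear ih h1 h2
        have : ∀ j, j ≤ N → i + 2 ≤ j → c i (s j) = s j := by
          intro j hj
          induction hj using Nat.decreasingInduction with
          | self => intro hj; exact hfix i (by omega)
          | of_succ j hj ih =>
            intro hj'
            rw [hs j hj, hc.far i j (by omega) hj, ih (by omega)]
        exact this _ (by omega) le_rfl
      rw [hs i hi, hs (i + 1) hk, ← hc.braid i hk, h4]
    · rw [hs i hi]
      rcases lt_or_gt_of_ne h1 with h | h
      · rw [hc.far k i (by omega) hi, ih h3 (by omega)]
      · rw [← hc.far i k (by omega) hk, ih h3 (by omega)]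

theorem single_equivariant {i k : ℕ} (hi : i ≤ N) (hk : k < N) :
    c k (s i) = s (adjSwap k i) := by
  unfold adjSwap
  split_ifs with h1 h2
  · subst h1; rw [hs _ hk, hc.sq _ hk]
  · subst h2; rw [hs _ hk]
  · exact hc.single_fix hs hfix hi hk (Ne.symm h1) (Ne.symm h2)

end Down

section DownPair

variable (hc : IsChainAction N c) {g : ℕ → ℕ → α}
  (hg : ∀ i j, i < j → j < N → g i j = c j (g i (j + 1)))
  (hg' : ∀ i, i + 1 < N → g i N = c i (g (i + 1) N))
  (hfix : ∀ k, k < N → k + 2 ≠ N → c k (g (N - 1) N) = g (N - 1) N)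
include hc hg'

theorem last_fix {i k : ℕ} (hi : i < N) (hk : k + 1 < N) (h1 : k ≠ i) (h2 : k + 1 ≠ i)
    (hfix : ∀ k, k < N → k + 2 ≠ N → c k (g (N - 1) N) = g (N - 1) N) :
    c k (g i N) = g i N := by
  have hc' : IsChainAction (N - 1) c :=
    ⟨fun k hk => hc.sq k (by omega), fun k l h hl => hc.far k l h (by omega),
      fun k hk => hc.braid k (by omega)⟩
  exact hc'.single_fix (s := fun i => g i N) (fun i hi => hg' i (by omega))
    (fun k hk => hfix k (by omega) (by omega)) (by omega) (by omega) h1 h2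

include hg

theorem down_shift {i j : ℕ} (hij : i + 1 < j) (hj : j ≤ N) : c i (g i j) = g (i + 1) j := by
  induction hj using Nat.decreasingInduction with
  | self => rw [hg' i hij, hc.sq i (by omega)]
  | of_succ j hj ih =>
    rw [hg i j (by omega) hj, hc.far i j hij hj, ih (by omega), ← hg (i + 1) j hij hj]

include hfix

theorem down_fix_inner {i j k : ℕ} (hj : j ≤ N) (hij : i < j) (hk : k + 1 < j)
    (h1 : k ≠ i) (h2 : k + 1 ≠ i) : c k (g i j) = g i j := by
  induction hj using Nat.decreasingInduction with
  | self => exact hc.last_fix hg' hij hk h1 h2 hfix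
  | of_succ j hj ih =>
    rw [hg i j hij hj, hc.far k j hk hj, ih (by omega) (by omega)]

theorem down_fix {i j k : ℕ} (hj : j ≤ N) (hij : i < j) (hk : k < N)
    (h1 : k ≠ i) (h2 : k + 1 ≠ i) (h3 : k ≠ j) (h4 : k + 1 ≠ j) : c k (g i j) = g i j := by
  by_cases hkj : k + 1 < j
  · exact hc.down_fix_inner hg hg' hfix hj hij hkj h1 h2
  induction hj using Nat.decreasingInduction with
  | self => omega
  | of_succ j hj ih =>
    by_cases h5 : k = j + 1
    · subst h5
      rw [hg i j hij hj, hg i (j + 1) (by omega) hk, ← hc.braid j hk,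
        hc.down_fix_inner hg hg' hfix (j := j + 2) (by omega) (by omega) (by omega) (by omega)
          (by omega)]
    · rw [hg i j hij hj, ← hc.far j k (by omega) hk,
        ih (by omega) (by omega) (by omega) (by omega)]

theorem down_swap {i : ℕ} (hi : i + 1 ≤ N) : c i (g i (i + 1)) = g i (i + 1) := by
  suffices ∀ j, j ≤ N → 1 ≤ j → c (j - 1) (g (j - 1) j) = g (j - 1) j from
    this (i + 1) hi (by omega)
  intro j hj
  induction hj using Nat.decreasingInduction with
  | self => intro h; exact hfix (N - 1) (by omega) (by omega)
  | of_succ j hj ih =>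
    intro h
    obtain ⟨i, rfl⟩ := Nat.exists_eq_add_of_le' h
    have ih := ih (by omega)
    simp only [Nat.add_sub_cancel] at *
    have h2 : g i (i + 2) = c i (g (i + 1) (i + 2)) := by
      rw [← hc.down_shift hg hg' (by omega) hj, hc.sq i (by omega)]
    rw [hg i (i + 1) (by omega) hj, h2, hc.braid i hj, ih]

end DownPair

/-- Extension of a family indexed by the pairs `i < j` to all pairs, by a symmetry rule `ν`. -/
def symmExt (ν : α → α) (x : ℕ → ℕ → α) (i j : ℕ) : α := if i < j then x i j else ν (x j i)

theorem symmExt_equivariant (hc : IsChainAction N c) {x : ℕ → ℕ → α} {ν : α → α}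
    (hν : ∀ a, ν (ν a) = a) (hcν : ∀ k a, c k (ν a) = ν (c k a))
    (hup : ∀ i j, i < j → j < N → c j (x i j) = x i (j + 1))
    (hshift : ∀ i j, i + 1 < j → j ≤ N → c i (x i j) = x (i + 1) j)
    (hswap : ∀ i, i < N → c i (x i (i + 1)) = ν (x i (i + 1)))
    (hfix : ∀ i j k, i < j → j ≤ N → k < N → k ≠ i → k + 1 ≠ i → k ≠ j → k + 1 ≠ j →
      c k (x i j) = x i j)
    {i j k : ℕ} (hij : i ≠ j) (hi : i ≤ N) (hj : j ≤ N) (hk : k < N) :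
    c k (symmExt ν x i j) = symmExt ν x (adjSwap k i) (adjSwap k j) := by
  have key : ∀ i j, i < j → j ≤ N → c k (x i j) = symmExt ν x (adjSwap k i) (adjSwap k j) := by
    intro i j hij hj
    by_cases h1 : k = i
    · subst h1
      by_cases h2 : j = k + 1
      · subst h2
        simp [adjSwap, symmExt, hswap k hk]
      · have h3 : k + 1 < j := by omega
        simp [adjSwap, symmExt, hij.ne', h2, h3, hshift k j h3 hj]
    by_cases h2 : k + 1 = i
    · subst h2
      have h3 : j ≠ k := by omega
      have h4 : k < j := by omega
      rw [← hshift k j hij hj, hc.sq k hk]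
      simp [adjSwap, symmExt, h3, hij.ne', h4]
    by_cases h3 : k = j
    · subst h3
      have h4 : i < k + 1 := by omega
      have h5 : i ≠ k + 1 := by omega
      simp [adjSwap, symmExt, hup i k hij hk, hij.ne, h4, h5]
    by_cases h4 : k + 1 = j
    · subst h4
      have h5 : i < k := by omega
      rw [← hup i k h5 hk, hc.sq k hk]
      simp [adjSwap, symmExt, hij.ne, h5.ne, h5]
    · rw [hfix i j k hij hj hk h1 h2 h3 h4]
      simp [adjSwap, symmExt, hij, Ne.symm h1, Ne.symm h2, Ne.symm h3, Ne.symm h4]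
  rcases lt_or_gt_of_ne hij with h | h
  · rw [← key i j h hj, symmExt, if_pos h]
  · have hne : adjSwap k i ≠ adjSwap k j := by
      unfold adjSwap; split_ifs <;> omega
    rw [symmExt, if_neg (by omega), hcν, key j i h hi, symmExt, symmExt]
    rcases lt_or_gt_of_ne hne with h' | h'
    · rw [if_neg (by omega), if_pos h', hν]
    · rw [if_pos h', if_neg (by omega)]

end IsChainAction

theorem m_far (T : ClassicalType) {n k l : ℕ} (h : k + 1 < l) (hl : l + 1 < n) :
    T.m n k l = 2 := by
  cases T <;> simp only [ClassicalType.m] <;> split_ifs <;> omega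

theorem m_next (T : ClassicalType) {n k : ℕ} (h : k + 2 < n) : T.m n k (k + 1) = 3 := by
  have h1 : k + 1 ≠ n := by omega
  have h2 : k + 1 + 1 ≠ n := by omega
  cases T <;> simp [ClassicalType.m, h1, h2]

theorem m_D_last {n k : ℕ} (h : k + 1 < n) (h' : k + 3 ≠ n) :
    ClassicalType.m .D n k (n - 1) = 2 := by
  simp only [ClassicalType.m]; split_ifs <;> omega

theorem m_D_last_next {n k : ℕ} (h : k + 3 = n) : ClassicalType.m .D n k (n - 1) = 3 := by
  simp only [ClassicalType.m]; split_ifs <;> omega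

theorem m_B_last {n k : ℕ} (h : k + 2 < n) : ClassicalType.m .B n k (n - 1) = 2 := by
  simp only [ClassicalType.m]; split_ifs <;> omega

theorem m_B_last_next {n k : ℕ} (h : k + 2 = n) : ClassicalType.m .B n k (n - 1) = 4 := by
  simp only [ClassicalType.m]; split_ifs <;> omega

theorem ClassicalType.lt_rank (T : ClassicalType) {n k : ℕ} (h : k + 1 < n) : k < T.rank n := by
  cases T <;> simp only [ClassicalType.rank] <;> omega

variable {T : ClassicalType} {n : ℕ}

/-- Conjugation by `t_k`, up to sign. -/
def twist (T : ClassicalType) (n k : ℕ) : SpinWeyl T n →ₗ[ℂ] SpinWeyl T n :=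
  -(LinearMap.mulLeft ℂ (t T n k) ∘ₗ LinearMap.mulRight ℂ (t T n k))

theorem twist_apply (k : ℕ) (a : SpinWeyl T n) :
    twist T n k a = -(t T n k * (a * t T n k)) := by
  simp [twist]

theorem t_mul_t {k : ℕ} (hk : k < T.rank n) : t T n k * t T n k = 1 := isSpinSystem_t.sq k hk

theorem t_mul_t_mul {k : ℕ} (hk : k < T.rank n) (a : SpinWeyl T n) :
    t T n k * (t T n k * a) = a := by
  rw [← mul_assoc, t_mul_t hk, one_mul]

theorem twist_sq {k : ℕ} (hk : k < T.rank n) (a : SpinWeyl T n) :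
    twist T n k (twist T n k a) = a := by
  simp only [twist_apply, neg_mul, mul_neg, neg_neg, mul_assoc, t_mul_t hk, t_mul_t_mul hk,
    mul_one]

theorem twist_self {k : ℕ} (hk : k < T.rank n) : twist T n k (t T n k) = -t T n k := by
  rw [twist_apply, t_mul_t_mul hk]

theorem twist_comm {k l : ℕ} (hk : k < T.rank n) (hl : l < T.rank n) (h : T.m n k l = 2)
    (a : SpinWeyl T n) : twist T n k (twist T n l a) = twist T n l (twist T n k a) := by
  have h1 := isSpinSystem_t.two k l hk hl h
  have : ∀ k l, twist T n k (twist T n l a) = t T n k * t T n l * a * (t T n l * t T n k) := by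
    intro k l; simp only [twist_apply, neg_mul, mul_neg, neg_neg, mul_assoc]
  rw [this, this, h1]
  simp only [neg_mul, mul_neg]

theorem twist_of_two {k l : ℕ} (hk : k < T.rank n) (hl : l < T.rank n) (h : T.m n k l = 2) :
    twist T n k (t T n l) = t T n l := by
  rw [twist_apply, ← mul_assoc, isSpinSystem_t.two k l hk hl h, neg_mul, neg_neg, mul_assoc,
    t_mul_t hk, mul_one]

theorem twist_braid {k l : ℕ} (hk : k < T.rank n) (hl : l < T.rank n) (h : T.m n k l = 3)
    (a : SpinWeyl T n) :
    twist T n k (twist T n l (twist T n k a)) = twist T n l (twist T n k (twist T n l a)) := by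
  have h1 := isSpinSystem_t.three k l hk hl h
  have : ∀ k l, twist T n k (twist T n l (twist T n k a)) =
      -(t T n k * t T n l * t T n k * a * (t T n k * t T n l * t T n k)) := by
    intro k l; simp only [twist_apply, neg_mul, mul_neg, neg_neg, mul_assoc]
  rw [this, this, h1]

theorem twist_of_three {k l : ℕ} (hk : k < T.rank n) (hl : l < T.rank n) (h : T.m n k l = 3) :
    twist T n k (twist T n l (t T n k)) = t T n l := by
  have h1 := isSpinSystem_t.three k l hk hl h
  have : twist T n k (twist T n l (t T n k)) =
      t T n k * t T n l * t T n k * t T n l * t T n k := by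
    simp only [twist_apply, neg_mul, mul_neg, neg_neg, mul_assoc]
  rw [this, h1]
  simp only [mul_assoc, t_mul_t hk, t_mul_t hl, mul_one]

theorem twist_four {k l : ℕ} (hk : k < T.rank n) (hl : l < T.rank n) (h : T.m n k l = 4)
    (a : SpinWeyl T n) :
    twist T n k (twist T n l (twist T n k (twist T n l a))) =
      twist T n l (twist T n k (twist T n l (twist T n k a))) := by
  have h1 := isSpinSystem_t.four k l hk hl h
  have : ∀ k l, twist T n k (twist T n l (twist T n k (twist T n l a))) =
      t T n k * t T n l * (t T n k * t T n l) * a *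
        (t T n l * t T n k * (t T n l * t T n k)) := by
    intro k l; simp only [twist_apply, neg_mul, mul_neg, neg_neg, mul_assoc]
  rw [this, this, h1]
  simp only [neg_mul, mul_neg]

theorem twist_of_four {k l : ℕ} (hk : k < T.rank n) (hl : l < T.rank n) (h : T.m n k l = 4) :
    twist T n k (twist T n l (t T n k)) = twist T n l (t T n k) := by
  have h1 := isSpinSystem_t.four k l hk hl h
  have : twist T n k (twist T n l (t T n k)) =
      t T n k * t T n l * (t T n k * t T n l) * t T n k := by
    simp only [twist_apply, neg_mul, mul_neg, neg_neg, mul_assoc]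
  rw [this, h1]
  simp only [mul_assoc, t_mul_t hk, mul_one, neg_mul, twist_apply]

theorem isChainAction_twist (T : ClassicalType) (n : ℕ) :
    IsChainAction (n - 1) fun k (a : SpinWeyl T n) => twist T n k a where
  sq k hk x := twist_sq (T.lt_rank (by omega)) x
  far k l h hl x := twist_comm (T.lt_rank (by omega)) (T.lt_rank (by omega))
    (m_far T h (by omega)) x
  braid k hk x := twist_braid (T.lt_rank (by omega)) (T.lt_rank (by omega))
    (m_next T (by omega)) x

theorem twist_far {k l : ℕ} (hk : k + 1 < n) (hl : l + 1 < n) (h : k + 1 < l ∨ l + 1 < k) :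
    twist T n k (t T n l) = t T n l := by
  apply twist_of_two (T.lt_rank hk) (T.lt_rank hl)
  rcases h with h | h
  · exact m_far T h hl
  · rw [m_symm]; exact m_far T h hk

theorem tUp_succ {a b : ℕ} (h : a ≤ b) : tUp T n a (b + 1) = tUp T n a b * t T n b := by
  simp [tUp, List.Ico.succ_top h]

theorem tDown_succ {a b : ℕ} (h : a ≤ b) : tDown T n (b + 1) a = t T n b * tDown T n b a := by
  simp [tDown, List.Ico.succ_top h]

theorem tUp_cons {a b : ℕ} (h : a < b) : tUp T n a b = t T n a * tUp T n (a + 1) b := by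
  simp [tUp, List.Ico.eq_cons h]

theorem tDown_cons {a b : ℕ} (h : a < b) : tDown T n b a = tDown T n b (a + 1) * t T n a := by
  simp [tDown, List.Ico.eq_cons h]

theorem tUp_self (a : ℕ) : tUp T n a a = 1 := by simp [tUp]

theorem tDown_self (a : ℕ) : tDown T n a a = 1 := by simp [tDown]

theorem neg_one_pow_mul (e : ℕ) (a b : SpinWeyl T n) : a * ((-1) ^ e * b) = (-1) ^ e * (a * b) := by
  rw [← mul_assoc, ← mul_assoc, ((Commute.neg_one_right a).pow_right e).eq]

theorem bracketLt_self (i : ℕ) : bracketLt T n i (i + 1) = t T n i := by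
  simp [bracketLt, tUp_self, tDown_self]

theorem bracketLt_succ {i j : ℕ} (h : i < j) :
    bracketLt T n i (j + 1) = twist T n j (bracketLt T n i j) := by
  obtain ⟨d, rfl⟩ := Nat.exists_eq_add_of_lt h
  rw [twist_apply, bracketLt, bracketLt, tDown_succ (by omega), tUp_succ (by omega),
    show i + d + 1 + 1 - i - 1 = (i + d + 1 - i - 1) + 1 by omega, pow_succ]
  simp only [mul_assoc, neg_one_pow_mul, neg_mul, one_mul, mul_neg]

theorem barBracketLt_succ {i j : ℕ} (h : i < j) (hj : j < n - 1) :
    barBracketLt T n i j = twist T n j (barBracketLt T n i (j + 1)) := by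
  obtain ⟨d, rfl⟩ := Nat.exists_eq_add_of_lt h
  cases T with
  | A => simp [barBracketLt]
  | D =>
    simp only [barBracketLt]
    rw [twist_apply, tUp_cons hj, tDown_cons hj,
      show i + d + 1 + 1 - i - 1 = (i + d + 1 - i - 1) + 1 by omega, pow_succ]
    simp only [mul_assoc, neg_one_pow_mul, neg_mul, one_mul, mul_neg, neg_neg]
  | B =>
    simp only [barBracketLt]
    rw [twist_apply, tUp_cons hj, tDown_cons hj,
      show i + d + 1 + 1 - i = (i + d + 1 - i) + 1 by omega, pow_succ]
    simp only [mul_assoc, neg_one_pow_mul, neg_mul, one_mul, mul_neg, neg_neg]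

theorem barBracketLt_last {i : ℕ} (hi : i + 1 < n - 1) :
    barBracketLt T n i (n - 1) = twist T n i (barBracketLt T n (i + 1) (n - 1)) := by
  cases T with
  | A => simp [barBracketLt]
  | D =>
    simp only [barBracketLt]
    rw [twist_apply, tUp_cons (a := i) (by omega), tDown_cons (a := i) (by omega),
      show n - 1 - i - 1 = (n - 1 - (i + 1) - 1) + 1 by omega, pow_succ]
    simp only [tUp_self, tDown_self, mul_assoc, neg_one_pow_mul, neg_mul, one_mul, mul_neg,
      mul_one]
  | B =>
    simp only [barBracketLt]
    rw [twist_apply, tUp_cons (a := i) (by omega), tDown_cons (a := i) (by omega),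
      show n - 1 - i = (n - 1 - (i + 1)) + 1 by omega, pow_succ]
    simp only [tUp_self, tDown_self, mul_assoc, neg_one_pow_mul, neg_mul, one_mul, mul_neg,
      mul_one]

theorem barBracketLt_D (h : 2 ≤ n) : barBracketLt .D n (n - 2) (n - 1) = t .D n (n - 1) := by
  simp [barBracketLt, tUp_self, tDown_self, show n - 1 - (n - 2) - 1 = 0 by omega]

theorem barBracketLt_B (h : 2 ≤ n) :
    barBracketLt .B n (n - 2) (n - 1) = twist .B n (n - 1) (t .B n (n - 2)) := by
  simp [barBracketLt, tUp_self, tDown_self, show n - 1 - (n - 2) = 1 by omega, twist_apply,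
    mul_assoc]

theorem D_last_lt_rank (h : 2 ≤ n) : n - 1 < ClassicalType.rank .D n := by
  simp only [ClassicalType.rank]; omega

theorem B_last_lt_rank (h : 2 ≤ n) : n - 1 < ClassicalType.rank .B n := by
  simp only [ClassicalType.rank]; omega

theorem bracketLt_next {i : ℕ} (hi : i + 1 < n - 1) :
    twist T n i (twist T n (i + 1) (bracketLt T n i (i + 1))) =
      bracketLt T n (i + 1) (i + 2) := by
  rw [bracketLt_self, bracketLt_self,
    twist_of_three (T.lt_rank (by omega)) (T.lt_rank (by omega)) (m_next T (by omega))]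

theorem bracketLt_far (i k : ℕ) (hi : i < n - 1) (hk : k < n - 1) (h : k + 1 < i ∨ i + 1 < k) :
    twist T n k (bracketLt T n i (i + 1)) = bracketLt T n i (i + 1) := by
  rw [bracketLt_self, twist_far (by omega) (by omega) h]

theorem bracketLt_shift {i j : ℕ} (hij : i + 1 < j) (hj : j ≤ n - 1) :
    twist T n i (bracketLt T n i j) = bracketLt T n (i + 1) j :=
  (isChainAction_twist T n).up_shift (f := bracketLt T n) (fun _ _ h _ => bracketLt_succ h)
    (fun _ hi => bracketLt_next hi) hij hj

theorem bracketLt_fix {i j k : ℕ} (hij : i < j) (hj : j ≤ n - 1) (hk : k < n - 1)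
    (h1 : k ≠ i) (h2 : k + 1 ≠ i) (h3 : k ≠ j) (h4 : k + 1 ≠ j) :
    twist T n k (bracketLt T n i j) = bracketLt T n i j :=
  (isChainAction_twist T n).up_fix (f := bracketLt T n) (fun _ _ h _ => bracketLt_succ h)
    bracketLt_far hij hj hk h1 h2 h3 h4

theorem barBracketLt_base (k : ℕ) (hk : k < n - 1) (h : k + 2 ≠ n - 1) :
    twist T n k (barBracketLt T n (n - 1 - 1) (n - 1)) = barBracketLt T n (n - 1 - 1) (n - 1) := by
  rw [show n - 1 - 1 = n - 2 by omega]
  cases T with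
  | A => simp [barBracketLt]
  | D =>
    rw [barBracketLt_D (by omega), twist_of_two (ClassicalType.lt_rank _ (by omega))
      (D_last_lt_rank (by omega)) (m_D_last (by omega) (by omega))]
  | B =>
    rw [barBracketLt_B (by omega)]
    by_cases h' : k + 2 = n
    · obtain rfl : k = n - 2 := by omega
      exact twist_of_four (ClassicalType.lt_rank _ (by omega)) (B_last_lt_rank (by omega))
        (m_B_last_next h')
    · rw [twist_comm (ClassicalType.lt_rank _ (by omega)) (B_last_lt_rank (by omega))
        (m_B_last (by omega)), twist_far (by omega) (by omega) (by omega)]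

theorem barBracketLt_shift {i j : ℕ} (hij : i + 1 < j) (hj : j ≤ n - 1) :
    twist T n i (barBracketLt T n i j) = barBracketLt T n (i + 1) j :=
  (isChainAction_twist T n).down_shift (g := barBracketLt T n) (fun _ _ h hj => barBracketLt_succ h hj)
    (fun _ hi => barBracketLt_last hi) hij hj

theorem barBracketLt_fix {i j k : ℕ} (hij : i < j) (hj : j ≤ n - 1) (hk : k < n - 1)
    (h1 : k ≠ i) (h2 : k + 1 ≠ i) (h3 : k ≠ j) (h4 : k + 1 ≠ j) :
    twist T n k (barBracketLt T n i j) = barBracketLt T n i j :=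
  (isChainAction_twist T n).down_fix (g := barBracketLt T n) (fun _ _ h hj => barBracketLt_succ h hj)
    (fun _ hi => barBracketLt_last hi) barBracketLt_base hj hij hk h1 h2 h3 h4

theorem barBracketLt_swap {i : ℕ} (hi : i < n - 1) :
    twist T n i (barBracketLt T n i (i + 1)) = barBracketLt T n i (i + 1) :=
  (isChainAction_twist T n).down_swap (g := barBracketLt T n) (fun _ _ h hj => barBracketLt_succ h hj)
    (fun _ hi => barBracketLt_last hi) barBracketLt_base hi

/-- The elements attached to the roots `e_i - e_j` (for `s = false`) and `e_i + e_j` (for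
`s = true`). -/
def root (T : ClassicalType) (n : ℕ) (s : Bool) (i j : ℕ) : SpinWeyl T n :=
  if s then IsChainAction.symmExt id (barBracketLt T n) i j
  else IsChainAction.symmExt (fun a => -a) (bracketLt T n) i j

/-- The element attached to the short root `e_i`; it is zero except in type `B`. -/
def shortRoot (T : ClassicalType) (n i : ℕ) : SpinWeyl T n :=
  match T with
  | .A => 0
  | .D => 0
  | .B => (-1) ^ (n - 1 - i) * (tUp .B n i (n - 1) * t .B n (n - 1) * tDown .B n (n - 1) i)

theorem root_chain (s : Bool) {i j k : ℕ} (hij : i ≠ j) (hi : i < n) (hj : j < n)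
    (hk : k + 1 < n) :
    twist T n k (root T n s i j) = root T n s (adjSwap k i) (adjSwap k j) := by
  have hi' : i ≤ n - 1 := by omega
  have hj' : j ≤ n - 1 := by omega
  have hk' : k < n - 1 := by omega
  cases s with
  | true =>
    exact IsChainAction.symmExt_equivariant (ν := id) (x := barBracketLt T n)
      (isChainAction_twist T n) (fun _ => rfl) (fun _ _ => rfl)
      (fun i j h hj => by
        simp only [barBracketLt_succ h hj]; rw [twist_sq (T.lt_rank (by omega))])
      (fun i j h hj => barBracketLt_shift h hj) (fun i hi => barBracketLt_swap hi)
      (fun i j k h hj hk => barBracketLt_fix h hj hk) hij hi' hj' hk'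
  | false =>
    exact IsChainAction.symmExt_equivariant (ν := fun a => -a) (x := bracketLt T n)
      (isChainAction_twist T n) (fun _ => neg_neg _)
      (fun _ _ => map_neg _ _) (fun i j h hj => (bracketLt_succ h).symm)
      (fun i j h hj => bracketLt_shift h hj)
      (fun i hi => by simp only [bracketLt_self]; rw [twist_self (T.lt_rank (by omega))])
      (fun i j k h hj hk => bracketLt_fix h hj hk) hij hi' hj' hk'

theorem shortRoot_succ {i : ℕ} (hi : i < n - 1) :
    shortRoot T n i = twist T n i (shortRoot T n (i + 1)) := by
  cases T with
  | A => simp [shortRoot]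
  | D => simp [shortRoot]
  | B =>
    simp only [shortRoot]
    rw [twist_apply, tUp_cons hi, tDown_cons hi,
      show n - 1 - i = (n - 1 - (i + 1)) + 1 by omega, pow_succ]
    simp only [mul_assoc, neg_one_pow_mul, neg_mul, one_mul, mul_neg]

theorem shortRoot_last : shortRoot .B n (n - 1) = t .B n (n - 1) := by
  simp [shortRoot, tUp_self, tDown_self]

theorem shortRoot_chain {i k : ℕ} (hi : i < n) (hk : k + 1 < n) :
    twist T n k (shortRoot T n i) = shortRoot T n (adjSwap k i) := by
  refine (isChainAction_twist T n).single_equivariant (s := shortRoot T n) (fun i hi => shortRoot_succ hi) ?_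
    (by omega) (by omega)
  intro k hk
  cases T with
  | A => simp [shortRoot]
  | D => simp [shortRoot]
  | B =>
    rw [shortRoot_last, twist_of_two (ClassicalType.lt_rank _ (by omega))
      (B_last_lt_rank (by omega)) (m_B_last (by omega))]

theorem bracketLt_commute_of_far {k i j : ℕ} (hij : i < j) (hj : j < n) (hk : k < T.rank n)
    (h : ∀ l, i ≤ l → l < j → T.m n k l = 2) :
    twist T n k (bracketLt T n i j) = bracketLt T n i j := by
  induction j, hij using Nat.le_induction with
  | base => rw [bracketLt_self, twist_of_two hk (T.lt_rank (by omega)) (h i le_rfl (by omega))]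
  | succ j hij ih =>
    rw [bracketLt_succ hij, twist_comm hk (T.lt_rank (by omega)) (h j (by omega) (by omega)),
      ih (by omega) fun l h1 h2 => h l h1 (by omega)]

section D

theorem D_last_bracketLt {i j : ℕ} (hij : i < j) (hj : j + 2 < n) :
    twist .D n (n - 1) (bracketLt .D n i j) = bracketLt .D n i j := by
  refine bracketLt_commute_of_far hij (by omega) (D_last_lt_rank (by omega)) fun l h1 h2 => ?_
  rw [m_symm, m_D_last (by omega) (by omega)]

theorem D_last_bracketLt_twin (h : 2 ≤ n) :
    twist .D n (n - 1) (bracketLt .D n (n - 2) (n - 1)) = bracketLt .D n (n - 2) (n - 1) := by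
  refine bracketLt_commute_of_far (by omega) (by omega) (D_last_lt_rank (by omega))
    fun l h1 h2 => ?_
  rw [m_symm, m_D_last (by omega) (by omega)]

theorem D_last_bracketLt_left {i : ℕ} (hi : i + 2 < n) :
    twist .D n (n - 1) (bracketLt .D n i (n - 2)) = barBracketLt .D n i (n - 1) := by
  have h3 : i ≤ n - 3 := by omega
  induction h3 using Nat.decreasingInduction with
  | self =>
    have h2 : bracketLt .D n (n - 3) (n - 2) = t .D n (n - 3) := by
      rw [show n - 2 = n - 3 + 1 by omega, bracketLt_self]
    rw [barBracketLt_last (by omega), show n - 3 + 1 = n - 2 by omega, barBracketLt_D (by omega),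
      h2, ← twist_of_three (D_last_lt_rank (by omega)) (ClassicalType.lt_rank .D (by omega))
        (show ClassicalType.m .D n (n - 1) (n - 3) = 3 by
          rw [m_symm, m_D_last_next (by omega)]),
      twist_sq (D_last_lt_rank (by omega))]
  | of_succ i hi' ih =>
    rw [barBracketLt_last (by omega), ← ih (by omega),
      twist_comm (ClassicalType.lt_rank .D (by omega)) (D_last_lt_rank (by omega))
        (m_D_last (by omega) (by omega)),
      ← bracketLt_shift (by omega) (by omega), twist_sq (ClassicalType.lt_rank .D (by omega))]

theorem bracketLt_penultimate {i : ℕ} (hi : i + 2 < n) :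
    bracketLt T n i (n - 1) = twist T n (n - 2) (bracketLt T n i (n - 2)) := by
  rw [← bracketLt_succ (by omega), show n - 2 + 1 = n - 1 by omega]

theorem barBracketLt_penultimate {i : ℕ} (hi : i + 2 < n) :
    barBracketLt T n i (n - 2) = twist T n (n - 2) (barBracketLt T n i (n - 1)) := by
  rw [barBracketLt_succ (by omega) (by omega), show n - 2 + 1 = n - 1 by omega]

theorem D_last_bracketLt_right {i : ℕ} (hi : i + 2 < n) :
    twist .D n (n - 1) (bracketLt .D n i (n - 1)) = barBracketLt .D n i (n - 2) := by
  rw [barBracketLt_penultimate hi, ← D_last_bracketLt_left hi, bracketLt_penultimate hi,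
    twist_comm (ClassicalType.lt_rank .D (by omega)) (D_last_lt_rank (by omega))
      (m_D_last (by omega) (by omega))]

theorem D_last_barBracketLt_twin (h : 2 ≤ n) :
    twist .D n (n - 1) (barBracketLt .D n (n - 2) (n - 1)) = -barBracketLt .D n (n - 2) (n - 1) := by
  rw [barBracketLt_D h, twist_self (D_last_lt_rank h)]

theorem D_last_barBracketLt {i j : ℕ} (hij : i < j) (hj : j + 2 < n) :
    twist .D n (n - 1) (barBracketLt .D n i j) = barBracketLt .D n i j := by
  have h3 : j ≤ n - 3 := by omega
  induction h3 using Nat.decreasingInduction with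
  | self =>
    have r1 : n - 1 < ClassicalType.rank .D n := D_last_lt_rank (by omega)
    have r2 : n - 2 < ClassicalType.rank .D n := ClassicalType.lt_rank .D (by omega)
    have r3 : n - 3 < ClassicalType.rank .D n := ClassicalType.lt_rank .D (by omega)
    have h1 : bracketLt .D n i (n - 2) = twist .D n (n - 3) (bracketLt .D n i (n - 3)) := by
      rw [← bracketLt_succ (by omega), show n - 3 + 1 = n - 2 by omega]
    have h2 : twist .D n (n - 2) (bracketLt .D n i (n - 3)) = bracketLt .D n i (n - 3) :=
      bracketLt_fix (by omega) (by omega) (by omega) (by omega) (by omega) (by omega) (by omega)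
    have m13 : ClassicalType.m .D n (n - 1) (n - 3) = 3 := by
      rw [m_symm, m_D_last_next (by omega)]
    have m32 : ClassicalType.m .D n (n - 3) (n - 2) = 3 := by
      rw [show n - 2 = n - 3 + 1 by omega, m_next .D (by omega)]
    have key : barBracketLt .D n i (n - 3) = twist .D n (n - 3) (twist .D n (n - 1)
        (twist .D n (n - 2) (twist .D n (n - 3) (bracketLt .D n i (n - 3))))) := by
      rw [barBracketLt_succ (by omega) (by omega), show n - 3 + 1 = n - 2 by omega,
        ← D_last_bracketLt_right (by omega), bracketLt_penultimate (by omega), h1]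
    rw [key, twist_braid r1 r3 m13, twist_braid r3 r2 m32, h2]
  | of_succ j hj' ih =>
    rw [barBracketLt_succ hij (by omega), twist_comm (D_last_lt_rank (by omega))
      (ClassicalType.lt_rank .D (by omega))
      (by rw [m_symm, m_D_last (by omega) (by omega)]), ih (by omega) (by omega)]

end D

section B

theorem B_last_bracketLt {i j : ℕ} (hij : i < j) (hj : j + 1 < n) :
    twist .B n (n - 1) (bracketLt .B n i j) = bracketLt .B n i j := by
  refine bracketLt_commute_of_far hij (by omega) (B_last_lt_rank (by omega)) fun l h1 h2 => ?_
  rw [m_symm, m_B_last (by omega)]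

theorem B_last_bracketLt_last {i : ℕ} (hi : i + 1 < n) :
    twist .B n (n - 1) (bracketLt .B n i (n - 1)) = barBracketLt .B n i (n - 1) := by
  have h3 : i ≤ n - 2 := by omega
  induction h3 using Nat.decreasingInduction with
  | self =>
    rw [barBracketLt_B (by omega)]
    congr 1
    rw [show n - 1 = n - 2 + 1 by omega, bracketLt_self]
  | of_succ i hi' ih =>
    rw [barBracketLt_last (by omega), ← ih (by omega),
      twist_comm (ClassicalType.lt_rank .B (by omega)) (B_last_lt_rank (by omega))
        (m_B_last (by omega)),
      ← bracketLt_shift (by omega) (by omega), twist_sq (ClassicalType.lt_rank .B (by omega))]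

theorem B_last_barBracketLt {i j : ℕ} (hij : i < j) (hj : j + 1 < n) :
    twist .B n (n - 1) (barBracketLt .B n i j) = barBracketLt .B n i j := by
  have h3 : j ≤ n - 2 := by omega
  induction h3 using Nat.decreasingInduction with
  | self =>
    have r1 : n - 1 < ClassicalType.rank .B n := B_last_lt_rank (by omega)
    have r2 : n - 2 < ClassicalType.rank .B n := ClassicalType.lt_rank .B (by omega)
    have m4 : ClassicalType.m .B n (n - 1) (n - 2) = 4 := by
      rw [m_symm, m_B_last_next (by omega)]
    rw [barBracketLt_penultimate (by omega), ← B_last_bracketLt_last (by omega),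
      bracketLt_penultimate (by omega), twist_four r1 r2 m4,
      B_last_bracketLt (by omega) (by omega)]
  | of_succ j hj' ih =>
    rw [barBracketLt_succ hij (by omega), twist_comm (B_last_lt_rank (by omega))
      (ClassicalType.lt_rank .B (by omega))
      (by rw [m_symm, m_B_last (by omega)]), ih (by omega) (by omega)]

theorem B_last_shortRoot {i : ℕ} (hi : i + 1 < n) :
    twist .B n (n - 1) (shortRoot .B n i) = shortRoot .B n i := by
  have h3 : i ≤ n - 2 := by omega
  induction h3 using Nat.decreasingInduction with
  | self =>
    rw [shortRoot_succ (by omega), show n - 2 + 1 = n - 1 by omega, shortRoot_last]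
    exact twist_of_four (B_last_lt_rank (by omega)) (ClassicalType.lt_rank .B (by omega))
      (by rw [m_symm, m_B_last_next (by omega)])
  | of_succ i hi' ih =>
    rw [shortRoot_succ (by omega), twist_comm (B_last_lt_rank (by omega))
      (ClassicalType.lt_rank .B (by omega))
      (by rw [m_symm, m_B_last (by omega)]), ih (by omega)]

end B

/-- The sign `-1` for `true`, and `1` for `false`. -/
def bsign (s : Bool) : ℂ := if s then -1 else 1

@[simp] theorem bsign_true : bsign true = -1 := rfl

@[simp] theorem bsign_false : bsign false = 1 := rfl

theorem root_lt (s : Bool) {i j : ℕ} (h : i < j) :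
    root T n s i j = if s then barBracketLt T n i j else bracketLt T n i j := by
  simp [root, IsChainAction.symmExt, h]

theorem root_symm (s : Bool) {i j : ℕ} (h : i ≠ j) :
    root T n s j i = -(bsign s • root T n s i j) := by
  rcases lt_or_gt_of_ne h with h | h <;> cases s <;>
    simp [root, IsChainAction.symmExt, h, h.not_gt]

theorem actNat_chain {k : ℕ} (hk : k + 1 < n) (j : ℕ) (b : Bool) :
    actNat T n k (j, b) = (adjSwap k j, b) := by
  simp only [actNat, hk, if_true, signedSwap, adjSwap]
  split_ifs <;> simp

theorem actNat_D_last (h : 1 ≤ n) (p : ℕ × Bool) :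
    actNat .D n (n - 1) p = signedSwap (n - 2) (n - 1) true p := by
  simp [actNat, show ¬ n - 1 + 1 < n by omega]

theorem actNat_B_last (h : 1 ≤ n) (p : ℕ × Bool) :
    actNat .B n (n - 1) p = signedSwap (n - 1) (n - 1) true p := by
  simp [actNat, show ¬ n - 1 + 1 < n by omega]

theorem actNat_eq (k j : ℕ) (b : Bool) : actNat T n k (j, b) =
    ((actNat T n k (j, false)).1, xor b (actNat T n k (j, false)).2) := by
  have h : ∀ a a' s, signedSwap a a' s (j, b) =
      ((signedSwap a a' s (j, false)).1, xor b (signedSwap a a' s (j, false)).2) := by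
    intro a a' s
    simp only [signedSwap]
    split_ifs <;> simp [Bool.xor_comm]
  cases T <;> by_cases hk : k + 1 < n <;> simp [actNat, hk, h _ _ _]

/-- The permutation of the coordinates underlying the simple reflection `s_k`. -/
def permNat (T : ClassicalType) (n k j : ℕ) : ℕ := (actNat T n k (j, false)).1

/-- Whether the simple reflection `s_k` changes the sign of the coordinate `j`. -/
def flipNat (T : ClassicalType) (n k j : ℕ) : Bool := (actNat T n k (j, false)).2

theorem actNat_mk (k j : ℕ) (b : Bool) :
    actNat T n k (j, b) = (permNat T n k j, xor b (flipNat T n k j)) := actNat_eq k j b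

@[simp]
theorem permNat_permNat (k j : ℕ) : permNat T n k (permNat T n k j) = j := by
  have h := actNat_sq T n k (j, false)
  simp only [actNat_mk] at h
  exact congrArg Prod.fst h

@[simp]
theorem flipNat_permNat (k j : ℕ) : flipNat T n k (permNat T n k j) = flipNat T n k j := by
  have h := congrArg Prod.snd (actNat_sq T n k (j, false))
  simp only [actNat_mk] at h
  revert h
  cases flipNat T n k j <;> cases flipNat T n k (permNat T n k j) <;> simp

theorem permNat_injective (k : ℕ) : Function.Injective (permNat T n k) :=
  Function.LeftInverse.injective (permNat_permNat k)

theorem permNat_lt {k j : ℕ} (hj : j < n) : permNat T n k j < n := by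
  have h : ∀ a a' s, a < n → a' < n → (signedSwap a a' s (j, false)).1 < n := by
    intro a a' s ha ha'
    simp only [signedSwap]
    split_ifs <;> assumption
  by_cases hk : k + 1 < n
  · simp only [permNat, actNat, hk, if_true]
    exact h _ _ _ (by omega) hk
  · cases T <;> simp only [permNat, actNat, hk, if_false, id]
    · exact hj
    · exact h _ _ _ (by omega) (by omega)
    · exact h _ _ _ (by omega) (by omega)

/-- The equivariance of the elements attached to the long roots. -/
theorem twist_root (hn : T.Admissible n) {k : ℕ} (hk : k < T.rank n) (s : Bool) {i j : ℕ}
    (hij : i ≠ j) (hi : i < n) (hj : j < n) :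
    twist T n k (root T n s i j) = bsign (flipNat T n k i) •
      root T n (xor s (xor (flipNat T n k i) (flipNat T n k j)))
        (permNat T n k i) (permNat T n k j) := by
  wlog hlt : i < j generalizing i j
  · have hne : permNat T n k j ≠ permNat T n k i := (permNat_injective k).ne hij.symm
    rw [root_symm s hij.symm, map_neg, map_smul, this hij.symm hj hi (by omega),
      root_symm _ hne]
    cases s <;> cases flipNat T n k i <;> cases flipNat T n k j <;> simp
  simp only [permNat, flipNat]
  by_cases hk' : k + 1 < n
  · simp only [actNat_chain hk', root_chain s hij hi hj hk']
    simp
  cases T with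
  | A => simp only [ClassicalType.rank] at hk; omega
  | D =>
    simp only [ClassicalType.rank, ClassicalType.Admissible] at hk hn
    obtain rfl : k = n - 1 := by omega
    have r1 : n - 1 < ClassicalType.rank .D n := D_last_lt_rank (by omega)
    simp only [actNat_D_last (show 1 ≤ n by omega)]
    by_cases h1 : j + 2 < n
    · have e1 : i ≠ n - 2 := by omega
      have e2 : i ≠ n - 1 := by omega
      have e3 : j ≠ n - 2 := by omega
      have e4 : j ≠ n - 1 := by omega
      simp [signedSwap, e1, e2, e3, e4, root_lt s hlt]
      cases s <;> simp [D_last_bracketLt hlt h1, D_last_barBracketLt hlt h1]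
    by_cases h2 : j + 2 = n
    · obtain rfl : j = n - 2 := by omega
      have e1 : i ≠ n - 2 := by omega
      have e2 : i ≠ n - 1 := by omega
      simp [signedSwap, e1, e2, root_lt s hlt, root_lt _ (show i < n - 1 by omega)]
      cases s
      · simp [D_last_bracketLt_left (show i + 2 < n by omega)]
      · simp [← D_last_bracketLt_right (show i + 2 < n by omega), twist_sq r1]
    obtain rfl : j = n - 1 := by omega
    have e0 : n - 1 ≠ n - 2 := by omega
    by_cases h3 : i + 2 = n
    · obtain rfl : i = n - 2 := by omega
      simp [signedSwap, e0, root_symm _ e0.symm]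
      simp [root_lt _ hlt]
      cases s
      · simp [D_last_bracketLt_twin (show 2 ≤ n by omega)]
      · simp [D_last_barBracketLt_twin (show 2 ≤ n by omega)]
    · have e1 : i ≠ n - 2 := by omega
      have e2 : i ≠ n - 1 := by omega
      simp [signedSwap, e0, e1, e2, root_lt s hlt, root_lt _ (show i < n - 2 by omega)]
      cases s
      · simp [D_last_bracketLt_right (show i + 2 < n by omega)]
      · simp [← D_last_bracketLt_left (show i + 2 < n by omega), twist_sq r1]
  | B =>
    simp only [ClassicalType.rank, ClassicalType.Admissible] at hk hn
    obtain rfl : k = n - 1 := by omega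
    have r1 : n - 1 < ClassicalType.rank .B n := B_last_lt_rank (by omega)
    simp only [actNat_B_last (show 1 ≤ n by omega)]
    have e2 : i ≠ n - 1 := by omega
    by_cases h1 : j + 1 < n
    · have e4 : j ≠ n - 1 := by omega
      simp [signedSwap, e2, e4, root_lt s hlt]
      cases s <;> simp [B_last_bracketLt hlt h1, B_last_barBracketLt hlt h1]
    · obtain rfl : j = n - 1 := by omega
      simp [signedSwap, e2, root_lt _ hlt]
      cases s
      · simp [B_last_bracketLt_last (show i + 1 < n by omega)]
      · simp [← B_last_bracketLt_last (show i + 1 < n by omega), twist_sq r1]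

/-- The equivariance of the elements attached to the short roots. -/
theorem twist_shortRoot (hn : T.Admissible n) {k : ℕ} (hk : k < T.rank n) {i : ℕ} (hi : i < n) :
    twist T n k (shortRoot T n i) = bsign (flipNat T n k i) •
      shortRoot T n (permNat T n k i) := by
  simp only [permNat, flipNat]
  by_cases hk' : k + 1 < n
  · simp [actNat_chain hk', shortRoot_chain hi hk']
  cases T with
  | A => simp only [ClassicalType.rank] at hk; omega
  | D => simp [shortRoot]
  | B =>
    simp only [ClassicalType.rank, ClassicalType.Admissible] at hk hn
    obtain rfl : k = n - 1 := by omega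
    simp only [actNat_B_last (show 1 ≤ n by omega)]
    by_cases h1 : i + 1 < n
    · have e2 : i ≠ n - 1 := by omega
      simp [signedSwap, e2, B_last_shortRoot h1]
    · obtain rfl : i = n - 1 := by omega
      simp [signedSwap, shortRoot_last, twist_self (B_last_lt_rank hn)]

/-- The permutation of the coordinates underlying the simple reflection `s_k`. -/
def perm (T : ClassicalType) (n k : ℕ) (i : Fin n) : Fin n := ⟨permNat T n k i, permNat_lt i.2⟩

/-- The sign with which the simple reflection `s_k` moves the coordinate `i`. -/
def eta (T : ClassicalType) (n k : ℕ) (i : Fin n) : ℂ := bsign (flipNat T n k i)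

@[simp]
theorem perm_perm (k : ℕ) (i : Fin n) : perm T n k (perm T n k i) = i :=
  Fin.ext (permNat_permNat k i)

@[simp]
theorem eta_perm (k : ℕ) (i : Fin n) : eta T n k (perm T n k i) = eta T n k i := by
  simp [eta, perm]

@[simp]
theorem bsign_mul_self (s : Bool) : bsign s * bsign s = 1 := by cases s <;> simp

theorem bsign_xor (s s' : Bool) : bsign (xor s s') = bsign s * bsign s' := by
  cases s <;> cases s' <;> simp

@[simp]
theorem eta_mul_eta (k : ℕ) (i : Fin n) : eta T n k i * eta T n k i = 1 := bsign_mul_self _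

theorem perm_injective (k : ℕ) : Function.Injective (perm T n k) :=
  Function.LeftInverse.injective (perm_perm k)

/-- The signed permutation matrix of the simple reflection `s_k`. -/
def sgnMatrix (R : Type*) [Ring R] [Algebra ℂ R] (T : ClassicalType) (n k : ℕ) :
    Matrix (Fin n) (Fin n) R :=
  Matrix.of fun j i => if i = perm T n k j then algebraMap ℂ R (eta T n k j) else 0

theorem sgnMatrix_mul {R : Type*} [Ring R] [Algebra ℂ R] (k : ℕ) (X : Matrix (Fin n) (Fin n) R)
    (j i : Fin n) : (sgnMatrix R T n k * X) j i = eta T n k j • X (perm T n k j) i := by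
  simp [sgnMatrix, Matrix.mul_apply, Algebra.smul_def]

theorem perm_eta_two (hn : T.Admissible n) {k l : ℕ} (hk : k < T.rank n) (hl : l < T.rank n)
    (h : T.m n k l = 2) (j : Fin n) : perm T n k (perm T n l j) = perm T n l (perm T n k j) ∧
      eta T n k j * eta T n l (perm T n k j) = eta T n l j * eta T n k (perm T n l j) := by
  have : actNat T n k (actNat T n l ((j : ℕ), false)) =
      actNat T n l (actNat T n k ((j : ℕ), false)) :=
    congrFun ((isCoxeterSystem_actNat hn).two k l hk hl h) (j, false)
  simp only [actNat_mk, Prod.mk.injEq] at this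
  refine ⟨Fin.ext this.1, ?_⟩
  simpa only [bsign_xor, bsign_false, one_mul, eta, perm] using (congrArg bsign this.2).symm

theorem perm_eta_three (hn : T.Admissible n) {k l : ℕ} (hk : k < T.rank n) (hl : l < T.rank n)
    (h : T.m n k l = 3) (j : Fin n) :
    perm T n k (perm T n l (perm T n k j)) = perm T n l (perm T n k (perm T n l j)) ∧
      eta T n k j * eta T n l (perm T n k j) * eta T n k (perm T n l (perm T n k j)) =
        eta T n l j * eta T n k (perm T n l j) * eta T n l (perm T n k (perm T n l j)) := by
  have : actNat T n k (actNat T n l (actNat T n k ((j : ℕ), false))) =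
      actNat T n l (actNat T n k (actNat T n l ((j : ℕ), false))) :=
    congrFun ((isCoxeterSystem_actNat hn).three k l hk hl h) (j, false)
  simp only [actNat_mk, Prod.mk.injEq] at this
  refine ⟨Fin.ext this.1, ?_⟩
  simpa only [bsign_xor, bsign_false, one_mul, eta, perm] using congrArg bsign this.2

theorem perm_eta_four (hn : T.Admissible n) {k l : ℕ} (hk : k < T.rank n) (hl : l < T.rank n)
    (h : T.m n k l = 4) (j : Fin n) :
    perm T n k (perm T n l (perm T n k (perm T n l j))) =
        perm T n l (perm T n k (perm T n l (perm T n k j))) ∧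
      eta T n k j * eta T n l (perm T n k j) * eta T n k (perm T n l (perm T n k j)) *
          eta T n l (perm T n k (perm T n l (perm T n k j))) =
        eta T n l j * eta T n k (perm T n l j) * eta T n l (perm T n k (perm T n l j)) *
          eta T n k (perm T n l (perm T n k (perm T n l j))) := by
  have : actNat T n k (actNat T n l (actNat T n k (actNat T n l ((j : ℕ), false)))) =
      actNat T n l (actNat T n k (actNat T n l (actNat T n k ((j : ℕ), false)))) :=
    congrFun ((isCoxeterSystem_actNat hn).four k l hk hl h) (j, false)
  simp only [actNat_mk, Prod.mk.injEq] at this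
  refine ⟨Fin.ext this.1, ?_⟩
  simpa only [bsign_xor, bsign_false, one_mul, eta, perm] using (congrArg bsign this.2).symm

theorem isCoxeterSystem_sgnMatrix (hn : T.Admissible n) (R : Type*) [Ring R] [Algebra ℂ R] :
    IsCoxeterSystem T n (sgnMatrix R T n) := by
  have h1 : ∀ k, sgnMatrix R T n k = sgnMatrix R T n k * 1 := fun k => (mul_one _).symm
  refine ⟨fun k _ => ?_, fun k l hk hl h => ?_, fun k l hk hl h => ?_, fun k l hk hl h => ?_⟩ <;>
    ext j i
  · rw [← mul_one (sgnMatrix R T n k * sgnMatrix R T n k), mul_assoc, sgnMatrix_mul,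
      sgnMatrix_mul, smul_smul, eta_perm, eta_mul_eta, perm_perm, one_smul]
  · obtain ⟨h2, h3⟩ := perm_eta_two hn hk hl h j
    rw [← mul_one (sgnMatrix R T n k * sgnMatrix R T n l),
      ← mul_one (sgnMatrix R T n l * sgnMatrix R T n k)]
    simp only [mul_assoc, sgnMatrix_mul, smul_smul]
    rw [h2, h3]
  · obtain ⟨h2, h3⟩ := perm_eta_three hn hk hl h j
    rw [← mul_one (sgnMatrix R T n k * sgnMatrix R T n l * _),
      ← mul_one (sgnMatrix R T n l * sgnMatrix R T n k * _)]
    simp only [mul_assoc, sgnMatrix_mul, smul_smul]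
    simp only [mul_assoc] at h3
    rw [h2, h3]
  · obtain ⟨h2, h3⟩ := perm_eta_four hn hk hl h j
    rw [← mul_one (sgnMatrix R T n k * sgnMatrix R T n l * _),
      ← mul_one (sgnMatrix R T n l * sgnMatrix R T n k * _)]
    simp only [mul_assoc, sgnMatrix_mul, smul_smul]
    simp only [mul_assoc] at h3
    rw [← h2, h3]

/-- The commutator `[y_j, ξ_i]`, as an element of the spin Weyl group algebra. -/
def comm (T : ClassicalType) (n : ℕ) (u v : ℂ) (i j : Fin n) : SpinWeyl T n :=
  if i = j then diag T n u v i else offDiag T n u i j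

theorem root_true_A (i j : ℕ) : root .A n true i j = 0 := by
  simp [root, IsChainAction.symmExt, barBracketLt]

theorem bracket_eq (i j : Fin n) : bracket T n i j = root T n false i j := by
  simp [bracket, root, IsChainAction.symmExt]

theorem barBracket_eq (i j : Fin n) : barBracket T n i j = root T n true i j := by
  simp [barBracket, root, IsChainAction.symmExt]

theorem offDiag_eq (u : ℂ) (i j : Fin n) :
    offDiag T n u i j = -(u • ∑ s, bsign s • root T n s i j) := by
  cases T <;> simp [offDiag, bracket_eq, barBracket_eq, root_true_A]

theorem diag_eq (u v : ℂ) (i : Fin n) :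
    diag T n u v i = u • ∑ k ∈ Finset.univ.erase i, ∑ s, root T n s i k + v • shortRoot T n i := by
  cases T
  · simp [diag, bracket_eq, root_true_A, shortRoot]
  · simp [diag, bracket_eq, barBracket_eq, shortRoot, add_comm]
  · simp [diag, bracket_eq, barBracket_eq, shortRoot, barSingle, add_comm]

theorem sum_bool_xor {M : Type*} [AddCommMonoid M] (b : Bool) (f : Bool → M) :
    ∑ s, f (xor s b) = ∑ s, f s := by
  cases b <;> simp [add_comm]

theorem twist_comm_eq (hn : T.Admissible n) (u v : ℂ) {k : ℕ} (hk : k < T.rank n) (i j : Fin n) :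
    twist T n k (comm T n u v i j) =
      eta T n k j • comm T n u v (perm T n k i) (perm T n k j) := by
  by_cases hij : i = j
  · subst hij
    simp only [comm, if_true, diag_eq, map_add, map_smul, map_sum, smul_add]
    rw [twist_shortRoot hn hk i.2, smul_comm _ v]
    congr 1
    rw [smul_comm _ u]
    congr 1
    rw [Finset.smul_sum]
    refine Finset.sum_nbij' (perm T n k) (perm T n k) ?_ ?_ ?_ ?_ ?_
    · intro a ha
      simpa [(perm_injective k).ne_iff] using ha
    · intro a ha
      simp only [Finset.mem_erase, Finset.mem_univ, and_true] at ha ⊢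
      intro h
      exact ha (by rw [← h, perm_perm])
    · intro a _; exact perm_perm k a
    · intro a _; exact perm_perm k a
    · intro a ha
      have ha' : (i : ℕ) ≠ a := fun h => (Finset.ne_of_mem_erase ha) (Fin.ext h.symm)
      simp only [twist_root hn hk _ ha' i.2 a.2]
      rw [sum_bool_xor _ (fun s => bsign (flipNat T n k i) •
        root T n s (permNat T n k i) (permNat T n k a)), Finset.smul_sum]
      rfl
  · have hij' : (i : ℕ) ≠ j := fun h => hij (Fin.ext h)
    have hp : perm T n k i ≠ perm T n k j := (perm_injective k).ne hij
    simp only [comm, hij, hp, if_false, offDiag_eq, map_neg, map_smul, map_sum,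
      twist_root hn hk _ hij' i.2 j.2, smul_neg]
    rw [smul_comm _ u]
    congr 2
    rw [Finset.smul_sum, ← sum_bool_xor (xor (flipNat T n k i) (flipNat T n k j)) fun s => eta T n k j •
      bsign s • root T n s (perm T n k i) (perm T n k j)]
    refine Finset.sum_congr rfl fun s _ => ?_
    rw [smul_smul, smul_smul]
    congr 1
    simp only [bsign_xor, eta]
    have := bsign_mul_self (flipNat T n k j)
    linear_combination (-(bsign s * bsign (flipNat T n k i))) * this

/-- Long roots are obtained from simple roots by simple reflections. -/
theorem root_induction (hn : T.Admissible n) {Pr : Bool → ℕ → ℕ → Prop}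
    (hA : T = .A → ∀ i j, Pr true i j)
    (hsimple : ∀ k, k + 1 < n → Pr false k (k + 1))
    (hrefl : ∀ k s i j, k < T.rank n → i < n → j < n → i ≠ j → Pr s i j →
      Pr (xor s (xor (flipNat T n k i) (flipNat T n k j))) (permNat T n k i) (permNat T n k j))
    (hsymm : ∀ s i j, i ≠ j → Pr s i j → Pr s j i)
    (s : Bool) {i j : ℕ} (hij : i ≠ j) (hi : i < n) (hj : j < n) : Pr s i j := by
  have hchain : ∀ k s i j, k + 1 < n → i < n → j < n → i ≠ j → Pr s i j →
      Pr s (adjSwap k i) (adjSwap k j) := by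
    intro k s i j hk hi hj hij h
    simpa [permNat, flipNat, actNat_chain hk] using
      hrefl k s i j (T.lt_rank hk) hi hj hij h
  wlog hlt : i < j generalizing i j
  · exact hsymm s j i hij.symm (this hij.symm hj hi (by omega))
  have hfalse : ∀ i j, i < j → j < n → Pr false i j := by
    intro i j hij hj
    induction j, hij using Nat.le_induction with
    | base => exact hsimple i hj
    | succ j hij ih =>
      have h3 := hchain j false i j hj (by omega) (by omega) (by omega) (ih (by omega))
      rwa [adjSwap, if_neg (by omega), if_neg (by omega), adjSwap, if_pos rfl] at h3
  cases s with
  | false => exact hfalse i j hlt hj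
  | true =>
    by_cases hT : T = .A
    · exact hA hT i j
    have h0 : Pr true 0 (n - 1) := by
      cases T with
      | A => exact absurd rfl hT
      | D =>
        have hn : 4 ≤ n := hn
        have h1 := hrefl (n - 1) false 0 (n - 2) (D_last_lt_rank (by omega)) (by omega) (by omega)
          (by omega) (hfalse 0 (n - 2) (by omega) (by omega))
        have e1 : (0 : ℕ) ≠ n - 2 := by omega
        have e2 : (0 : ℕ) ≠ n - 1 := by omega
        simpa [permNat, flipNat, actNat_D_last (show 1 ≤ n by omega), signedSwap, e1, e2] using h1
      | B =>
        have hn : 2 ≤ n := hn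
        have h1 := hrefl (n - 1) false 0 (n - 1) (B_last_lt_rank (by omega)) (by omega) (by omega)
          (by omega) (hfalse 0 (n - 1) (by omega) (by omega))
        have e2 : (0 : ℕ) ≠ n - 1 := by omega
        simpa [permNat, flipNat, actNat_B_last (show 1 ≤ n by omega), signedSwap, e2] using h1
    have h1 : ∀ i, i < n - 1 → Pr true i (n - 1) := by
      intro i hi
      induction i with
      | zero => exact h0
      | succ i ih =>
        have h3 := hchain i true i (n - 1) (by omega) (by omega) (by omega) (by omega)
          (ih (by omega))
        rwa [adjSwap, if_pos rfl, adjSwap, if_neg (by omega), if_neg (by omega)] at h3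
    have hj' : j ≤ n - 1 := by omega
    induction hj' using Nat.decreasingInduction with
    | self => exact h1 i hlt
    | of_succ j hj' ih =>
      have h3 := hchain j true i (j + 1) (by omega) (by omega) (by omega) (by omega)
        (ih (by omega) (by omega) (by omega))
      rwa [adjSwap, if_neg (by omega), if_neg (by omega), adjSwap, if_neg (by omega),
        if_pos rfl] at h3

/-- Short roots are obtained from the simple one by simple reflections. -/
theorem shortRoot_induction {Pr : ℕ → Prop}
    (h0 : T ≠ .B → ∀ i, Pr i) (hsimple : T = .B → Pr (n - 1))
    (hrefl : ∀ k i, k < T.rank n → i < n → Pr i → Pr (permNat T n k i))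
    {i : ℕ} (hi : i < n) : Pr i := by
  by_cases hT : T = .B
  · have hi' : i ≤ n - 1 := by omega
    induction hi' using Nat.decreasingInduction with
    | self => exact hsimple hT
    | of_succ i hi' ih =>
      have h3 := hrefl i (i + 1) (T.lt_rank (by omega)) (by omega) (ih (by omega))
      rw [permNat, actNat_chain (by omega), adjSwap, if_neg (by omega), if_pos rfl] at h3
      exact h3
  · exact h0 hT i

theorem perm_chain {k : ℕ} (hk : k + 1 < n) (l : Fin n) :
    perm T n k l = Equiv.swap ⟨k, by omega⟩ ⟨k + 1, hk⟩ l := by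
  have h : permNat T n k l = adjSwap k l := by simp [permNat, actNat_chain hk]
  apply Fin.ext
  simp only [perm, h, adjSwap, Equiv.swap_apply_def, Fin.ext_iff]
  split_ifs <;> rfl

theorem eta_chain {k : ℕ} (hk : k + 1 < n) (l : Fin n) : eta T n k l = 1 := by
  simp [eta, flipNat, actNat_chain hk]

theorem swap_perm (k : ℕ) (i j l : Fin n) :
    Equiv.swap (perm T n k i) (perm T n k j) l =
      perm T n k (Equiv.swap i j (perm T n k l)) := by
  have h : ∀ i, perm T n k l = i ↔ l = perm T n k i := fun i =>
    ⟨fun h => by rw [← h, perm_perm], fun h => by rw [h, perm_perm]⟩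
  simp only [Equiv.swap_apply_def, h]
  split_ifs <;> simp

section Equivariant

variable {E : Type*} [Ring E] [Algebra ℂ E] {θ : SpinWeyl T n →ₐ[ℂ] E} {X : Fin n → E}
  {μ : ℕ → Fin n → ℂ}
  (hX : ∀ k, k < T.rank n → ∀ l, θ (t T n k) * X l = μ k l • (X (perm T n k l) * θ (t T n k)))
include hX

theorem conj_twist {k : ℕ} (hk : k < T.rank n) {a : SpinWeyl T n} {π : Fin n → Fin n}
    {c : Fin n → ℂ} (ha : ∀ l, θ a * X l = c l • (X (π l) * θ a)) (l : Fin n) :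
    θ (twist T n k a) * X l =
      (μ k l * c (perm T n k l) * μ k (π (perm T n k l))) •
        (X (perm T n k (π (perm T n k l))) * θ (twist T n k a)) := by
  have h1 : θ (twist T n k a) = -(θ (t T n k) * θ a * θ (t T n k)) := by
    rw [twist_apply, map_neg, map_mul, map_mul, mul_assoc]
  rw [h1, neg_mul, mul_neg, mul_assoc, hX k hk, mul_smul_comm, mul_assoc, ← mul_assoc (θ a), ha,
    smul_mul_assoc, mul_smul_comm, mul_assoc, ← mul_assoc (θ (t T n k)), hX k hk,
    smul_mul_assoc, smul_smul, smul_smul, smul_neg]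
  simp only [mul_assoc]

theorem conj_root (hn : T.Admissible n) {c : Bool → Fin n → Fin n → Fin n → ℂ}
    (hsimple : ∀ k (hk : k + 1 < n) l, c false ⟨k, by omega⟩ ⟨k + 1, hk⟩ l = μ k l)
    (hsymm : ∀ s i j l, c s i j l = c s j i l)
    (hrefl : ∀ k s i j l, k < T.rank n → i ≠ j →
      μ k l * c s i j (perm T n k l) * μ k (Equiv.swap i j (perm T n k l)) =
        c (xor s (xor (flipNat T n k i) (flipNat T n k j))) (perm T n k i) (perm T n k j) l)
    (s : Bool) {i j : Fin n} (hij : i ≠ j) (l : Fin n) :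
    θ (root T n s i j) * X l = c s i j l • (X (Equiv.swap i j l) * θ (root T n s i j)) := by
  suffices H : ∀ (hi : (i : ℕ) < n) (hj : (j : ℕ) < n) (l : Fin n),
      θ (root T n s i j) * X l = c s ⟨i, hi⟩ ⟨j, hj⟩ l •
        (X (Equiv.swap ⟨i, hi⟩ ⟨j, hj⟩ l) * θ (root T n s i j)) from H i.2 j.2 l
  refine root_induction hn (Pr := fun s a b => ∀ (ha : a < n) (hb : b < n) (l : Fin n),
      θ (root T n s a b) * X l = c s ⟨a, ha⟩ ⟨b, hb⟩ l •
        (X (Equiv.swap ⟨a, ha⟩ ⟨b, hb⟩ l) * θ (root T n s a b))) ?_ ?_ ?_ ?_ s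
    (fun h => hij (Fin.ext h)) i.2 j.2
  · rintro rfl a b ha hb l
    simp [root_true_A]
  · intro k hk hk0 hk1 l
    rw [root_lt _ (Nat.lt_succ_self k), if_neg (by simp), bracketLt_self, hX k (T.lt_rank hk),
      hsimple k hk, perm_chain hk]
  · intro k s a b hk ha hb hab ih ha' hb' l
    have h1 : root T n (xor s (xor (flipNat T n k a) (flipNat T n k b))) (permNat T n k a)
        (permNat T n k b) = bsign (flipNat T n k a) • twist T n k (root T n s a b) := by
      rw [twist_root hn hk s hab ha hb, smul_smul, bsign_mul_self, one_smul]
    have h2 := conj_twist hX hk (ih ha hb) l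
    rw [hrefl k s ⟨a, ha⟩ ⟨b, hb⟩ l hk (fun h => hab (Fin.mk.inj_iff.mp h)), ← swap_perm] at h2
    rw [h1, map_smul, smul_mul_assoc, h2, mul_smul_comm, smul_comm]
    rfl
  · intro s a b hab ih ha hb l
    rw [root_symm s hab, map_neg, map_smul, neg_mul, smul_mul_assoc, ih hb ha, hsymm,
      Equiv.swap_comm, mul_neg, mul_smul_comm, smul_neg, smul_comm]

theorem conj_shortRoot (hn : T.Admissible n) {c : Fin n → Fin n → ℂ}
    (hsimple : ∀ i l : Fin n, (i : ℕ) + 1 = n → c i l = μ (n - 1) l)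
    (hperm : T = .B → ∀ l, perm T n (n - 1) l = l)
    (hrefl : ∀ k i l, k < T.rank n →
      μ k l * c i (perm T n k l) * μ k (perm T n k l) = c (perm T n k i) l)
    (i l : Fin n) :
    θ (shortRoot T n i) * X l = c i l • (X l * θ (shortRoot T n i)) := by
  suffices H : ∀ (hi : (i : ℕ) < n) (l : Fin n),
      θ (shortRoot T n i) * X l = c ⟨i, hi⟩ l • (X l * θ (shortRoot T n i)) from H i.2 l
  refine shortRoot_induction (T := T) (Pr := fun a => ∀ (ha : a < n) (l : Fin n),
      θ (shortRoot T n a) * X l = c ⟨a, ha⟩ l • (X l * θ (shortRoot T n a))) ?_ ?_ ?_ i.2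
  · intro hT a ha l
    have : shortRoot T n a = 0 := by
      cases T with
      | A => rfl
      | D => rfl
      | B => exact absurd rfl hT
    simp [this]
  · intro hT ha l
    have h1 := hX (n - 1) (by subst hT; exact B_last_lt_rank hn) l
    have h2 : shortRoot T n (n - 1) = t T n (n - 1) := by subst hT; exact shortRoot_last
    rw [h2, h1, hperm hT, hsimple _ _ (show n - 1 + 1 = n by omega)]
  · intro k a hk ha ih ha' l
    have h1 : shortRoot T n (permNat T n k a) =
        bsign (flipNat T n k a) • twist T n k (shortRoot T n a) := by
      rw [twist_shortRoot hn hk ha, smul_smul, bsign_mul_self, one_smul]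
    have h2 := conj_twist hX hk (π := id) (ih ha) l
    simp only [id, perm_perm] at h2
    rw [hrefl k ⟨a, ha⟩ l hk] at h2
    rw [h1, map_smul, smul_mul_assoc, h2, mul_smul_comm, smul_comm]
    rfl

end Equivariant

theorem B_last_perm (hn : T.Admissible n) (hT : T = .B) (l : Fin n) :
    perm T n (n - 1) l = l := by
  subst hT
  have hn : 2 ≤ n := hn
  apply Fin.ext
  simp only [perm, permNat, actNat_B_last (show 1 ≤ n by omega), signedSwap]
  split_ifs with h <;> simp [h]

theorem B_last_eta (hn : 2 ≤ n) (l : Fin n) :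
    eta .B n (n - 1) l = if (l : ℕ) + 1 = n then -1 else 1 := by
  simp only [eta, flipNat, actNat_B_last (show 1 ≤ n by omega), signedSwap]
  by_cases h : (l : ℕ) + 1 = n
  · have h' : (l : ℕ) = n - 1 := by omega
    rw [if_pos h', if_pos h]; simp
  · have h' : (l : ℕ) ≠ n - 1 := by omega
    simp [h, h']

theorem eq_perm_iff {k : ℕ} {i l : Fin n} : l = perm T n k i ↔ perm T n k l = i :=
  ⟨fun h => by rw [h, perm_perm], fun h => by rw [← h, perm_perm]⟩

section Xi

variable {E : Type*} [Ring E] [Algebra ℂ E] {θ : SpinWeyl T n →ₐ[ℂ] E} {X : Fin n → E}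
  (hX : ∀ k, k < T.rank n → ∀ l, θ (t T n k) * X l = -(X (perm T n k l) * θ (t T n k)))
include hX

theorem root_mul_xi (hn : T.Admissible n) (s : Bool) {i j : Fin n} (hij : i ≠ j) (l : Fin n) :
    θ (root T n s i j) * X l = -(X (Equiv.swap i j l) * θ (root T n s i j)) := by
  have := conj_root (μ := fun _ _ => -1) (c := fun _ _ _ _ => -1)
    (fun k hk l => by rw [hX k hk l, neg_one_smul]) hn (by simp) (by simp) (by simp) s hij l
  rwa [neg_one_smul] at this

theorem shortRoot_mul_xi (hn : T.Admissible n) (i l : Fin n) :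
    θ (shortRoot T n i) * X l = -(X l * θ (shortRoot T n i)) := by
  have := conj_shortRoot (μ := fun _ _ => -1) (c := fun _ _ => -1)
    (fun k hk l => by rw [hX k hk l, neg_one_smul]) hn (by simp) (B_last_perm hn) (by simp) i l
  rwa [neg_one_smul] at this

theorem comm_anti_of_ne (hn : T.Admissible n) (u v : ℂ) {i j l : Fin n} (hij : i ≠ j)
    (hil : i ≠ l) (hjl : j ≠ l) :
    θ (comm T n u v i j) * X l + X l * θ (comm T n u v i j) = 0 := by
  simp only [comm, hij, if_false, offDiag_eq, map_neg, map_smul, map_sum, neg_mul, mul_neg,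
    smul_mul_assoc, mul_smul_comm, Finset.sum_mul, Finset.mul_sum, root_mul_xi hX hn _ hij,
    Equiv.swap_apply_of_ne_of_ne hil.symm hjl.symm, smul_neg, Finset.sum_neg_distrib]
  abel

theorem comm_anti_right (hn : T.Admissible n) (u v : ℂ) {i j : Fin n} (hij : i ≠ j) :
    θ (comm T n u v i j) * X j + X j * θ (comm T n u v i j) =
      -(u • ∑ s, bsign s • ((X j - X i) * θ (root T n s i j))) := by
  simp only [comm, hij, if_false, offDiag_eq, map_neg, map_smul, map_sum, neg_mul, mul_neg,
    smul_mul_assoc, mul_smul_comm, Finset.sum_mul, Finset.mul_sum, root_mul_xi hX hn _ hij,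
    Equiv.swap_apply_right, smul_neg, Finset.sum_neg_distrib, sub_mul, smul_sub,
    Finset.sum_sub_distrib]
  abel

theorem comm_anti_diag (hn : T.Admissible n) (u v : ℂ) {i l : Fin n} (hil : i ≠ l) :
    θ (comm T n u v i i) * X l + X l * θ (comm T n u v i i) =
      u • ∑ s, (X l - X i) * θ (root T n s i l) := by
  simp only [comm, if_true, diag_eq, map_add, map_smul, map_sum, add_mul, mul_add,
    smul_mul_assoc, mul_smul_comm, shortRoot_mul_xi hX hn]
  have h1 : ∀ k ∈ Finset.univ.erase i, (∑ s, θ (root T n s i k)) * X l +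
      X l * (∑ s, θ (root T n s i k)) =
        if k = l then ∑ s, (X l - X i) * θ (root T n s i l) else 0 := by
    intro k hk
    have hik : i ≠ k := (Finset.ne_of_mem_erase hk).symm
    simp only [Finset.sum_mul, Finset.mul_sum, root_mul_xi hX hn _ hik]
    split_ifs with h
    · subst h
      simp only [Equiv.swap_apply_right, Finset.sum_neg_distrib, sub_mul, Finset.sum_sub_distrib]
      abel
    · rw [Equiv.swap_apply_of_ne_of_ne hil.symm (Ne.symm h), Finset.sum_neg_distrib]
      abel
  have h2 : (∑ k ∈ Finset.univ.erase i, ∑ s, θ (root T n s i k)) * X l +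
      X l * (∑ k ∈ Finset.univ.erase i, ∑ s, θ (root T n s i k)) =
        ∑ s, (X l - X i) * θ (root T n s i l) := by
    rw [Finset.sum_mul, Finset.mul_sum, ← Finset.sum_add_distrib, Finset.sum_congr rfl h1,
      Finset.sum_ite_eq' _ l, if_pos (Finset.mem_erase.mpr ⟨hil.symm, Finset.mem_univ _⟩)]
  rw [← h2, smul_add, smul_neg]
  abel

/-- The Jacobi identity for one `y` and two `ξ`. -/
theorem comm_anti (hn : T.Admissible n) (u v : ℂ) {i l : Fin n} (hil : i ≠ l) (j : Fin n) :
    (θ (comm T n u v i j) * X l + X l * θ (comm T n u v i j)) +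
      (θ (comm T n u v l j) * X i + X i * θ (comm T n u v l j)) = 0 := by
  have key : ∀ {i l : Fin n}, i ≠ l →
      (θ (comm T n u v i i) * X l + X l * θ (comm T n u v i i)) +
        (θ (comm T n u v l i) * X i + X i * θ (comm T n u v l i)) = 0 := by
    intro i l hil
    have hil' : (i : ℕ) ≠ l := fun h => hil (Fin.ext h)
    rw [comm_anti_diag hX hn u v hil, comm_anti_right hX hn u v hil.symm]
    simp only [root_symm _ hil', map_neg, map_smul, mul_neg, mul_smul_comm, smul_neg, smul_smul,
      bsign_mul_self, one_smul, sub_mul, Finset.sum_neg_distrib, Finset.sum_sub_distrib, neg_neg,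
      smul_sub]
    abel
  by_cases h1 : i = j
  · subst h1; exact key hil
  by_cases h2 : l = j
  · subst h2; rw [add_comm]; exact key hil.symm
  · rw [comm_anti_of_ne hX hn u v h1 hil (Ne.symm h2),
      comm_anti_of_ne hX hn u v h2 hil.symm (Ne.symm h1), add_zero]

end Xi

section Y

variable {E : Type*} [Ring E] [Algebra ℂ E] {θ : SpinWeyl T n →ₐ[ℂ] E} {Y : Fin n → E}
  (hY : ∀ k, k < T.rank n → ∀ l,
    θ (t T n k) * Y l = eta T n k l • (Y (perm T n k l) * θ (t T n k)))
include hY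

theorem root_mul_y (hn : T.Admissible n) (s : Bool) {i j : Fin n} (hij : i ≠ j) (l : Fin n) :
    θ (root T n s i j) * Y l = (if l = i ∨ l = j then bsign s else 1) •
      (Y (Equiv.swap i j l) * θ (root T n s i j)) := by
  refine conj_root (c := fun s i j l => if l = i ∨ l = j then bsign s else 1) hY hn ?_ ?_ ?_
    s hij l
  · intro k hk l
    simp [eta_chain hk]
  · intro s i j l
    simp only [or_comm]
  · intro k s i j l hk hij
    simp only [eq_perm_iff (l := l)]
    by_cases h1 : perm T n k l = i
    · subst h1
      simp [bsign_xor, eta, perm]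
      ring
    by_cases h2 : perm T n k l = j
    · subst h2
      simp [bsign_xor, eta, perm]
      ring
    · simp [h1, h2, Equiv.swap_apply_of_ne_of_ne h1 h2]

theorem shortRoot_mul_y (hn : T.Admissible n) (i l : Fin n) :
    θ (shortRoot T n i) * Y l = (if l = i then (-1 : ℂ) else 1) •
      (Y l * θ (shortRoot T n i)) := by
  by_cases hT : T = .B
  · refine conj_shortRoot (c := fun i l => if l = i then (-1 : ℂ) else 1) hY hn ?_
      (B_last_perm hn) ?_ i l
    · intro i l hi
      subst hT
      rw [B_last_eta hn]
      simp only [Fin.ext_iff]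
      congr 1
      simp only [eq_iff_iff]
      omega
    · intro k i l hk
      simp only [eq_perm_iff (l := l)]
      have := eta_mul_eta (T := T) k l
      rw [eta_perm]
      linear_combination (if perm T n k l = i then (-1 : ℂ) else 1) * this
  · have : shortRoot T n i = 0 := by
      cases T with
      | A => rfl
      | D => rfl
      | B => exact absurd rfl hT
    simp [this]

theorem comm_y_of_ne (hn : T.Admissible n) (u v : ℂ) {i j l : Fin n} (hij : i ≠ j)
    (hil : i ≠ l) (hjl : j ≠ l) :
    Y l * θ (comm T n u v i j) - θ (comm T n u v i j) * Y l = 0 := by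
  simp only [comm, hij, if_false, offDiag_eq, map_neg, map_smul, map_sum, neg_mul, mul_neg,
    smul_mul_assoc, mul_smul_comm, Finset.sum_mul, Finset.mul_sum, root_mul_y hY hn _ hij,
    Equiv.swap_apply_of_ne_of_ne hil.symm hjl.symm, hil.symm, hjl.symm, or_self, one_smul,
    sub_self]

theorem comm_y_left (hn : T.Admissible n) (u v : ℂ) {i j : Fin n} (hij : i ≠ j) :
    Y i * θ (comm T n u v i j) - θ (comm T n u v i j) * Y i =
      u • ∑ s, (Y j - bsign s • Y i) * θ (root T n s i j) := by
  simp only [comm, hij, if_false, offDiag_eq, map_neg, map_smul, map_sum, neg_mul, mul_neg,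
    smul_mul_assoc, mul_smul_comm, Finset.sum_mul, Finset.mul_sum, root_mul_y hY hn _ hij,
    Equiv.swap_apply_left, true_or, if_true, smul_smul, bsign_mul_self, one_smul, sub_mul,
    Finset.sum_sub_distrib, smul_sub]
  abel

theorem comm_y_diag (hn : T.Admissible n) (u v : ℂ) {i l : Fin n} (hil : i ≠ l) :
    Y l * θ (comm T n u v i i) - θ (comm T n u v i i) * Y l =
      u • ∑ s, (Y l - bsign s • Y i) * θ (root T n s i l) := by
  simp only [comm, if_true, diag_eq, map_add, map_smul, map_sum, add_mul, mul_add,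
    smul_mul_assoc, mul_smul_comm, shortRoot_mul_y hY hn, hil.symm, if_false, one_smul]
  have h1 : ∀ k ∈ Finset.univ.erase i, Y l * (∑ s, θ (root T n s i k)) -
      (∑ s, θ (root T n s i k)) * Y l =
        if k = l then ∑ s, (Y l - bsign s • Y i) * θ (root T n s i l) else 0 := by
    intro k hk
    have hik : i ≠ k := (Finset.ne_of_mem_erase hk).symm
    simp only [Finset.sum_mul, Finset.mul_sum, root_mul_y hY hn _ hik]
    by_cases h : k = l
    · subst h
      simp only [Equiv.swap_apply_right, or_true, if_true, sub_mul, Finset.sum_sub_distrib,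
        smul_mul_assoc]
    · simp [Equiv.swap_apply_of_ne_of_ne hil.symm (Ne.symm h), hil.symm, h, Ne.symm h]
  have h2 : Y l * (∑ k ∈ Finset.univ.erase i, ∑ s, θ (root T n s i k)) -
      (∑ k ∈ Finset.univ.erase i, ∑ s, θ (root T n s i k)) * Y l =
        ∑ s, (Y l - bsign s • Y i) * θ (root T n s i l) := by
    rw [Finset.sum_mul, Finset.mul_sum, ← Finset.sum_sub_distrib, Finset.sum_congr rfl h1,
      Finset.sum_ite_eq' _ l, if_pos (Finset.mem_erase.mpr ⟨hil.symm, Finset.mem_univ _⟩)]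
  rw [← h2, smul_sub]
  abel

/-- The Jacobi identity for two `y` and one `ξ`. -/
theorem comm_y (hn : T.Admissible n) (u v : ℂ) (i j l : Fin n) :
    Y l * θ (comm T n u v i j) - θ (comm T n u v i j) * Y l =
      Y j * θ (comm T n u v i l) - θ (comm T n u v i l) * Y j := by
  by_cases hjl : j = l
  · subst hjl; rfl
  by_cases hij : i = j
  · subst hij
    rw [comm_y_diag hY hn u v hjl, comm_y_left hY hn u v hjl]
  by_cases hil : i = l
  · subst hil
    rw [comm_y_diag hY hn u v hij, comm_y_left hY hn u v hij]
  · rw [comm_y_of_ne hY hn u v hij hil hjl, comm_y_of_ne hY hn u v hil hij (Ne.symm hjl)]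

end Y

/-- The tensor product of the spin Weyl group algebra and the polynomial algebra. -/
def SpinPoly (T : ClassicalType) (n : ℕ) : Type := SpinWeyl T n ⊗[ℂ] MvPolynomial (Fin n) ℂ

instance : AddCommGroup (SpinPoly T n) :=
  inferInstanceAs (AddCommGroup (SpinWeyl T n ⊗[ℂ] MvPolynomial (Fin n) ℂ))

instance : Module ℂ (SpinPoly T n) :=
  inferInstanceAs (Module ℂ (SpinWeyl T n ⊗[ℂ] MvPolynomial (Fin n) ℂ))

/-- The identification of `SpinPoly` with a tensor product. -/
def spinPolyEquiv (T : ClassicalType) (n : ℕ) :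
    (SpinWeyl T n ⊗[ℂ] MvPolynomial (Fin n) ℂ) ≃ₗ[ℂ] SpinPoly T n :=
  LinearEquiv.refl ℂ _

/-- Pure tensors in `SpinPoly`. -/
def spinTmul (a : SpinWeyl T n) (f : MvPolynomial (Fin n) ℂ) : SpinPoly T n :=
  spinPolyEquiv T n (a ⊗ₜ f)

theorem spinPoly_ext {V : Type*} [AddCommMonoid V] [Module ℂ V] {D D' : SpinPoly T n →ₗ[ℂ] V}
    (h : ∀ a f, D (spinTmul a f) = D' (spinTmul a f)) : D = D' := by
  have : D ∘ₗ (spinPolyEquiv T n).toLinearMap = D' ∘ₗ (spinPolyEquiv T n).toLinearMap :=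
    TensorProduct.ext' h
  ext m
  exact LinearMap.congr_fun this ((spinPolyEquiv T n).symm m)

theorem add_spinTmul (a b : SpinWeyl T n) (f : MvPolynomial (Fin n) ℂ) :
    spinTmul (a + b) f = spinTmul a f + spinTmul b f := by
  simp [spinTmul, TensorProduct.add_tmul]

theorem smul_spinTmul (c : ℂ) (a : SpinWeyl T n) (f : MvPolynomial (Fin n) ℂ) :
    spinTmul (c • a) f = c • spinTmul a f := by
  rw [spinTmul, ← TensorProduct.smul_tmul', map_smul]; rfl

theorem zero_spinTmul (f : MvPolynomial (Fin n) ℂ) : spinTmul (0 : SpinWeyl T n) f = 0 := by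
  simp [spinTmul]

/-- The underlying space of the polynomial representation. -/
def BigModule (T : ClassicalType) (n : ℕ) : Type := SkewPoly n ⊗[ℂ] SpinPoly T n

instance : AddCommGroup (BigModule T n) :=
  inferInstanceAs (AddCommGroup (SkewPoly n ⊗[ℂ] SpinPoly T n))

instance : Module ℂ (BigModule T n) :=
  inferInstanceAs (Module ℂ (SkewPoly n ⊗[ℂ] SpinPoly T n))

/-- The identification of `BigModule` with a tensor product. -/
def bigModuleEquiv (T : ClassicalType) (n : ℕ) :
    (SkewPoly n ⊗[ℂ] SpinPoly T n) ≃ₗ[ℂ] BigModule T n :=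
  LinearEquiv.refl ℂ _

/-- The bilinear map to `BigModule`. -/
def bigMk (T : ClassicalType) (n : ℕ) : SkewPoly n →ₗ[ℂ] SpinPoly T n →ₗ[ℂ] BigModule T n :=
  (TensorProduct.mk ℂ (SkewPoly n) (SpinPoly T n)).compr₂ (bigModuleEquiv T n).toLinearMap

theorem bigModule_ext {V : Type*} [AddCommMonoid V] [Module ℂ V] {D D' : BigModule T n →ₗ[ℂ] V}
    (h : ∀ p m, D (bigMk T n p m) = D' (bigMk T n p m)) : D = D' := by
  have : D ∘ₗ (bigModuleEquiv T n).toLinearMap = D' ∘ₗ (bigModuleEquiv T n).toLinearMap :=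
    TensorProduct.ext' h
  ext m
  exact LinearMap.congr_fun this ((bigModuleEquiv T n).symm m)

theorem isSpinSystem_matrix (hn : T.Admissible n) : IsSpinSystem T n fun k =>
    sgnMatrix (SpinWeyl T n) T n k * Matrix.scalar (Fin n) (t T n k) := by
  refine (isCoxeterSystem_sgnMatrix hn _).mul_spin (isSpinSystem_t.map (Matrix.scalar (Fin n))) ?_
  intro k l
  ext j i
  rw [Matrix.scalar_apply, Matrix.mul_diagonal, Matrix.diagonal_mul]
  simp only [sgnMatrix, Matrix.of_apply]
  split_ifs
  · exact Algebra.commutes _ _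
  · rw [zero_mul, mul_zero]

/-- The homomorphism `a ↦ δ(a)` with `y_j a = ∑ i, δ(a)_{ji} y_i`. -/
def spinMatrix (hn : T.Admissible n) : SpinWeyl T n →ₐ[ℂ] Matrix (Fin n) (Fin n) (SpinWeyl T n) :=
  spinLift (isSpinSystem_matrix hn)

theorem spinMatrix_t_mul (hn : T.Admissible n) {k : ℕ} (hk : k < T.rank n) (a : SpinWeyl T n)
    (j i : Fin n) : spinMatrix hn (t T n k * a) j i =
      eta T n k j • (t T n k * spinMatrix hn a (perm T n k j) i) := by
  rw [map_mul, spinMatrix, spinLift_t _ hk, mul_assoc, sgnMatrix_mul]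
  simp [Matrix.scalar_apply]

/-- Left multiplication on `SpinPoly`. -/
def spinLeft (T : ClassicalType) (n : ℕ) : SpinWeyl T n →ₐ[ℂ] Module.End ℂ (SpinPoly T n) :=
  (((spinPolyEquiv T n).conjAlgEquiv ℂ).toAlgHom.comp
    (Module.End.rTensorAlgHom ℂ (SpinWeyl T n) (MvPolynomial (Fin n) ℂ))).comp
      (Algebra.lmul ℂ (SpinWeyl T n))

theorem spinLeft_tmul (a b : SpinWeyl T n) (f : MvPolynomial (Fin n) ℂ) :
    spinLeft T n a (spinTmul b f) = spinTmul (a * b) f := rfl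

/-- The action of `y_j` on `SpinPoly`. -/
def yInner (hn : T.Admissible n) (j : Fin n) : Module.End ℂ (SpinPoly T n) :=
  (spinPolyEquiv T n).conj (∑ i, TensorProduct.map
    (Matrix.entryLinearMap ℂ (SpinWeyl T n) j i ∘ₗ (spinMatrix hn).toLinearMap)
    (LinearMap.mulLeft ℂ (MvPolynomial.X i)))

theorem yInner_tmul (hn : T.Admissible n) (j : Fin n) (a : SpinWeyl T n)
    (f : MvPolynomial (Fin n) ℂ) :
    yInner hn j (spinTmul a f) = ∑ i, spinTmul (spinMatrix hn a j i) (MvPolynomial.X i * f) := by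
  simp [yInner, LinearMap.sum_apply, spinTmul, LinearEquiv.conj_apply]

theorem yInner_one_tmul (hn : T.Admissible n) (j : Fin n) (f : MvPolynomial (Fin n) ℂ) :
    yInner hn j (spinTmul 1 f) = spinTmul 1 (MvPolynomial.X j * f) := by
  rw [yInner_tmul, map_one, Finset.sum_eq_single j]
  · simp
  · intro i _ hi
    rw [Matrix.one_apply_ne (Ne.symm hi), zero_spinTmul]
  · simp

theorem yInner_spinLeft (hn : T.Admissible n) {k : ℕ} (hk : k < T.rank n) (j : Fin n) :
    yInner hn j * spinLeft T n (t T n k) =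
      eta T n k j • (spinLeft T n (t T n k) * yInner hn (perm T n k j)) := by
  refine spinPoly_ext fun a f => ?_
  simp only [Module.End.mul_apply, LinearMap.smul_apply, spinLeft_tmul, yInner_tmul,
    spinMatrix_t_mul hn hk, map_sum, Finset.smul_sum, smul_spinTmul]

theorem yInner_comm (hn : T.Admissible n) (i j : Fin n) :
    yInner hn i * yInner hn j = yInner hn j * yInner hn i := by
  have key : ∀ a : SpinWeyl T n, ∀ i j f, yInner hn i (yInner hn j (spinTmul a f)) =
      yInner hn j (yInner hn i (spinTmul a f)) := by
    intro a
    let U : Submodule ℂ (SpinWeyl T n) :=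
      { carrier := {a | ∀ i j f, yInner hn i (yInner hn j (spinTmul a f)) =
          yInner hn j (yInner hn i (spinTmul a f))}
        add_mem' := fun {a b} ha hb i j f => by
          simp only [add_spinTmul, map_add, ha i j f, hb i j f]
        zero_mem' := fun i j f => by simp [zero_spinTmul]
        smul_mem' := fun c a ha i j f => by
          simp only [smul_spinTmul, map_smul, ha i j f] }
    refine spin_induction U ?_ ?_ a
    · intro i j f
      simp only [yInner_one_tmul, mul_left_comm]
    · intro k hk a ha i j f
      have h1 : ∀ j m, yInner hn j (spinLeft T n (t T n k) m) =
          eta T n k j • spinLeft T n (t T n k) (yInner hn (perm T n k j) m) := fun j m =>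
        LinearMap.congr_fun (yInner_spinLeft hn hk j) m
      rw [← spinLeft_tmul]
      simp only [h1, map_smul, ha (perm T n k i) (perm T n k j) f]
      rw [smul_comm]
  exact spinPoly_ext fun a f => key a i j f

/-- The automorphism of the skew-polynomial algebra defined by `t_k`. -/
def skewAut (T : ClassicalType) (n k : ℕ) : SkewPoly n →ₐ[ℂ] SkewPoly n :=
  skewLift (fun i => -skewX (perm T n k i)) fun i j h => by
    simp [skewX_anti ((perm_injective (T := T) k).ne h)]

theorem skewAut_X (k : ℕ) (i : Fin n) : skewAut T n k (skewX i) = -skewX (perm T n k i) :=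
  skewLift_X _ _ i

theorem isCoxeterSystem_skewAut (hn : T.Admissible n) :
    IsCoxeterSystem T n (R := Module.End ℂ (SkewPoly n)) fun k => (skewAut T n k).toLinearMap := by
  refine ⟨fun k _ => ?_, fun k l hk hl h => ?_, fun k l hk hl h => ?_, fun k l hk hl h => ?_⟩
  · exact congrArg AlgHom.toLinearMap (show (skewAut T n k).comp (skewAut T n k) = AlgHom.id ℂ _
      from skew_ext fun i => by simp [skewAut_X])
  · exact congrArg AlgHom.toLinearMap (show (skewAut T n k).comp (skewAut T n l) =
      (skewAut T n l).comp (skewAut T n k) from skew_ext fun i => by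
        simp [skewAut_X, (perm_eta_two hn hk hl h i).1])
  · exact congrArg AlgHom.toLinearMap (show ((skewAut T n k).comp (skewAut T n l)).comp
      (skewAut T n k) = ((skewAut T n l).comp (skewAut T n k)).comp (skewAut T n l) from
      skew_ext fun i => by simp [skewAut_X, (perm_eta_three hn hk hl h i).1])
  · exact congrArg AlgHom.toLinearMap (show ((skewAut T n k).comp (skewAut T n l)).comp
      ((skewAut T n k).comp (skewAut T n l)) =
      ((skewAut T n l).comp (skewAut T n k)).comp ((skewAut T n l).comp (skewAut T n k)) from
      skew_ext fun i => by simp [skewAut_X, (perm_eta_four hn hk hl h i).1])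

theorem IsCoxeterSystem.map {R S : Type*} [Monoid R] [Monoid S] {σ : ℕ → R}
    (hσ : IsCoxeterSystem T n σ) (f : R →* S) : IsCoxeterSystem T n fun i => f (σ i) := by
  refine ⟨fun i hi => ?_, fun i j hi hj h => ?_, fun i j hi hj h => ?_, fun i j hi hj h => ?_⟩ <;>
    simp only [← map_mul, ← map_one f]
  · rw [hσ.sq i hi]
  · rw [hσ.two i j hi hj h]
  · rw [hσ.three i j hi hj h]
  · rw [hσ.four i j hi hj h]

/-- Endomorphisms of the first factor act on `BigModule`. -/
def endSkew (T : ClassicalType) (n : ℕ) :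
    Module.End ℂ (SkewPoly n) →ₐ[ℂ] Module.End ℂ (BigModule T n) :=
  ((bigModuleEquiv T n).conjAlgEquiv ℂ).toAlgHom.comp
    (Module.End.rTensorAlgHom ℂ (SkewPoly n) (SpinPoly T n))

/-- Endomorphisms of the second factor act on `BigModule`. -/
def endSpinPoly (T : ClassicalType) (n : ℕ) :
    Module.End ℂ (SpinPoly T n) →ₐ[ℂ] Module.End ℂ (BigModule T n) :=
  ((bigModuleEquiv T n).conjAlgEquiv ℂ).toAlgHom.comp
    (Module.End.lTensorAlgHom ℂ (SpinPoly T n) (SkewPoly n))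

theorem isSpinSystem_bigModule (hn : T.Admissible n) : IsSpinSystem T n fun k =>
    endSkew T n (skewAut T n k).toLinearMap * endSpinPoly T n (spinLeft T n (t T n k)) := by
  refine ((isCoxeterSystem_skewAut hn).map (endSkew T n).toMonoidHom).mul_spin
    (isSpinSystem_t.map ((endSpinPoly T n).comp (spinLeft T n)).toRingHom) ?_
  intro k l
  exact bigModule_ext fun p m => rfl

/-- The action of the spin Weyl group algebra on `BigModule`. -/
def spinAct (hn : T.Admissible n) : SpinWeyl T n →ₐ[ℂ] Module.End ℂ (BigModule T n) :=
  spinLift (isSpinSystem_bigModule hn)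

theorem spinAct_t (hn : T.Admissible n) {k : ℕ} (hk : k < T.rank n) (p : SkewPoly n)
    (m : SpinPoly T n) : spinAct hn (t T n k) (bigMk T n p m) =
      bigMk T n (skewAut T n k p) (spinLeft T n (t T n k) m) := by
  rw [spinAct, spinLift_t _ hk]
  rfl

theorem spinAct_one_tmul (hn : T.Admissible n) (a : SpinWeyl T n) (m : SpinPoly T n) :
    spinAct hn a (bigMk T n 1 m) = bigMk T n 1 (spinLeft T n a m) := by
  let U : Submodule ℂ (SpinWeyl T n) :=
    { carrier := {a | ∀ m, spinAct hn a (bigMk T n 1 m) = bigMk T n 1 (spinLeft T n a m)}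
      add_mem' := fun {a b} ha hb m => by
        simp only [map_add, LinearMap.add_apply, ha m, hb m, map_add]
      zero_mem' := fun m => by simp
      smul_mem' := fun c a ha m => by
        simp only [map_smul, LinearMap.smul_apply, ha m, map_smul] }
  refine spin_induction U (fun m => by simp) (fun k hk a ha m => ?_) a m
  rw [map_mul, Module.End.mul_apply, ha m, spinAct_t hn hk, map_one, map_mul, Module.End.mul_apply]

/-- Left multiplication by skew polynomials on `BigModule`. -/
def skewLeft (T : ClassicalType) (n : ℕ) : SkewPoly n →ₐ[ℂ] Module.End ℂ (BigModule T n) :=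
  (endSkew T n).comp (Algebra.lmul ℂ (SkewPoly n))

theorem skewLeft_tmul (p q : SkewPoly n) (m : SpinPoly T n) :
    skewLeft T n p (bigMk T n q m) = bigMk T n (p * q) m := rfl

/-- The action of `ξ_i` on `BigModule`. -/
def xiAct (T : ClassicalType) (n : ℕ) (i : Fin n) : Module.End ℂ (BigModule T n) :=
  skewLeft T n (skewX i)

theorem spinAct_xiAct (hn : T.Admissible n) (k : ℕ) (hk : k < T.rank n) (i : Fin n) :
    spinAct hn (t T n k) * xiAct T n i =
      -(xiAct T n (perm T n k i) * spinAct hn (t T n k)) := by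
  refine bigModule_ext fun p m => ?_
  rw [LinearMap.neg_apply, Module.End.mul_apply, Module.End.mul_apply, xiAct, skewLeft_tmul,
    spinAct_t hn hk, spinAct_t hn hk, xiAct, skewLeft_tmul, map_mul, skewAut_X, neg_mul,
    map_neg, LinearMap.neg_apply]

/-- The homomorphism `p ↦ p + [y_j, p] ε` to the dual numbers over the endomorphisms. -/
def skewDual (hn : T.Admissible n) (u v : ℂ) (j : Fin n) :
    SkewPoly n →ₐ[ℂ] TrivSqZeroExt (Module.End ℂ (BigModule T n)) (Module.End ℂ (BigModule T n)) :=
  skewLift (fun i => TrivSqZeroExt.inl (xiAct T n i) +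
      TrivSqZeroExt.inr (spinAct hn (comm T n u v i j))) (by
    intro i l hil
    have h1 : xiAct T n i * xiAct T n l = -(xiAct T n l * xiAct T n i) := by
      simp only [xiAct, ← map_mul, skewX_anti hil, map_neg]
    have h2 := comm_anti (spinAct_xiAct hn) hn u v hil j
    ext1
    · simpa using h1
    · simp only [TrivSqZeroExt.snd_mul, TrivSqZeroExt.snd_neg, TrivSqZeroExt.fst_add,
        TrivSqZeroExt.snd_add, TrivSqZeroExt.fst_inl, TrivSqZeroExt.fst_inr,
        TrivSqZeroExt.snd_inl, TrivSqZeroExt.snd_inr, add_zero, zero_add, smul_eq_mul,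
        MulOpposite.smul_eq_mul_unop, MulOpposite.unop_op]
      rw [eq_neg_iff_add_eq_zero, ← h2]
      abel)

theorem skewDual_fst (hn : T.Admissible n) (u v : ℂ) (j : Fin n) (p : SkewPoly n) :
    (skewDual hn u v j p).fst = skewLeft T n p := by
  have : (TrivSqZeroExt.fstHom ℂ (Module.End ℂ (BigModule T n))
      (Module.End ℂ (BigModule T n))).comp (skewDual hn u v j) = skewLeft T n :=
    skew_ext fun i => by simp [skewDual, xiAct]
  exact DFunLike.congr_fun this p

/-- The twisted derivation `p ↦ [y_j, p]`. -/
def skewDer (hn : T.Admissible n) (u v : ℂ) (j : Fin n) :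
    SkewPoly n →ₗ[ℂ] Module.End ℂ (BigModule T n) where
  toFun p := (skewDual hn u v j p).snd
  map_add' p q := by rw [map_add, TrivSqZeroExt.snd_add]
  map_smul' c p := by rw [map_smul, TrivSqZeroExt.snd_smul, RingHom.id_apply]

theorem skewDer_one (hn : T.Admissible n) (u v : ℂ) (j : Fin n) : skewDer hn u v j 1 = 0 := by
  simp [skewDer]

theorem skewDer_X_mul (hn : T.Admissible n) (u v : ℂ) (i j : Fin n) (p : SkewPoly n) :
    skewDer hn u v j (skewX i * p) = xiAct T n i * skewDer hn u v j p +
      spinAct hn (comm T n u v i j) * skewLeft T n p := by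
  change (skewDual hn u v j (skewX i * p)).snd = _
  rw [map_mul, TrivSqZeroExt.snd_mul, skewDual_fst, skewDual_fst]
  simp [skewDual, skewDer, xiAct]

/-- The action of `y_j` on `BigModule`. -/
def yAct (hn : T.Admissible n) (u v : ℂ) (j : Fin n) : Module.End ℂ (BigModule T n) :=
  TensorProduct.lift ((LinearMap.lcomp ℂ (BigModule T n) (bigMk T n 1)) ∘ₗ skewDer hn u v j) ∘ₗ
    (bigModuleEquiv T n).symm.toLinearMap + endSpinPoly T n (yInner hn j)

theorem yAct_tmul (hn : T.Admissible n) (u v : ℂ) (j : Fin n) (p : SkewPoly n)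
    (m : SpinPoly T n) : yAct hn u v j (bigMk T n p m) =
      skewDer hn u v j p (bigMk T n 1 m) + bigMk T n p (yInner hn j m) := rfl

theorem yAct_one_tmul (hn : T.Admissible n) (u v : ℂ) (j : Fin n) (m : SpinPoly T n) :
    yAct hn u v j (bigMk T n 1 m) = bigMk T n 1 (yInner hn j m) := by
  rw [yAct_tmul, skewDer_one, LinearMap.zero_apply, zero_add]

theorem yAct_xiAct (hn : T.Admissible n) (u v : ℂ) (i j : Fin n) :
    yAct hn u v j * xiAct T n i =
      xiAct T n i * yAct hn u v j + spinAct hn (comm T n u v i j) := by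
  refine bigModule_ext fun p m => ?_
  rw [Module.End.mul_apply, xiAct, skewLeft_tmul, yAct_tmul, skewDer_X_mul, LinearMap.add_apply,
    LinearMap.add_apply, Module.End.mul_apply, Module.End.mul_apply, Module.End.mul_apply,
    yAct_tmul, map_add, xiAct, skewLeft_tmul, skewLeft_tmul, mul_one]
  abel

theorem end_eq_zero {D : Module.End ℂ (BigModule T n)}
    (h0 : ∀ m : SpinPoly T n, D (bigMk T n 1 m) = 0)
    (h1 : ∀ i, ∃ Z : Module.End ℂ (BigModule T n), D * xiAct T n i = Z * D) : D = 0 := by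
  refine bigModule_ext fun p m => ?_
  let U : Submodule ℂ (SkewPoly n) :=
    { carrier := {p | ∀ m : SpinPoly T n, D (bigMk T n p m) = 0}
      add_mem' := fun {a b} ha hb m => by
        simp only [map_add, LinearMap.add_apply, ha m, hb m, add_zero]
      zero_mem' := fun m => by simp
      smul_mem' := fun c a ha m => by
        simp only [map_smul, LinearMap.smul_apply, ha m, smul_zero] }
  refine skew_induction U h0 (fun i p hp m => ?_) p m
  obtain ⟨Z, hZ⟩ := h1 i
  rw [← skewLeft_tmul]
  have := LinearMap.congr_fun hZ (bigMk T n p m)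
  rw [Module.End.mul_apply, Module.End.mul_apply, hp m, map_zero] at this
  exact this

theorem t_mul_comm (hn : T.Admissible n) (u v : ℂ) {k : ℕ} (hk : k < T.rank n) (i j : Fin n) :
    t T n k * comm T n u v i j =
      -(eta T n k j • (comm T n u v (perm T n k i) (perm T n k j) * t T n k)) := by
  rw [← smul_mul_assoc, ← twist_comm_eq hn u v hk, twist_apply, neg_mul, neg_neg, mul_assoc,
    mul_assoc, t_mul_t hk, mul_one]

theorem spinAct_yAct (hn : T.Admissible n) (u v : ℂ) (k : ℕ) (hk : k < T.rank n) (j : Fin n) :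
    spinAct hn (t T n k) * yAct hn u v j =
      eta T n k j • (yAct hn u v (perm T n k j) * spinAct hn (t T n k)) := by
  rw [← sub_eq_zero]
  refine end_eq_zero (fun m => ?_) fun i => ⟨-xiAct T n (perm T n k i), ?_⟩
  · have h := LinearMap.congr_fun (yInner_spinLeft hn hk (perm T n k j)) m
    simp only [perm_perm, eta_perm, LinearMap.smul_apply, Module.End.mul_apply] at h
    rw [LinearMap.sub_apply, LinearMap.smul_apply, Module.End.mul_apply, Module.End.mul_apply,
      yAct_one_tmul, spinAct_t hn hk, spinAct_t hn hk, map_one, yAct_one_tmul, h,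
      map_smul, smul_smul, eta_mul_eta, one_smul, sub_self]
  · have h1 : spinAct hn (t T n k) * spinAct hn (comm T n u v i j) = -(eta T n k j •
        (spinAct hn (comm T n u v (perm T n k i) (perm T n k j)) * spinAct hn (t T n k))) := by
      rw [← map_mul, t_mul_comm hn u v hk, map_neg, map_smul, map_mul]
    rw [sub_mul, mul_assoc, yAct_xiAct, mul_add, ← mul_assoc, spinAct_xiAct hn k hk, h1,
      smul_mul_assoc, mul_assoc (yAct hn u v _), spinAct_xiAct hn k hk, mul_neg, ← mul_assoc,
      yAct_xiAct, add_mul, smul_neg, smul_add, mul_sub, neg_mul, neg_mul, mul_smul_comm]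
    simp only [mul_assoc, neg_mul, smul_neg]
    abel

theorem yAct_comm (hn : T.Admissible n) (u v : ℂ) (i j : Fin n) :
    yAct hn u v i * yAct hn u v j = yAct hn u v j * yAct hn u v i := by
  rw [← sub_eq_zero]
  refine end_eq_zero (fun m => ?_) fun l => ⟨xiAct T n l, ?_⟩
  · have h := LinearMap.congr_fun (yInner_comm hn i j) m
    simp only [Module.End.mul_apply] at h
    rw [LinearMap.sub_apply, Module.End.mul_apply, Module.End.mul_apply, yAct_one_tmul,
      yAct_one_tmul, yAct_one_tmul, yAct_one_tmul, h, sub_self]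
  · have h1 := comm_y (spinAct_yAct hn u v) hn u v l i j
    have h2 : ∀ i j, yAct hn u v i * yAct hn u v j * xiAct T n l =
        xiAct T n l * (yAct hn u v i * yAct hn u v j) +
          (spinAct hn (comm T n u v l i) * yAct hn u v j +
            yAct hn u v i * spinAct hn (comm T n u v l j)) := by
      intro i j
      rw [mul_assoc, yAct_xiAct, mul_add, ← mul_assoc, yAct_xiAct, add_mul, mul_assoc]
      abel
    rw [sub_mul, h2, h2, mul_sub, ← sub_eq_zero]
    rw [← sub_eq_zero] at h1
    rw [← neg_eq_zero, ← h1]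
    abel

theorem D_last_perm (hn : 2 ≤ n) (l : Fin n) : (perm .D n (n - 1) l : ℕ) =
    if (l : ℕ) + 2 = n then n - 1 else if (l : ℕ) + 1 = n then n - 2 else l := by
  simp only [perm, permNat, actNat_D_last (show 1 ≤ n by omega), signedSwap]
  split_ifs <;> simp only [] <;> omega

theorem D_last_eta (hn : 2 ≤ n) (l : Fin n) : eta .D n (n - 1) l =
    if (l : ℕ) + 2 = n ∨ (l : ℕ) + 1 = n then -1 else 1 := by
  simp only [eta, flipNat, actNat_D_last (show 1 ≤ n by omega), signedSwap]
  have h1 : (l : ℕ) = n - 2 ↔ (l : ℕ) + 2 = n := by omega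
  have h2 : (l : ℕ) = n - 1 ↔ (l : ℕ) + 1 = n := by omega
  simp only [h1, h2]
  by_cases h : (l : ℕ) + 2 = n
  · rw [if_pos h, if_pos (Or.inl h)]; rfl
  · by_cases h' : (l : ℕ) + 1 = n
    · rw [if_neg h, if_pos h', if_pos (Or.inr h')]; rfl
    · rw [if_neg h, if_neg h', if_neg (by tauto)]; rfl

theorem perm_chain_left {k : ℕ} (hk : k + 1 < n) (i i' : Fin n) (h : (i : ℕ) = k)
    (h' : (i' : ℕ) = k + 1) : perm T n k i = i' := by
  subst h
  rw [perm_chain hk, Equiv.swap_apply_left]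
  exact Fin.ext h'.symm

theorem perm_chain_of_ne {k : ℕ} (hk : k + 1 < n) (j : Fin n) (h : (j : ℕ) ≠ k)
    (h' : (j : ℕ) ≠ k + 1) : perm T n k j = j := by
  rw [perm_chain hk]
  exact Equiv.swap_apply_of_ne_of_ne (fun e => h (congrArg Fin.val e))
    fun e => h' (congrArg Fin.val e)

/-- The images of the generators in the polynomial representation. -/
def repGen (hn : T.Admissible n) (u v : ℂ) : Gen T n → Module.End ℂ (BigModule T n)
  | .xi i => xiAct T n i
  | .y j => yAct hn u v j
  | .spin a => spinAct hn a

theorem repGen_rel (hn : T.Admissible n) (u v : ℂ) {a b : FreeAlgebra ℂ (Gen T n)}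
    (h : Rel T n u v a b) :
    FreeAlgebra.lift ℂ (repGen hn u v) a = FreeAlgebra.lift ℂ (repGen hn u v) b := by
  have hx : ∀ i, FreeAlgebra.lift ℂ (repGen hn u v) (fxi T i) = xiAct T n i := fun i =>
    FreeAlgebra.lift_ι_apply _ _
  have hy : ∀ i, FreeAlgebra.lift ℂ (repGen hn u v) (fy T i) = yAct hn u v i := fun i =>
    FreeAlgebra.lift_ι_apply _ _
  have hs : ∀ a, FreeAlgebra.lift ℂ (repGen hn u v) (fspin a) = spinAct hn a := fun i =>
    FreeAlgebra.lift_ι_apply _ _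
  cases h with
  | spin_scalar r => rw [hs, AlgHom.commutes, AlgHom.commutes]
  | _ => ?_
  all_goals simp only [map_mul, map_add, map_neg, map_sub, hx, hy, hs]
  case y_comm i j => exact yAct_comm hn u v i j
  case xi_anti i j h => simp only [xiAct, ← map_mul, skewX_anti h, map_neg]
  case t_y i i' h =>
    have hk : (i : ℕ) + 1 < n := by omega
    rw [spinAct_yAct hn u v _ (T.lt_rank hk), eta_chain hk, one_smul,
      perm_chain_left hk i i' rfl h.symm]
  case t_xi i i' h =>
    have hk : (i : ℕ) + 1 < n := by omega
    rw [spinAct_xiAct hn _ (T.lt_rank hk), perm_chain_left hk i i' rfl h.symm]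
  case t_y_of_ne k hk j h h' =>
    rw [spinAct_yAct hn u v _ (T.lt_rank hk), eta_chain hk, one_smul, perm_chain_of_ne hk j h h']
  case t_xi_of_ne k hk j h h' =>
    rw [spinAct_xiAct hn _ (T.lt_rank hk), perm_chain_of_ne hk j h h']
  case D_last_y hT i i' h h' =>
    subst hT
    have e : perm .D n (n - 1) i' = i := by
      apply Fin.ext; rw [D_last_perm (by omega), if_neg (by omega), if_pos h']; omega
    rw [spinAct_yAct hn u v _ (D_last_lt_rank (by omega)), D_last_eta (by omega),
      if_pos (Or.inr h'), e, neg_one_smul]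
  case D_last_xi hT i i' h h' =>
    subst hT
    have e : perm .D n (n - 1) i' = i := by
      apply Fin.ext; rw [D_last_perm (by omega), if_neg (by omega), if_pos h']; omega
    rw [spinAct_xiAct hn _ (D_last_lt_rank (by omega)), e]
  case D_last_y_of_ne hT j h h' =>
    subst hT
    have hn' : 4 ≤ n := hn
    have e : perm .D n (n - 1) j = j := by
      apply Fin.ext; rw [D_last_perm (by omega), if_neg h, if_neg h']
    rw [spinAct_yAct hn u v _ (D_last_lt_rank (by omega)), D_last_eta (by omega),
      if_neg (by omega), e, one_smul]
  case D_last_xi_of_ne hT j h h' =>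
    subst hT
    have hn' : 4 ≤ n := hn
    have e : perm .D n (n - 1) j = j := by
      apply Fin.ext; rw [D_last_perm (by omega), if_neg h, if_neg h']
    rw [spinAct_xiAct hn _ (D_last_lt_rank (by omega)), e]
  case B_last_y hT i h =>
    subst hT
    have hn' : 2 ≤ n := hn
    rw [spinAct_yAct hn u v _ (B_last_lt_rank hn'), B_last_eta hn', if_pos h,
      B_last_perm hn rfl, neg_one_smul]
  case B_last_xi hT i h =>
    subst hT
    rw [spinAct_xiAct hn _ (B_last_lt_rank hn), B_last_perm hn rfl]
  case B_last_y_of_ne hT i h =>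
    subst hT
    have hn' : 2 ≤ n := hn
    rw [spinAct_yAct hn u v _ (B_last_lt_rank hn'), B_last_eta hn', if_neg h,
      B_last_perm hn rfl, one_smul]
  case B_last_xi_of_ne hT i h =>
    subst hT
    rw [spinAct_xiAct hn _ (B_last_lt_rank hn), B_last_perm hn rfl]
  case y_xi_of_ne i j h =>
    rw [yAct_xiAct, add_sub_cancel_left, comm, if_neg h]
  case y_xi_self i =>
    rw [yAct_xiAct, add_sub_cancel_left, comm, if_pos rfl]

/-- The polynomial representation of the rational spin double affine Hecke algebra. -/
def rep (hn : T.Admissible n) (u v : ℂ) : SDaHa T n u v →ₐ[ℂ] Module.End ℂ (BigModule T n) :=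
  RingQuot.liftAlgHom ℂ (s := Rel T n u v)
    ⟨FreeAlgebra.lift ℂ (repGen hn u v), fun {_ _} h => repGen_rel hn u v h⟩

theorem rep_mk (hn : T.Admissible n) (u v : ℂ) (x : FreeAlgebra ℂ (Gen T n)) :
    rep hn u v (mk T n u v x) = FreeAlgebra.lift ℂ (repGen hn u v) x :=
  RingQuot.liftAlgHom_mkAlgHom_apply ℂ _ _ x

theorem rep_xi (hn : T.Admissible n) (u v : ℂ) (i : Fin n) :
    rep hn u v (xi T n u v i) = xiAct T n i :=
  (rep_mk hn u v _).trans (FreeAlgebra.lift_ι_apply _ _)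

theorem rep_y (hn : T.Admissible n) (u v : ℂ) (i : Fin n) :
    rep hn u v (y T n u v i) = yAct hn u v i :=
  (rep_mk hn u v _).trans (FreeAlgebra.lift_ι_apply _ _)

theorem rep_spinHom (hn : T.Admissible n) (u v : ℂ) (a : SpinWeyl T n) :
    rep hn u v (spinHom T n u v a) = spinAct hn a :=
  (rep_mk hn u v _).trans (FreeAlgebra.lift_ι_apply _ _)

theorem skewHom_skewX (u v : ℂ) (i : Fin n) : skewHom T n u v (skewX i) = xi T n u v i :=
  (RingQuot.liftAlgHom_mkAlgHom_apply ℂ _ _ _).trans (FreeAlgebra.lift_ι_apply _ _)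

section Relations

variable (u v : ℂ)

theorem mk_fspin (a : SpinWeyl T n) : mk T n u v (fspin a) = spinHom T n u v a := rfl

theorem mk_fxi (i : Fin n) : mk T n u v (fxi T i) = xi T n u v i := rfl

theorem mk_fy (i : Fin n) : mk T n u v (fy T i) = y T n u v i := rfl

theorem y_mul_xi (i j : Fin n) : y T n u v j * xi T n u v i =
    xi T n u v i * y T n u v j + spinHom T n u v (comm T n u v i j) := by
  rw [← sub_eq_iff_eq_add']
  by_cases h : i = j
  · subst h
    rw [comm, if_pos rfl]
    simpa only [map_sub, map_mul, mk_fspin, mk_fxi, mk_fy] using mk_rel T n u v (.y_xi_self i)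
  · rw [comm, if_neg h]
    simpa only [map_sub, map_mul, mk_fspin, mk_fxi, mk_fy] using mk_rel T n u v (.y_xi_of_ne i j h)

theorem mul_eq_smul_of_involutive {R : Type*} [Ring R] [Algebra ℂ R] {s a b : R} {c : ℂ}
    (hs : s * s = 1) (hc : c * c = 1) (h : s * a = c • (b * s)) : s * b = c • (a * s) := by
  have h1 : a * s = c • (s * b) := by
    calc a * s = s * (s * a) * s := by rw [← mul_assoc, hs, one_mul]
      _ = c • (s * b) := by
        rw [h, mul_smul_comm, smul_mul_assoc, mul_assoc, mul_assoc, hs, mul_one]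
  rw [h1, smul_smul, hc, one_smul]

theorem spin_t_sq {k : ℕ} (hk : k < T.rank n) :
    spinHom T n u v (t T n k) * spinHom T n u v (t T n k) = 1 := by
  rw [← map_mul, t_mul_t hk, map_one]

/-- A family of relations between the `t_k` and elements `X_j`, of the form
`t_k X_j = c ν_{k,j} X_{s_k(j)} t_k`, follows from the defining ones. -/
theorem t_mul_of_cases (hn : T.Admissible n) (X : Fin n → SDaHa T n u v) (ν : ℕ → Fin n → ℂ)
    (hν : ∀ k j, ν k (perm T n k j) = ν k j) (hν2 : ∀ k j, ν k j * ν k j = 1)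
    (h1 : ∀ i i' : Fin n, (i : ℕ) + 1 = i' →
      spinHom T n u v (t T n i) * X i = ν i i • (X i' * spinHom T n u v (t T n i)))
    (h2 : ∀ k, k + 1 < n → ∀ j : Fin n, (j : ℕ) ≠ k → (j : ℕ) ≠ k + 1 →
      spinHom T n u v (t T n k) * X j = ν k j • (X j * spinHom T n u v (t T n k)))
    (hD1 : T = .D → ∀ i i' : Fin n, (i : ℕ) + 2 = n → (i' : ℕ) + 1 = n →
      spinHom T n u v (t T n (n - 1)) * X i' =
        ν (n - 1) i' • (X i * spinHom T n u v (t T n (n - 1))))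
    (hD2 : T = .D → ∀ j : Fin n, (j : ℕ) + 2 ≠ n → (j : ℕ) + 1 ≠ n →
      spinHom T n u v (t T n (n - 1)) * X j =
        ν (n - 1) j • (X j * spinHom T n u v (t T n (n - 1))))
    (hB : T = .B → ∀ j : Fin n, spinHom T n u v (t T n (n - 1)) * X j =
      ν (n - 1) j • (X j * spinHom T n u v (t T n (n - 1))))
    {k : ℕ} (hk : k < T.rank n) (j : Fin n) :
    spinHom T n u v (t T n k) * X j =
      ν k j • (X (perm T n k j) * spinHom T n u v (t T n k)) := by
  by_cases hk' : k + 1 < n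
  · by_cases hj : (j : ℕ) = k
    · rw [perm_chain_left hk' j ⟨k + 1, hk'⟩ hj rfl]
      subst hj
      exact h1 j _ rfl
    · by_cases hj' : (j : ℕ) = k + 1
      · have e : perm T n k ⟨k, by omega⟩ = j := perm_chain_left hk' _ _ rfl hj'
        rw [← e, perm_perm, hν]
        refine mul_eq_smul_of_involutive (spin_t_sq u v hk) (hν2 _ _) ?_
        rw [e]
        exact h1 ⟨k, by omega⟩ j hj'.symm
      · rw [perm_chain_of_ne hk' j hj hj']
        exact h2 k hk' j hj hj'
  · cases T with
    | A => simp only [ClassicalType.rank] at hk; omega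
    | D =>
      have hn' : 4 ≤ n := hn
      obtain rfl : k = n - 1 := by simp only [ClassicalType.rank] at hk; omega
      by_cases hj : (j : ℕ) + 1 = n
      · have e : perm .D n (n - 1) j = ⟨n - 2, by omega⟩ := by
          apply Fin.ext; rw [D_last_perm (by omega), if_neg (by omega), if_pos hj]
        rw [e]
        exact hD1 rfl _ _ (by simp only; omega) hj
      · by_cases hj' : (j : ℕ) + 2 = n
        · have e : perm .D n (n - 1) j = ⟨n - 1, by omega⟩ := by
            apply Fin.ext; rw [D_last_perm (by omega), if_pos hj']
          have e' := hν (n - 1) j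
          rw [e] at e' ⊢
          rw [← e']
          exact mul_eq_smul_of_involutive (spin_t_sq u v hk) (hν2 _ _)
            (hD1 rfl _ _ hj' (by simp only; omega))
        · have e : perm .D n (n - 1) j = j := by
            apply Fin.ext; rw [D_last_perm (by omega), if_neg hj', if_neg hj]
          rw [e]
          exact hD2 rfl j hj' hj
    | B =>
      obtain rfl : k = n - 1 := by simp only [ClassicalType.rank] at hk; omega
      rw [B_last_perm hn rfl]
      exact hB rfl j

theorem t_mul_y (hn : T.Admissible n) {k : ℕ} (hk : k < T.rank n) (j : Fin n) :
    spinHom T n u v (t T n k) * y T n u v j =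
      eta T n k j • (y T n u v (perm T n k j) * spinHom T n u v (t T n k)) := by
  refine t_mul_of_cases u v hn (y T n u v) (eta T n) (by simp) (by simp) ?_ ?_ ?_ ?_ ?_ hk j
  · intro i i' h
    rw [eta_chain (by omega), one_smul]
    simpa only [map_mul, mk_fspin, mk_fy] using mk_rel T n u v (.t_y i i' h)
  · intro k hk j h h'
    rw [eta_chain hk, one_smul]
    simpa only [map_mul, mk_fspin, mk_fy] using mk_rel T n u v (.t_y_of_ne k hk j h h')
  · rintro rfl i i' h h'
    rw [D_last_eta (by omega), if_pos (Or.inr h'), neg_one_smul]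
    simpa only [map_mul, map_neg, mk_fspin, mk_fxi, mk_fy] using mk_rel .D n u v (.D_last_y rfl i i' h h')
  · rintro rfl j h h'
    have hn' : 4 ≤ n := hn
    rw [D_last_eta (by omega), if_neg (by omega), one_smul]
    simpa only [map_mul, mk_fspin, mk_fy] using mk_rel .D n u v (.D_last_y_of_ne rfl j h h')
  · rintro rfl j
    rw [B_last_eta hn]
    split_ifs with h
    · rw [neg_one_smul]
      simpa only [map_mul, map_neg, mk_fspin, mk_fxi, mk_fy] using mk_rel .B n u v (.B_last_y rfl j h)
    · rw [one_smul]
      simpa only [map_mul, mk_fspin, mk_fy] using mk_rel .B n u v (.B_last_y_of_ne rfl j h)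

theorem t_mul_xi (hn : T.Admissible n) {k : ℕ} (hk : k < T.rank n) (j : Fin n) :
    spinHom T n u v (t T n k) * xi T n u v j =
      -(xi T n u v (perm T n k j) * spinHom T n u v (t T n k)) := by
  rw [← neg_one_smul ℂ]
  refine t_mul_of_cases u v hn (xi T n u v) (fun _ _ => -1) (by simp) (by simp) ?_ ?_ ?_ ?_ ?_ hk j
    <;> simp only [neg_one_smul]
  · intro i i' h
    simpa only [map_mul, map_neg, mk_fspin, mk_fxi, mk_fy] using mk_rel T n u v (.t_xi i i' h)
  · intro k hk j h h'
    simpa only [map_mul, map_neg, mk_fspin, mk_fxi, mk_fy] using mk_rel T n u v (.t_xi_of_ne k hk j h h')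
  · rintro rfl i i' h h'
    simpa only [map_mul, map_neg, mk_fspin, mk_fxi, mk_fy] using mk_rel .D n u v (.D_last_xi rfl i i' h h')
  · rintro rfl j h h'
    simpa only [map_mul, map_neg, mk_fspin, mk_fxi, mk_fy] using mk_rel .D n u v (.D_last_xi_of_ne rfl j h h')
  · rintro rfl j
    by_cases h : (j : ℕ) + 1 = n
    · simpa only [map_mul, map_neg, mk_fspin, mk_fxi, mk_fy] using mk_rel .B n u v (.B_last_xi rfl j h)
    · simpa only [map_mul, map_neg, mk_fspin, mk_fxi, mk_fy] using mk_rel .B n u v (.B_last_xi_of_ne rfl j h)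

end Relations

theorem bigModule_ext_spinTmul {V : Type*} [AddCommMonoid V] [Module ℂ V]
    {D D' : BigModule T n →ₗ[ℂ] V}
    (h : ∀ p a f, D (bigMk T n p (spinTmul a f)) = D' (bigMk T n p (spinTmul a f))) : D = D' :=
  bigModule_ext fun p => LinearMap.congr_fun
    (spinPoly_ext (D := D ∘ₗ bigMk T n p) (D' := D' ∘ₗ bigMk T n p) (h p))

/-- The source of the multiplication map, identified with the polynomial representation. -/
def tripleEquiv (T : ClassicalType) (n : ℕ) :
    (SkewPoly n ⊗[ℂ] SpinWeyl T n ⊗[ℂ] MvPolynomial (Fin n) ℂ) ≃ₗ[ℂ] BigModule T n :=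
  TensorProduct.assoc ℂ (SkewPoly n) (SpinWeyl T n) (MvPolynomial (Fin n) ℂ) ≪≫ₗ
    (spinPolyEquiv T n).lTensor (SkewPoly n) ≪≫ₗ bigModuleEquiv T n

theorem tripleEquiv_tmul (p : SkewPoly n) (a : SpinWeyl T n) (f : MvPolynomial (Fin n) ℂ) :
    tripleEquiv T n (p ⊗ₜ[ℂ] a ⊗ₜ[ℂ] f) = bigMk T n p (spinTmul a f) := rfl

section Multiplication

variable (u v : ℂ)

/-- The multiplication map, as a map from the polynomial representation. -/
def bigMult (T : ClassicalType) (n : ℕ) (u v : ℂ) : BigModule T n →ₗ[ℂ] SDaHa T n u v :=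
  multMap T n u v ∘ₗ (tripleEquiv T n).symm.toLinearMap

theorem bigMult_tmul (p : SkewPoly n) (a : SpinWeyl T n) (f : MvPolynomial (Fin n) ℂ) :
    bigMult T n u v (bigMk T n p (spinTmul a f)) =
      skewHom T n u v p * spinHom T n u v a * polyHom T n u v f := by
  rw [bigMult, ← tripleEquiv_tmul, LinearMap.comp_apply, LinearEquiv.coe_coe,
    LinearEquiv.symm_apply_apply, multMap_tmul]

theorem bigMult_skewLeft (p : SkewPoly n) (m : BigModule T n) :
    bigMult T n u v (skewLeft T n p m) = skewHom T n u v p * bigMult T n u v m := by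
  refine LinearMap.congr_fun (f := bigMult T n u v ∘ₗ skewLeft T n p)
    (g := LinearMap.mulLeft ℂ (skewHom T n u v p) ∘ₗ bigMult T n u v)
    (bigModule_ext_spinTmul fun q a f => ?_) m
  rw [LinearMap.comp_apply, LinearMap.comp_apply, skewLeft_tmul, bigMult_tmul, bigMult_tmul,
    map_mul, LinearMap.mulLeft_apply]
  simp only [mul_assoc]

theorem bigMult_xiAct (i : Fin n) (m : BigModule T n) :
    bigMult T n u v (xiAct T n i m) = xi T n u v i * bigMult T n u v m := by
  rw [xiAct, bigMult_skewLeft, skewHom_skewX]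

theorem t_mul_skewHom (hn : T.Admissible n) {k : ℕ} (hk : k < T.rank n) (p : SkewPoly n) :
    spinHom T n u v (t T n k) * skewHom T n u v p =
      skewHom T n u v (skewAut T n k p) * spinHom T n u v (t T n k) := by
  let U : Submodule ℂ (SkewPoly n) := LinearMap.eqLocus
    (LinearMap.mulLeft ℂ (spinHom T n u v (t T n k)) ∘ₗ (skewHom T n u v).toLinearMap)
    (LinearMap.mulRight ℂ (spinHom T n u v (t T n k)) ∘ₗ (skewHom T n u v).toLinearMap ∘ₗ
      (skewAut T n k).toLinearMap)
  refine skew_induction U ?_ (fun i p hp => ?_) p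
  · change spinHom T n u v (t T n k) * skewHom T n u v 1 =
      skewHom T n u v (skewAut T n k 1) * spinHom T n u v (t T n k)
    simp only [map_one, one_mul, mul_one]
  · change spinHom T n u v (t T n k) * skewHom T n u v p =
      skewHom T n u v (skewAut T n k p) * spinHom T n u v (t T n k) at hp
    change spinHom T n u v (t T n k) * skewHom T n u v (skewX i * p) =
      skewHom T n u v (skewAut T n k (skewX i * p)) * spinHom T n u v (t T n k)
    rw [map_mul, map_mul, map_mul, skewAut_X, map_neg, skewHom_skewX, skewHom_skewX, ← mul_assoc,
      t_mul_xi u v hn hk, neg_mul, neg_mul, neg_mul, mul_assoc, hp, mul_assoc]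

theorem bigMult_spinAct (hn : T.Admissible n) (a : SpinWeyl T n) (m : BigModule T n) :
    bigMult T n u v (spinAct hn a m) = spinHom T n u v a * bigMult T n u v m := by
  let U : Submodule ℂ (SpinWeyl T n) :=
    { carrier := {a | ∀ m, bigMult T n u v (spinAct hn a m) =
        spinHom T n u v a * bigMult T n u v m}
      add_mem' := fun {a b} ha hb m => by
        rw [map_add, LinearMap.add_apply, map_add, ha m, hb m, map_add, add_mul]
      zero_mem' := fun m => by
        rw [map_zero, LinearMap.zero_apply, map_zero, map_zero, zero_mul]
      smul_mem' := fun c a ha m => by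
        rw [map_smul, LinearMap.smul_apply, map_smul, ha m, map_smul, smul_mul_assoc] }
  refine spin_induction U ?_ (fun k hk a ha m => ?_) a m
  · intro m
    rw [map_one, Module.End.one_apply, map_one, one_mul]
  · rw [map_mul, Module.End.mul_apply, map_mul, mul_assoc, ← ha]
    generalize spinAct hn a m = m'
    refine LinearMap.congr_fun (f := bigMult T n u v ∘ₗ spinAct hn (t T n k))
      (g := LinearMap.mulLeft ℂ (spinHom T n u v (t T n k)) ∘ₗ bigMult T n u v)
      (bigModule_ext_spinTmul fun q a f => ?_) m'
    rw [LinearMap.comp_apply, LinearMap.comp_apply, spinAct_t hn hk, spinLeft_tmul, bigMult_tmul,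
      bigMult_tmul, LinearMap.mulLeft_apply, map_mul, ← mul_assoc, ← mul_assoc, ← mul_assoc,
      t_mul_skewHom u v hn hk]

theorem y_mul_spinHom (hn : T.Admissible n) (a : SpinWeyl T n) (j : Fin n) :
    y T n u v j * spinHom T n u v a =
      ∑ i, spinHom T n u v (spinMatrix hn a j i) * y T n u v i := by
  let U : Submodule ℂ (SpinWeyl T n) :=
    { carrier := {a | ∀ j, y T n u v j * spinHom T n u v a =
        ∑ i, spinHom T n u v (spinMatrix hn a j i) * y T n u v i}
      add_mem' := fun {a b} ha hb j => by
        simp only [map_add, mul_add, ha j, hb j, Matrix.add_apply, add_mul, Finset.sum_add_distrib]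
      zero_mem' := fun j => by simp
      smul_mem' := fun c a ha j => by
        simp only [map_smul, mul_smul_comm, ha j, Matrix.smul_apply, smul_mul_assoc,
          Finset.smul_sum] }
  refine spin_induction U (fun j => ?_) (fun k hk a ha j => ?_) a j
  · rw [map_one, map_one, mul_one, Finset.sum_eq_single j]
    · simp
    · intro i _ hi
      rw [Matrix.one_apply_ne (Ne.symm hi), map_zero, zero_mul]
    · simp
  · simp only [spinMatrix_t_mul hn hk, map_smul, map_mul, smul_mul_assoc, mul_assoc,
      ← Finset.smul_sum, ← Finset.mul_sum]
    rw [← ha (perm T n k j), ← mul_assoc, ← mul_assoc, t_mul_y u v hn hk, perm_perm, eta_perm,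
      smul_mul_assoc, smul_smul, eta_mul_eta, one_smul]

theorem bigMult_yAct (hn : T.Admissible n) (j : Fin n) (m : BigModule T n) :
    bigMult T n u v (yAct hn u v j m) = y T n u v j * bigMult T n u v m := by
  have base : ∀ m : SpinPoly T n, bigMult T n u v (yAct hn u v j (bigMk T n 1 m)) =
      y T n u v j * bigMult T n u v (bigMk T n 1 m) := by
    intro m
    refine LinearMap.congr_fun (f := bigMult T n u v ∘ₗ yAct hn u v j ∘ₗ bigMk T n 1)
      (g := LinearMap.mulLeft ℂ (y T n u v j) ∘ₗ bigMult T n u v ∘ₗ bigMk T n 1)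
      (spinPoly_ext fun a f => ?_) m
    simp only [LinearMap.comp_apply, LinearMap.mulLeft_apply]
    simp only [yAct_one_tmul, yInner_tmul, map_sum, bigMult_tmul, map_one, one_mul, map_mul,
      polyHom_X]
    rw [← mul_assoc, y_mul_spinHom u v hn, Finset.sum_mul]
    simp only [mul_assoc]
  refine LinearMap.congr_fun (f := bigMult T n u v ∘ₗ yAct hn u v j)
    (g := LinearMap.mulLeft ℂ (y T n u v j) ∘ₗ bigMult T n u v)
    (bigModule_ext fun p m => ?_) m
  let U : Submodule ℂ (SkewPoly n) :=
    { carrier := {p | bigMult T n u v (yAct hn u v j (bigMk T n p m)) =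
        y T n u v j * bigMult T n u v (bigMk T n p m)}
      add_mem' := fun {a b} ha hb => by
        simp only [Set.mem_ofPred_eq] at ha hb ⊢
        rw [map_add, LinearMap.add_apply, map_add, map_add, map_add, ha, hb, mul_add]
      zero_mem' := by
        simp only [Set.mem_ofPred_eq]
        rw [map_zero, LinearMap.zero_apply, map_zero, map_zero, mul_zero]
      smul_mem' := fun c a ha => by
        simp only [Set.mem_ofPred_eq] at ha ⊢
        rw [map_smul, LinearMap.smul_apply, map_smul, map_smul, map_smul, ha, mul_smul_comm] }
  refine skew_induction U (base m) (fun i p hp => ?_) p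
  have hp : bigMult T n u v (yAct hn u v j (bigMk T n p m)) =
    y T n u v j * bigMult T n u v (bigMk T n p m) := hp
  have h := LinearMap.congr_fun (yAct_xiAct hn u v i j) (bigMk T n p m)
  rw [Module.End.mul_apply, LinearMap.add_apply, Module.End.mul_apply] at h
  have hx : xiAct T n i (bigMk T n p m) = bigMk T n (skewX i * p) m := rfl
  change bigMult T n u v (yAct hn u v j (bigMk T n (skewX i * p) m)) =
    y T n u v j * bigMult T n u v (bigMk T n (skewX i * p) m)
  rw [← hx, h, map_add, bigMult_xiAct, bigMult_spinAct, bigMult_xiAct, hp, ← mul_assoc,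
    ← mul_assoc, ← add_mul, y_mul_xi]

theorem bigMult_rep (hn : T.Admissible n) (h : SDaHa T n u v) (m : BigModule T n) :
    bigMult T n u v (rep hn u v h m) = h * bigMult T n u v m := by
  obtain ⟨w, rfl⟩ : ∃ w, mk T n u v w = h := RingQuot.mkAlgHom_surjective ℂ (Rel T n u v) h
  induction w using FreeAlgebra.induction generalizing m with
  | grade0 r =>
    rw [AlgHom.commutes, AlgHom.commutes, Module.algebraMap_end_apply, map_smul,
      ← Algebra.smul_def]
  | grade1 g =>
    cases g with
    | xi i =>
      change bigMult T n u v (rep hn u v (xi T n u v i) m) = xi T n u v i * _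
      rw [rep_xi, bigMult_xiAct]
    | y j =>
      change bigMult T n u v (rep hn u v (y T n u v j) m) = y T n u v j * _
      rw [rep_y, bigMult_yAct]
    | spin a =>
      change bigMult T n u v (rep hn u v (spinHom T n u v a) m) = spinHom T n u v a * _
      rw [rep_spinHom, bigMult_spinAct]
  | mul a b ha hb =>
    rw [map_mul, map_mul, Module.End.mul_apply, ha, hb, mul_assoc]
  | add a b ha hb =>
    rw [map_add, map_add, LinearMap.add_apply, map_add, ha, hb, add_mul]

theorem rep_skewHom (hn : T.Admissible n) (p : SkewPoly n) :
    rep hn u v (skewHom T n u v p) = skewLeft T n p := by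
  have : (rep hn u v).comp (skewHom T n u v) = skewLeft T n :=
    skew_ext fun i => by
      rw [AlgHom.comp_apply, skewHom_skewX, rep_xi, xiAct]
  exact DFunLike.congr_fun this p

theorem rep_polyHom_one (hn : T.Admissible n) (f : MvPolynomial (Fin n) ℂ) :
    rep hn u v (polyHom T n u v f) (bigMk T n 1 (spinTmul 1 1)) = bigMk T n 1 (spinTmul 1 f) := by
  let vac : MvPolynomial (Fin n) ℂ →ₗ[ℂ] BigModule T n :=
    bigMk T n 1 ∘ₗ (spinPolyEquiv T n).toLinearMap ∘ₗ
      TensorProduct.mk ℂ (SpinWeyl T n) (MvPolynomial (Fin n) ℂ) 1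
  have hvac : ∀ f, vac f = bigMk T n 1 (spinTmul 1 f) := fun _ => rfl
  rw [← hvac, ← hvac]
  induction f using MvPolynomial.induction_on with
  | C a =>
    rw [← MvPolynomial.algebraMap_eq, AlgHom.commutes, AlgHom.commutes,
      Module.algebraMap_end_apply, Algebra.algebraMap_eq_smul_one, map_smul]
  | add p q hp hq => rw [map_add, map_add, LinearMap.add_apply, hp, hq, map_add]
  | mul_X p i hp =>
    rw [mul_comm, map_mul, map_mul, Module.End.mul_apply, hp, polyHom_X, rep_y, hvac,
      yAct_one_tmul, yInner_one_tmul, hvac]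

theorem rep_bigMult (hn : T.Admissible n) (m : BigModule T n) :
    rep hn u v (bigMult T n u v m) (bigMk T n 1 (spinTmul 1 1)) = m := by
  refine LinearMap.congr_fun (f := (LinearMap.applyₗ (bigMk T n 1 (spinTmul 1 1))) ∘ₗ
    (rep hn u v).toLinearMap ∘ₗ bigMult T n u v) (g := LinearMap.id)
    (bigModule_ext_spinTmul fun p a f => ?_) m
  change rep hn u v (bigMult T n u v (bigMk T n p (spinTmul a f)))
    (bigMk T n 1 (spinTmul 1 1)) = _
  rw [bigMult_tmul, map_mul, map_mul, Module.End.mul_apply, Module.End.mul_apply,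
    rep_polyHom_one, rep_spinHom, spinAct_one_tmul, spinLeft_tmul, rep_skewHom, skewLeft_tmul,
    mul_one, mul_one, LinearMap.id_apply]

theorem multMap_bijective (hn : T.Admissible n) : Function.Bijective (multMap T n u v) := by
  have h : Function.Bijective (bigMult T n u v) := by
    refine ⟨Function.LeftInverse.injective
      (g := fun h => rep hn u v h (bigMk T n 1 (spinTmul 1 1))) (rep_bigMult u v hn), fun h =>
        ⟨rep hn u v h (bigMk T n 1 (spinTmul 1 1)), ?_⟩⟩
    rw [bigMult_rep, bigMult_tmul, map_one, map_one, map_one, mul_one, mul_one, mul_one]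
  have e : ⇑(multMap T n u v) = bigMult T n u v ∘ tripleEquiv T n := by
    ext x
    simp [bigMult]
  rw [e]
  exact h.comp (tripleEquiv T n).bijective

end Multiplication

/-- The sign that arises when `ξ_i` is moved into its place in the monomial `ξ^α`. -/
def monomialSign {n : ℕ} (i : Fin n) (α : Fin n → ℕ) : ℂ := (-1) ^ ∑ j, if j < i then α j else 0

theorem monomialSign_mul_self (i : Fin n) (α : Fin n → ℕ) :
    monomialSign i α * monomialSign i α = 1 := by
  rw [monomialSign, ← mul_pow]
  simp

theorem monomialSign_add_single (i l : Fin n) (α : Fin n → ℕ) :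
    monomialSign i (α + Pi.single l 1) = monomialSign i α * if l < i then -1 else 1 := by
  have : (∑ j, if j < i then (α + Pi.single l 1 : Fin n → ℕ) j else 0) =
      (∑ j, if j < i then α j else 0) + if l < i then 1 else 0 := by
    have h : ∀ j, (if j < i then (α + Pi.single l 1 : Fin n → ℕ) j else 0) =
        (if j < i then α j else 0) + if j = l then (if l < i then 1 else 0) else 0 := by
      intro j
      by_cases hj : j = l
      · subst hj
        simp only [Pi.add_apply, Pi.single_eq_same, if_true]
        split_ifs <;> rfl
      · simp [hj]
    simp only [h, Finset.sum_add_distrib, Finset.sum_ite_eq', Finset.mem_univ, if_true]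
  rw [monomialSign, this, pow_add]
  split_ifs <;> simp [monomialSign]

theorem mul_prod_ofFn_pow {R : Type*} [Ring R] [Algebra ℂ R] {m : ℕ} (X : Fin m → R)
    (hX : ∀ i j, i ≠ j → X i * X j = -(X j * X i)) (i : Fin m) (α : Fin m → ℕ) :
    X i * (List.ofFn fun j => X j ^ α j).prod =
      monomialSign i α • (List.ofFn fun j => X j ^ (α + Pi.single i 1 : Fin m → ℕ) j).prod := by
  induction m with
  | zero => exact i.elim0
  | succ m ih =>
    rw [List.ofFn_succ, List.ofFn_succ, List.prod_cons, List.prod_cons]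
    refine Fin.cases ?_ (fun i => ?_) i
    · simp [monomialSign, pow_succ', mul_assoc]
    · have h1 : X i.succ * X 0 ^ α 0 = ((-1 : ℂ) ^ α 0) • (X 0 ^ α 0 * X i.succ) := by
        induction α 0 with
        | zero => simp
        | succ a iha =>
          rw [pow_succ, ← mul_assoc, iha, smul_mul_assoc, mul_assoc,
            hX _ _ (Fin.succ_ne_zero i), pow_succ, mul_neg, mul_smul, neg_one_smul, mul_assoc]
      have h2 : monomialSign i.succ α = (-1) ^ α 0 * monomialSign i fun j => α j.succ := by
        simp [monomialSign, Fin.sum_univ_succ, pow_add]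
      have h3 : ∀ j : Fin m, (α + Pi.single i.succ 1 : Fin (m + 1) → ℕ) j.succ =
          ((fun j => α j.succ) + Pi.single i 1 : Fin m → ℕ) j := by
        intro j
        simp [Pi.single_apply]
      have h4 : (α + Pi.single i.succ 1 : Fin (m + 1) → ℕ) 0 = α 0 := by simp
      rw [← mul_assoc, h1, smul_mul_assoc, mul_assoc,
        ih (fun j => X j.succ) (fun a b hab => hX _ _ (by simpa using hab)) i, h2, mul_smul,
        mul_smul_comm, h4]
      simp only [h3]

/-- The ordered monomial `ξ^α` of the skew-polynomial algebra. -/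
def skewMonomial (α : Fin n → ℕ) : SkewPoly n := (List.ofFn fun i => skewX i ^ α i).prod

theorem skewX_mul_skewMonomial (i : Fin n) (α : Fin n → ℕ) :
    skewX i * skewMonomial α = monomialSign i α • skewMonomial (α + Pi.single i 1) :=
  mul_prod_ofFn_pow skewX (fun _ _ h => skewX_anti h) i α

theorem skewMonomial_zero : skewMonomial (0 : Fin n → ℕ) = 1 := by
  simp [skewMonomial]

/-- The action of `ξ_i` on the space of formal combinations of ordered monomials. -/
def monomialAct (i : Fin n) : Module.End ℂ ((Fin n → ℕ) →₀ ℂ) :=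
  Finsupp.linearCombination ℂ fun α =>
    Finsupp.single (α + Pi.single i 1) (monomialSign i α)

theorem monomialAct_single (i : Fin n) (α : Fin n → ℕ) (c : ℂ) :
    monomialAct i (Finsupp.single α c) =
      Finsupp.single (α + Pi.single i 1) (c * monomialSign i α) := by
  rw [monomialAct, Finsupp.linearCombination_single, Finsupp.smul_single, smul_eq_mul]

theorem monomialAct_anti {i j : Fin n} (h : i ≠ j) :
    monomialAct i * monomialAct j = -(monomialAct j * monomialAct i) := by
  refine Finsupp.lhom_ext fun α c => ?_
  rw [LinearMap.neg_apply, Module.End.mul_apply, Module.End.mul_apply, monomialAct_single,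
    monomialAct_single, monomialAct_single, monomialAct_single, ← Finsupp.single_neg,
    add_right_comm, monomialSign_add_single, monomialSign_add_single]
  congr 1
  rcases h.lt_or_gt with h | h
  · rw [if_neg h.not_gt, if_pos h]; ring
  · rw [if_pos h, if_neg h.not_gt]; ring

/-- The representation of the skew-polynomial algebra on combinations of ordered monomials. -/
def monomialRep (n : ℕ) : SkewPoly n →ₐ[ℂ] Module.End ℂ ((Fin n → ℕ) →₀ ℂ) :=
  skewLift monomialAct fun _ _ h => monomialAct_anti h

theorem monomialRep_skewMonomial (α : Fin n → ℕ) :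
    monomialRep n (skewMonomial α) (Finsupp.single 0 1) = Finsupp.single α 1 := by
  induction h : ∑ i, α i generalizing α with
  | zero =>
    have h0 : α = 0 := funext fun i => by simpa using (Finset.sum_eq_zero_iff.1 h) i
    subst h0
    rw [skewMonomial_zero, map_one, Module.End.one_apply]
  | succ d ih =>
    obtain ⟨i, hi⟩ : ∃ i, α i ≠ 0 := by
      by_contra! hα
      simp [hα] at h
    obtain ⟨β, rfl⟩ : ∃ β, α = β + Pi.single i 1 := by
      refine ⟨α - Pi.single i 1, (tsub_add_cancel_of_le ?_).symm⟩
      intro j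
      by_cases hj : j = i
      · subst hj
        rw [Pi.single_eq_same]
        exact Nat.one_le_iff_ne_zero.2 hi
      · simp [hj]
    have hβ : ∑ j, β j = d := by
      simpa [Finset.sum_add_distrib] using h
    have h1 : skewMonomial (β + Pi.single i 1) =
        monomialSign i β • (skewX i * skewMonomial β) := by
      rw [skewX_mul_skewMonomial, smul_smul, monomialSign_mul_self, one_smul]
    rw [h1, map_smul, map_mul, LinearMap.smul_apply, Module.End.mul_apply, ih β hβ, monomialRep,
      skewLift_X, monomialAct_single, one_mul, Finsupp.smul_single, smul_eq_mul,
      monomialSign_mul_self]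

theorem linearCombination_monomialRep (p : SkewPoly n) (m : (Fin n → ℕ) →₀ ℂ) :
    Finsupp.linearCombination ℂ skewMonomial (monomialRep n p m) =
      p * Finsupp.linearCombination ℂ skewMonomial m := by
  let U : Submodule ℂ (SkewPoly n) :=
    { carrier := {p | ∀ m, Finsupp.linearCombination ℂ skewMonomial (monomialRep n p m) =
        p * Finsupp.linearCombination ℂ skewMonomial m}
      add_mem' := fun {a b} ha hb m => by
        rw [map_add, LinearMap.add_apply, map_add, ha m, hb m, add_mul]
      zero_mem' := fun m => by
        rw [map_zero, LinearMap.zero_apply, map_zero, zero_mul]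
      smul_mem' := fun c a ha m => by
        rw [map_smul, LinearMap.smul_apply, map_smul, ha m, smul_mul_assoc] }
  refine skew_induction U (fun m => ?_) (fun i p hp m => ?_) p m
  · rw [map_one, Module.End.one_apply, one_mul]
  · rw [map_mul, Module.End.mul_apply, mul_assoc, ← hp]
    generalize monomialRep n p m = m'
    refine LinearMap.congr_fun
      (f := Finsupp.linearCombination ℂ skewMonomial ∘ₗ monomialRep n (skewX i))
      (g := LinearMap.mulLeft ℂ (skewX i) ∘ₗ Finsupp.linearCombination ℂ skewMonomial)
      (Finsupp.lhom_ext fun α c => ?_) m'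
    rw [LinearMap.comp_apply, LinearMap.comp_apply, LinearMap.mulLeft_apply, monomialRep,
      skewLift_X, monomialAct_single, Finsupp.linearCombination_single,
      Finsupp.linearCombination_single, mul_smul_comm, skewX_mul_skewMonomial, smul_smul]

theorem linearCombination_skewMonomial_bijective (n : ℕ) :
    Function.Bijective (Finsupp.linearCombination ℂ (skewMonomial (n := n))) := by
  refine ⟨Function.LeftInverse.injective
    (g := fun p => monomialRep n p (Finsupp.single 0 1)) fun m => ?_, fun p =>
      ⟨monomialRep n p (Finsupp.single 0 1), ?_⟩⟩
  · refine LinearMap.congr_fun (f := LinearMap.applyₗ (Finsupp.single (0 : Fin n → ℕ) (1 : ℂ)) ∘ₗ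
      (monomialRep n).toLinearMap ∘ₗ Finsupp.linearCombination ℂ skewMonomial)
      (g := LinearMap.id) (Finsupp.lhom_ext fun α c => ?_) m
    change monomialRep n (Finsupp.linearCombination ℂ skewMonomial (Finsupp.single α c))
      (Finsupp.single 0 1) = Finsupp.single α c
    rw [Finsupp.linearCombination_single, map_smul, LinearMap.smul_apply,
      monomialRep_skewMonomial, Finsupp.smul_single, smul_eq_mul, mul_one]
  · rw [linearCombination_monomialRep, Finsupp.linearCombination_single, skewMonomial_zero,
      one_smul, mul_one]

/-- The basis of the skew-polynomial algebra formed by the ordered monomials. -/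
def skewBasis (n : ℕ) : Module.Basis (Fin n → ℕ) ℂ (SkewPoly n) :=
  .ofRepr (LinearEquiv.ofBijective _ (linearCombination_skewMonomial_bijective n)).symm

theorem skewBasis_apply (α : Fin n → ℕ) : skewBasis n α = skewMonomial α := by
  simp [skewBasis]

theorem skewHom_skewMonomial (u v : ℂ) (α : Fin n → ℕ) :
    skewHom T n u v (skewMonomial α) = xiMonomial T n u v α := by
  simp only [skewMonomial, xiMonomial, map_list_prod, List.map_ofFn, Function.comp_def, map_pow,
    skewHom_skewX]

/-- The monomial basis of the polynomial algebra, indexed by functions. -/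
def polyBasis (n : ℕ) : Module.Basis (Fin n → ℕ) ℂ (MvPolynomial (Fin n) ℂ) :=
  (MvPolynomial.basisMonomials (Fin n) ℂ).reindex Finsupp.equivFunOnFinite

theorem polyHom_polyBasis (u v : ℂ) (γ : Fin n → ℕ) :
    polyHom T n u v (polyBasis n γ) = yMonomial T n u v γ := by
  have h : polyBasis n γ =
      (List.ofFn fun i => (MvPolynomial.X i : MvPolynomial (Fin n) ℂ) ^ γ i).prod := by
    rw [List.prod_ofFn, polyBasis, Module.Basis.reindex_apply, MvPolynomial.coe_basisMonomials]
    dsimp only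
    rw [MvPolynomial.monomial_eq, MvPolynomial.C_1, one_mul, Finsupp.prod_fintype _ _ (by simp)]
    rfl
  simp only [h, yMonomial, map_list_prod, List.map_ofFn, Function.comp_def, map_pow, polyHom_X]

/-- The basis of the rational spin double affine Hecke algebra determined by a basis of the spin
Weyl group algebra. -/
def monomialBasis (hn : T.Admissible n) (u v : ℂ) {ι : Type*}
    (b : Module.Basis ι ℂ (SpinWeyl T n)) :
    Module.Basis ((Fin n → ℕ) × ι × (Fin n → ℕ)) ℂ (SDaHa T n u v) :=
  ((((skewBasis n).tensorProduct b).tensorProduct (polyBasis n)).reindex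
    (Equiv.prodAssoc _ _ _)).map (LinearEquiv.ofBijective _ (multMap_bijective u v hn))

theorem monomialBasis_apply (hn : T.Admissible n) (u v : ℂ) {ι : Type*}
    (b : Module.Basis ι ℂ (SpinWeyl T n)) (α : Fin n → ℕ) (σ : ι) (γ : Fin n → ℕ) :
    monomialBasis hn u v b (α, σ, γ) =
      xiMonomial T n u v α * spinHom T n u v (b σ) * yMonomial T n u v γ := by
  rw [monomialBasis, Module.Basis.map_apply, Module.Basis.reindex_apply,
    Equiv.prodAssoc_symm_apply, Module.Basis.tensorProduct_apply,
    Module.Basis.tensorProduct_apply, LinearEquiv.ofBijective_apply, multMap_tmul,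
    skewBasis_apply, skewHom_skewMonomial, polyHom_polyBasis]

end SpinDaha

end

theorem theorem5p7 (T : SpinDaha.ClassicalType) (n : ℕ) (hn : T.Admissible n) (u v : ℂ) :
    Function.Bijective (SpinDaha.multMap T n u v) ∧
      ∀ {ι : Type*} (b : Module.Basis ι ℂ (SpinDaha.SpinWeyl T n)),
        ∃ B : Module.Basis ((Fin n → ℕ) × ι × (Fin n → ℕ)) ℂ (SpinDaha.SDaHa T n u v),
          ∀ (α : Fin n → ℕ) (σ : ι) (γ : Fin n → ℕ),
            B (α, σ, γ) =
              SpinDaha.xiMonomial T n u v α * SpinDaha.spinHom T n u v (b σ) *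
                SpinDaha.yMonomial T n u v γ :=
  ⟨SpinDaha.multMap_bijective u v hn, fun b =>
    ⟨SpinDaha.monomialBasis hn u v b, SpinDaha.monomialBasis_apply hn u v b⟩⟩
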